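/- Let $d\ge 1$, $\alpha\in(0,1)$, $z=(t,x,v)\in\mathbb R\times\mathbb R^d\times\mathbb R^d$, and $\mathbb R^{1+2d}_T=(-\infty,T)\times\mathbb R^{2d}$ for $T\in(-\infty,\infty]$; for $r>0$ let $Q_r=(-r^2,0)\times B_{r^3}\times B_r$, where $B_s=\{y\in\mathbb R^d:|y|<s\}$. Functions are real-valued and measurable, functions equal almost everywhere are identified, and all derivatives of $u$ are understood in the sense of distributions. For $G=(t_0,t_1)\times D$ with $-\infty\le t_0<t_1\le\infty$ and $D\subset\mathbb R^{2d}$ open, put $$[u]_{L_\infty C^{\alpha/3,\alpha}_{x,v}(G)}=\operatorname*{ess\,sup}_{t\in(t_0,t_1)}\ \sup_{(x_1,v_1)\ne(x_2,v_2)\in D}\frac{|u(t,x_1,v_1)-u(t,x_2,v_2)|}{(|x_1-x_2|^{1/3}+|v_1-v_2|)^\alpha},$$ $$\|u\|_{L_\infty C^{\alpha/3,\alpha}_{x,v}(G)}=\|u\|_{L_\infty(G)}+[u]_{L_\infty C^{\alpha/3,\alpha}_{x,v}(G)},$$ and let $L_\infty C^{\alpha/3,\alpha}_{x,v}(G)$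 be the space of functions for which this norm is finite. Let $\mathbb C^{2,\alpha}(G)$ be the space of all $u$ such that $u$, $D_vu$, $D_v^2u$, $\partial_tu-v\cdot D_xu$ belong to $L_\infty C^{\alpha/3,\alpha}_{x,v}(G)$; its norm $\|u\|_{\mathbb C^{2,\alpha}(G)}$ is the sum of the four norms. With $$\rho(z,z_0)=\max\{|t-t_0|^{1/2},\ |x-x_0+(t-t_0)v_0|^{1/3},\ |v-v_0|\},$$ put $$[u]_{\mathcal C^\alpha(G)}=\sup_{z\neq z'\in G}\frac{|u(z)-u(z')|}{\rho(z,z')^\alpha},\qquad \mathcal C^\alpha(G)=\{u\in L_\infty(G):[u]_{\mathcal C^\alpha(G)}<\infty\},$$ and let $\mathcal C^{2,\alpha}(G)$ be the space of all $u\in\mathcal C^\alpha(G)$ such that $\partial_tu-v\cdot D_xu\in L_\infty C^{\alpha/3,\alpha}_{x,v}(G)$ and $D_v^2u$ is a function with $[D_v^2u]_{\mathcal C^\alpha(G)}<\infty$. (i) There is a constant $N=N(d,\alpha)$ such that for every $T\in(-\infty,\infty]$ and every $u\in\mathbb C^{2,\alpha}(\mathbb R^{1+2d}_T)$ one has $u\in\mathcal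 C^{2,\alpha}(\mathbb R^{1+2d}_T)$ and $$[D_v^2u]_{\mathcal C^\alpha(\mathbb R^{1+2d}_T)}\le N\left([\partial_tu-v\cdot D_xu]_{L_\infty C^{\alpha/3,\alpha}_{x,v}(\mathbb R^{1+2d}_T)}+[\Delta_vu]_{L_\infty C^{\alpha/3,\alpha}_{x,v}(\mathbb R^{1+2d}_T)}\right).$$ (ii) For all $0<r<R$ there is a constant $N=N(d,\alpha,r,R)$ such that every $u\in\mathbb C^{2,\alpha}(Q_R)$ belongs to $\mathcal C^{2,\alpha}(Q_r)$ and $$[D_v^2u]_{\mathcal C^\alpha(Q_r)}\le N\,\|u\|_{\mathbb C^{2,\alpha}(Q_R)}.$$ -/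

import Mathlib

open MeasureTheory Set
open scoped ENNReal NNReal ContDiff

noncomputable section

namespace KineticHolder

/-- The space `ℝ^d` with its Euclidean norm. -/
abbrev E (d : ℕ) : Type := EuclideanSpace ℝ (Fin d)

/-- Points `z = (t, x, v)` of `ℝ^{1+2d}`. -/
abbrev Z (d : ℕ) : Type := ℝ × E d × E d

/-! ### Domains

Domains are products `I × D` of a time interval `I` and a set `D` of pairs `(x, v)`. -/

/-- The time interval `(-∞, T)` for `T ∈ (-∞, ∞]`. -/
def timeBelow (T : WithTop ℝ) : Set ℝ := {t : ℝ | (t : WithTop ℝ) < T}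

/-- The time interval `(-r², 0)` of the kinetic cylinder `Q_r`. -/
def cylTime (r : ℝ) : Set ℝ := Ioo (-(r ^ 2)) 0

/-- The section `B_{r³} × B_r` of the kinetic cylinder `Q_r`, so that
`Q_r = cylTime r ×ˢ cylSpace d r`. -/
def cylSpace (d : ℕ) (r : ℝ) : Set (E d × E d) :=
  Metric.ball (0 : E d) (r ^ 3) ×ˢ Metric.ball (0 : E d) r

/-! ### Weak derivatives

All derivatives are in the sense of distributions on an open set `G` of `ℝ^{1+2d}`. -/

/-- Test functions: elements of `C_0^∞(G)`. -/
structure IsTest {d : ℕ} (G : Set (Z d)) (φ : Z d → ℝ) : Prop where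
  smooth : ContDiff ℝ ∞ φ
  compact : HasCompactSupport φ
  support : tsupport φ ⊆ G

/-- The classical partial derivative `∂φ/∂v_i`. -/
def partialV {d : ℕ} (i : Fin d) (φ : Z d → ℝ) (z : Z d) : ℝ :=
  fderiv ℝ φ z (0, 0, EuclideanSpace.single i 1)

/-- The classical transport derivative `∂_t φ - v · D_x φ` at `z = (t, x, v)`, that is the
derivative of `φ` in the direction `(1, -v, 0)`. -/
def transport {d : ℕ} (φ : Z d → ℝ) (z : Z d) : ℝ :=
  fderiv ℝ φ z (1, -z.2.2, 0)

/-- `Du` is the weak gradient `D_v u` in `G`. -/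
structure IsWeakGradV {d : ℕ} (G : Set (Z d)) (u : Z d → ℝ) (Du : Z d → E d) : Prop where
  locInt : LocallyIntegrableOn u G
  locInt_deriv : LocallyIntegrableOn Du G
  integral_eq : ∀ φ, IsTest G φ → ∀ i : Fin d,
    ∫ z in G, Du z i * φ z = -∫ z in G, u z * partialV i φ z

/-- `D2u` is the weak Hessian `D_v² u = (D_{v_i v_j} u)_{i,j}` in `G`. Matrices carry the
Euclidean (Frobenius) norm. -/
structure IsWeakHessV {d : ℕ} (G : Set (Z d)) (u : Z d → ℝ)
    (D2u : Z d → EuclideanSpace ℝ (Fin d × Fin d)) : Prop where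
  locInt : LocallyIntegrableOn u G
  locInt_deriv : LocallyIntegrableOn D2u G
  integral_eq : ∀ φ, IsTest G φ → ∀ i j : Fin d,
    ∫ z in G, D2u z (i, j) * φ z = ∫ z in G, u z * partialV i (partialV j φ) z

/-- `Yu` is the distribution `∂_t u - v · D_x u` in `G`. The formal adjoint of
`∂_t - v · D_x` is its negative. -/
structure IsWeakTransport {d : ℕ} (G : Set (Z d)) (u : Z d → ℝ) (Yu : Z d → ℝ) : Prop where
  locInt : LocallyIntegrableOn u G
  locInt_deriv : LocallyIntegrableOn Yu G
  integral_eq : ∀ φ, IsTest G φ →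
    ∫ z in G, Yu z * φ z = -∫ z in G, u z * transport φ z

/-- The Laplacian `Δ_v u`, the trace of the Hessian. -/
def laplV {d : ℕ} (D2u : Z d → EuclideanSpace ℝ (Fin d × Fin d)) (z : Z d) : ℝ :=
  ∑ i : Fin d, D2u z (i, i)

section Norms

variable {d : ℕ} {F : Type*} [NormedAddCommGroup F]

/-- The norm of `L_∞(G)`. -/
def linftyNorm (G : Set (Z d)) (u : Z d → F) : ℝ≥0∞ :=
  eLpNormEssSup u (volume.restrict G)

/-! ### Anisotropic Hölder spaces -/

/-- The seminorm of `C^{α/3, α}_{x, v}(D)`. -/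
def holderXVSeminorm (α : ℝ) (D : Set (E d × E d)) (w : E d × E d → F) : ℝ≥0∞ :=
  ⨆ (p ∈ D) (q ∈ D) (_ : p ≠ q),
    ‖w p - w q‖ₑ / ENNReal.ofReal ((‖p.1 - q.1‖ ^ (1 / 3 : ℝ) + ‖p.2 - q.2‖) ^ α)

/-- The seminorm of `L_∞ C^{α/3, α}_{x, v}(I × D)`. Elements of this space are classes of
functions modulo equality almost everywhere, whence the infimum over all representatives. Two
representatives that give a finite value agree on `D` for almost every `t`, so they give the same
value. -/
def linftyHolderSeminorm (α : ℝ) (I : Set ℝ) (D : Set (E d × E d)) (u : Z d → F) : ℝ≥0∞ :=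
  ⨅ (w : Z d → F) (_ : w =ᵐ[volume.restrict (I ×ˢ D)] u),
    essSup (fun t => holderXVSeminorm α D (fun p => w (t, p))) (volume.restrict I)

/-- The norm of `L_∞ C^{α/3, α}_{x, v}(I × D)`. -/
def linftyHolderNorm (α : ℝ) (I : Set ℝ) (D : Set (E d × E d)) (u : Z d → F) : ℝ≥0∞ :=
  linftyNorm (I ×ˢ D) u + linftyHolderSeminorm α I D u

/-- `u ∈ L_∞ C^{α/3, α}_{x, v}(I × D)`. -/
def MemLinftyHolder (α : ℝ) (I : Set ℝ) (D : Set (E d × E d)) (u : Z d → F) : Prop :=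
  AEStronglyMeasurable u (volume.restrict (I ×ˢ D)) ∧ linftyHolderNorm α I D u < ⊤

/-! ### Kinetic Hölder spaces -/

/-- The kinetic quasi-distance
`ρ(z, z₀) = max {|t - t₀|^{1/2}, |x - x₀ + (t - t₀) v₀|^{1/3}, |v - v₀|}`. -/
def rho (z z₀ : Z d) : ℝ :=
  max (|z.1 - z₀.1| ^ (1 / 2 : ℝ))
    (max (‖z.2.1 - z₀.2.1 + (z.1 - z₀.1) • z₀.2.2‖ ^ (1 / 3 : ℝ)) ‖z.2.2 - z₀.2.2‖)

/-- The kinetic Hölder seminorm on `G`. As above, functions are taken modulo equality almost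
everywhere, and on an open set all representatives with a finite value agree on `G`. -/
def kinSeminorm (α : ℝ) (G : Set (Z d)) (u : Z d → F) : ℝ≥0∞ :=
  ⨅ (w : Z d → F) (_ : w =ᵐ[volume.restrict G] u),
    ⨆ (z ∈ G) (z' ∈ G) (_ : z ≠ z'), ‖w z - w z'‖ₑ / ENNReal.ofReal (rho z z' ^ α)

/-- `u` belongs to the kinetic Hölder space of order `α` on `G`. -/
def MemKin (α : ℝ) (G : Set (Z d)) (u : Z d → F) : Prop :=
  AEStronglyMeasurable u (volume.restrict G) ∧ linftyNorm G u < ⊤ ∧ kinSeminorm α G u < ⊤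

end Norms

/-! ### The two spaces of order `2 + α` -/

/-- `u ∈ ℂ^{2,α}(I × D)`: the functions `u, D_v u, D_v² u, ∂_t u - v · D_x u` all belong to
`L_∞ C^{α/3, α}_{x, v}(I × D)`. -/
def MemC2 {d : ℕ} (α : ℝ) (I : Set ℝ) (D : Set (E d × E d)) (u : Z d → ℝ) : Prop :=
  MemLinftyHolder α I D u ∧
  (∃ Du, IsWeakGradV (I ×ˢ D) u Du ∧ MemLinftyHolder α I D Du) ∧
  (∃ D2u, IsWeakHessV (I ×ˢ D) u D2u ∧ MemLinftyHolder α I D D2u) ∧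
  (∃ Yu, IsWeakTransport (I ×ˢ D) u Yu ∧ MemLinftyHolder α I D Yu)

/-- The norm of `u` in `ℂ^{2,α}(I × D)`, where `Du = D_v u`, `D2u = D_v² u` and
`Yu = ∂_t u - v · D_x u`. -/
def c2Norm {d : ℕ} (α : ℝ) (I : Set ℝ) (D : Set (E d × E d)) (u : Z d → ℝ) (Du : Z d → E d)
    (D2u : Z d → EuclideanSpace ℝ (Fin d × Fin d)) (Yu : Z d → ℝ) : ℝ≥0∞ :=
  linftyHolderNorm α I D u + linftyHolderNorm α I D Du + linftyHolderNorm α I D D2u +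
    linftyHolderNorm α I D Yu

/-- `u` belongs to the kinetic Hölder space of order `2 + α` on `I × D`: `u` is in the kinetic
Hölder space of order `α`, `∂_t u - v · D_x u ∈ L_∞ C^{α/3, α}_{x, v}(I × D)`, and `D_v² u` is a
function with finite kinetic Hölder seminorm of order `α`. -/
def MemKin2 {d : ℕ} (α : ℝ) (I : Set ℝ) (D : Set (E d × E d)) (u : Z d → ℝ) : Prop :=
  MemKin α (I ×ˢ D) u ∧
  (∃ Yu, IsWeakTransport (I ×ˢ D) u Yu ∧ MemLinftyHolder α I D Yu) ∧
  (∃ D2u, IsWeakHessV (I ×ˢ D) u D2u ∧ kinSeminorm α (I ×ˢ D) D2u < ⊤)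

end KineticHolder

end

/-!
The two estimates are first proved a priori, for smooth functions `U` on a time interval that is
unbounded below, and then transferred to weak derivatives by mollification.

**A priori estimate** (`exists_kinetic_bound`). Let `Γ` be the `(x, v)`-Hölder constant of `D_v² U`
on time slices, and let `M` bound those of `Y U = ∂_t U - v · D_x U` and of `Δ_v U`.
* *Regularity in `x`* (`exists_hol_x`). By Taylor expansion, third differences of `U` in a direction
  `(0, w)` with `|w| = ε` are `O(Γ ε^{2 + α})`. Moving back in time by `ε²` along the
  characteristics turns a difference in the direction `(-ε² w, w)` into one in the direction
  `(0, w)`, at the cost of `O(M ε^{2 + α})`. Fifth differences in the direction `(-ε² w, 0)` are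
  combinations of these two, and Marchaud's inequality for the bounded function `U` gives Hölder
  continuity of order `(2 + α) / 3 < 1` in `x` with a constant `O(Γ + M)`, independent of
  `sup |U|`.
* *Regularity in time* (`exists_hol_time`). The same transport argument, applied to second
  differences in `v` with step `√h`, compares `D_v² U` at times `t` and `t - h` along a
  characteristic up to `O((Γ + M) h^{α/2})`.
* *Absorption* (`exists_absorb`, `exists_slice_bound`). Averages of `D_v² U` in `v` at scale `r`
  differ from `D_v² U` by `O(M r^α)`, since their derivative in the scale only involves `Δ_v U`
  (`IsKernel.exists_average_sub_le`). At a scale `L` times the distance of the two points, the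
  averages themselves differ by a small multiple of `Γ + M`: in `v` because the kernel is Lipschitz
  continuous, in `x` because two derivatives can be moved to the kernel and `U` is regular in `x`.
  So `Γ` may be replaced by `Γ / 2 + C M`. Iterating this, which is allowed as `Γ` is finite, gives
  `Γ ≤ 2 C M`.

**Weak derivatives.** Convolution on the kinetic group, `z ↦ ∫ φ(z₀) u(z₀ ∘ z) dz₀`, commutes with
`D_v` and `Y` and preserves the Hölder seminorms on time slices. For `φ` supported at negative
times it only looks into the past, so no room is lost below the final time. As the mollifications
converge almost everywhere and satisfy the estimate uniformly, their limit along an ultrafilter is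
a representative of `D_v² u` for which the estimate holds at all points
(`kinSeminorm_le_of_tendsto`). This is the global estimate (`exists_global_estimate`). For the
interior estimate (`exists_interior_estimate`), the mollifications are multiplied by a cutoff
function and the a priori estimate is applied for all negative times; the product rule and the
bounds of `u` and `D_v u` control the commutators (`exists_smooth_interior_bound`).
-/

noncomputable section

namespace KineticHolder

open Filter Topology

/-! ### Finite differences -/

/-- A bounded function with `φ(s) ≤ φ(2s) / 2 + A s ^ γ` and `γ < 1` is `O(s ^ γ)`. -/
lemma le_of_le_half_double {γ : ℝ} (hγ : γ < 1) {φ : ℝ → ℝ} {A B : ℝ}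
    (hB : ∀ s, 0 < s → φ s ≤ B)
    (h : ∀ s, 0 < s → φ s ≤ φ (2 * s) / 2 + A * s ^ γ) {s : ℝ} (hs : 0 < s) :
    φ s ≤ (1 - 2 ^ (γ - 1))⁻¹ * A * s ^ γ := by
  set κ : ℝ := 2 ^ (γ - 1) with hκ
  have hκ1 : κ < 1 := Real.rpow_lt_one_of_one_lt_of_neg (by norm_num) (by linarith)
  have hκ0 : 0 < κ := by positivity
  have h2 : (2 : ℝ) ^ γ = 2 * κ := by
    rw [hκ, Real.rpow_sub_one (by norm_num)]; ring
  have key : ∀ n : ℕ, ∀ s, 0 < s →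
      φ s ≤ B / 2 ^ n + (1 - κ)⁻¹ * (1 - κ ^ n) * A * s ^ γ := by
    intro n
    induction n with
    | zero => intro s hs; simpa using hB s hs
    | succ n ih =>
      intro s hs
      have h1 := h s hs
      have h3 := ih (2 * s) (by positivity)
      rw [Real.mul_rpow (by norm_num) hs.le, h2] at h3
      have hne : 1 - κ ≠ 0 := by linarith
      have : B / 2 ^ (n + 1) + (1 - κ)⁻¹ * (1 - κ ^ (n + 1)) * A * s ^ γ =
          (B / 2 ^ n + (1 - κ)⁻¹ * (1 - κ ^ n) * A * (2 * κ * s ^ γ)) / 2 + A * s ^ γ := by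
        field_simp
        ring
      linarith
  have hlim : Tendsto (fun n : ℕ => B / 2 ^ n + (1 - κ)⁻¹ * (1 - κ ^ n) * A * s ^ γ) atTop
      (𝓝 (0 + (1 - κ)⁻¹ * (1 - 0) * A * s ^ γ)) := by
    have e1 := tendsto_pow_atTop_nhds_zero_of_lt_one hκ0.le hκ1
    have e2 : Tendsto (fun n : ℕ => B / 2 ^ n) atTop (𝓝 0) := by
      have := (tendsto_pow_atTop_nhds_zero_of_lt_one (r := (1 / 2 : ℝ)) (by norm_num)
        (by norm_num)).const_mul B
      simpa [div_eq_mul_inv] using this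
    exact e2.add ((((e1.const_sub 1).const_mul _).mul_const _).mul_const _)
  have := ge_of_tendsto' hlim (fun n => key n s hs)
  simpa using this

/-- The forward difference of order `n` of `f` at `a` with step `s`. -/
def fdiff (f : ℝ → ℝ) : ℕ → ℝ → ℝ → ℝ
  | 0, _, a => f a
  | n + 1, s, a => fdiff f n s (a + s) - fdiff f n s a

lemma fdiff_bound {f : ℝ → ℝ} {B : ℝ} (hB : ∀ a, |f a| ≤ B) (n : ℕ) (s a : ℝ) :
    |fdiff f n s a| ≤ 2 ^ n * B := by
  induction n generalizing a with
  | zero => simpa [fdiff] using hB a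
  | succ n ih =>
    have h1 := abs_le.1 (ih (a + s))
    have h2 := abs_le.1 (ih a)
    rw [fdiff, abs_le, pow_succ]
    constructor <;> linarith [h1.1, h1.2, h2.1, h2.2]

/-- A bound on the differences of order `n + 1` gives one on those of order `n`, for
`1 ≤ n ≤ 4`. -/
lemma fdiff_descend {γ : ℝ} (hγ : γ < 1) {f : ℝ → ℝ} {A B : ℝ}
    (hB : ∀ a, |f a| ≤ B) {n : ℕ} (hn : 1 ≤ n) (hn4 : n ≤ 4)
    (h : ∀ s a, 0 < s → |fdiff f (n + 1) s a| ≤ A * s ^ γ) (s a : ℝ) (hs : 0 < s) :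
    |fdiff f n s a| ≤ (1 - 2 ^ (γ - 1))⁻¹ * (2 * A) * s ^ γ := by
  have hA : ∀ s, 0 < s → 0 ≤ A * s ^ γ := fun s hs => (abs_nonneg _).trans (h s a hs)
  refine le_of_le_half_double hγ (φ := fun s => |fdiff f n s a|)
    (fun s _ => fdiff_bound hB n s a) ?_ hs
  intro s hs
  -- `(T² - 1)ⁿ = 2ⁿ (T - 1)ⁿ + P(T) (T - 1)ⁿ⁺¹` for the shift `T` by `s`
  have h0 := abs_le.1 (h s a hs)
  have h1 := abs_le.1 (h s (a + s) hs)
  have h2 := abs_le.1 (h s (a + s + s) hs)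
  have h3 := abs_le.1 (h s (a + s + s + s) hs)
  have hAs := hA s hs
  have e2 : a + 2 * s = a + s + s := by ring
  have e4 : a + s + s + 2 * s = a + s + s + s + s := by ring
  have e6 : a + s + s + s + s + 2 * s = a + s + s + s + s + s + s := by ring
  have e8 : a + s + s + s + s + s + s + 2 * s = a + s + s + s + s + s + s + s + s := by ring
  obtain ⟨h0l, h0r⟩ := h0
  obtain ⟨h1l, h1r⟩ := h1
  obtain ⟨h2l, h2r⟩ := h2
  obtain ⟨h3l, h3r⟩ := h3
  have key : |fdiff f n s a| ≤ |fdiff f n (2 * s) a| / 2 + 2 * (A * s ^ γ) := by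
    have p1 := le_abs_self (fdiff f n (2 * s) a)
    have p2 := neg_abs_le (fdiff f n (2 * s) a)
    have p3 := abs_nonneg (fdiff f n (2 * s) a)
    set W := |fdiff f n (2 * s) a|
    clear_value W
    rw [abs_le]
    interval_cases n <;> simp only [fdiff, e2, e4, e6, e8] at * <;> constructor <;> linarith
  calc _ ≤ _ := key
    _ = _ := by ring

/-- **Marchaud's inequality**: a bounded function on `ℝ` whose fifth differences with step `s` are
`O(s ^ γ)` with `γ < 1` has first differences of that size. -/
lemma marchaud_five {γ : ℝ} (hγ : γ < 1) :
    ∃ C : ℝ, 0 ≤ C ∧ ∀ (f : ℝ → ℝ) (A B : ℝ), (∀ a, |f a| ≤ B) →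
      (∀ s a, 0 < s → |fdiff f 5 s a| ≤ A * s ^ γ) → |f 1 - f 0| ≤ C * A := by
  set c : ℝ := (1 - 2 ^ (γ - 1))⁻¹ with hc
  have hc0 : 0 ≤ c := by
    have : (2 : ℝ) ^ (γ - 1) < 1 :=
      Real.rpow_lt_one_of_one_lt_of_neg (by norm_num) (by linarith)
    rw [hc]
    exact inv_nonneg.2 (by linarith)
  refine ⟨c * (2 * (c * (2 * (c * (2 * (c * 2)))))), by positivity, fun f A B hB h => ?_⟩
  have h4 := fdiff_descend hγ hB (n := 4) (by norm_num) le_rfl h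
  have h3 := fdiff_descend hγ hB (n := 3) (by norm_num) (by norm_num) h4
  have h2 := fdiff_descend hγ hB (n := 2) (by norm_num) (by norm_num) h3
  have h1 := fdiff_descend hγ hB (n := 1) (by norm_num) (by norm_num) h2 1 0 one_pos
  simp only [fdiff, zero_add, Real.one_rpow, mul_one] at h1
  rw [← hc] at h1
  linarith

/-- On a two-dimensional grid with shifts `X`, `M`, the polynomial `(X - 1)⁵` belongs to the ideal
generated by `(M - 1)³` and `(X M - 1)³`, because `X - 1 = (X M - 1) - X (M - 1)`. -/
lemma fifth_diff_le {W : ℕ → ℕ → ℝ} {A : ℝ}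
    (h0 : ∀ j m, |W j (m + 3) - 3 * W j (m + 2) + 3 * W j (m + 1) - W j m| ≤ A)
    (h1 : ∀ j m, |W (j + 3) (m + 3) - 3 * W (j + 2) (m + 2) + 3 * W (j + 1) (m + 1) - W j m| ≤ A) :
    |W 5 0 - 5 * W 4 0 + 10 * W 3 0 - 10 * W 2 0 + 5 * W 1 0 - W 0 0| ≤ 80 * A := by
  obtain ⟨l0, r0⟩ := abs_le.1 (h1 2 2)
  obtain ⟨l1, r1⟩ := abs_le.1 (h1 1 1)
  obtain ⟨l2, r2⟩ := abs_le.1 (h1 0 0)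
  obtain ⟨l3, r3⟩ := abs_le.1 (h1 2 1)
  obtain ⟨l4, r4⟩ := abs_le.1 (h1 1 0)
  obtain ⟨l5, r5⟩ := abs_le.1 (h1 2 0)
  obtain ⟨l6, r6⟩ := abs_le.1 (h0 5 2)
  obtain ⟨l7, r7⟩ := abs_le.1 (h0 5 1)
  obtain ⟨l8, r8⟩ := abs_le.1 (h0 5 0)
  obtain ⟨l9, r9⟩ := abs_le.1 (h0 4 1)
  obtain ⟨l10, r10⟩ := abs_le.1 (h0 4 0)
  obtain ⟨l11, r11⟩ := abs_le.1 (h0 3 0)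
  rw [abs_le]
  norm_num only at *
  constructor <;> linarith

/-- Second order Taylor expansion with a bound on the oscillation of the second derivative. -/
lemma taylor_two {φ φ' φ'' : ℝ → ℝ} (h1 : ∀ s, HasDerivAt φ (φ' s) s)
    (h2 : ∀ s, HasDerivAt φ' (φ'' s) s) {S A : ℝ} (hS : 0 ≤ S)
    (hA : ∀ s ∈ Icc 0 S, |φ'' s - φ'' 0| ≤ A) :
    |φ S - φ 0 - φ' 0 * S - φ'' 0 * S ^ 2 / 2| ≤ A * S ^ 2 := by
  have hA0 : 0 ≤ A := (abs_nonneg _).trans (hA 0 ⟨le_rfl, hS⟩)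
  have a1 : ∀ s ∈ Icc 0 S, |φ' s - φ' 0 - φ'' 0 * s| ≤ A * S := by
    intro s hs
    have := (convex_Icc (0 : ℝ) S).norm_image_sub_le_of_norm_hasDerivWithin_le
      (f := fun s => φ' s - φ'' 0 * s) (f' := fun s => φ'' s - φ'' 0) (C := A)
      (fun x hx => ((h2 x).sub
        (by simpa using (hasDerivAt_id x).const_mul (φ'' 0))).hasDerivWithinAt)
      (fun x hx => hA x hx) (left_mem_Icc.2 hS) hs
    simp only [mul_zero, sub_zero, Real.norm_eq_abs, abs_of_nonneg hs.1] at this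
    calc _ = |φ' s - φ'' 0 * s - φ' 0| := by ring_nf
      _ ≤ A * s := this
      _ ≤ A * S := by gcongr; exact hs.2
  have := (convex_Icc (0 : ℝ) S).norm_image_sub_le_of_norm_hasDerivWithin_le
      (f := fun s => φ s - φ' 0 * s - φ'' 0 * s ^ 2 / 2)
      (f' := fun s => φ' s - φ' 0 - φ'' 0 * s) (C := A * S)
      (fun x hx => by
        have e : HasDerivAt (fun s : ℝ => φ'' 0 * s ^ 2 / 2) (φ'' 0 * x) x := by
          have := ((hasDerivAt_pow 2 x).const_mul (φ'' 0)).div_const 2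
          refine this.congr_deriv ?_
          norm_num
          ring
        exact (((h1 x).sub (by simpa using (hasDerivAt_id x).const_mul (φ' 0))).sub
          e).hasDerivWithinAt)
      a1 (left_mem_Icc.2 hS) (right_mem_Icc.2 hS)
  simp only [mul_zero, sub_zero, Real.norm_eq_abs, abs_of_nonneg hS] at this
  calc _ = |φ S - φ' 0 * S - φ'' 0 * S ^ 2 / 2 - φ 0| := by ring_nf
    _ ≤ A * S * S := by simpa using this
    _ = _ := by ring

lemma third_diff_le {φ φ' φ'' : ℝ → ℝ} (h1 : ∀ s, HasDerivAt φ (φ' s) s)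
    (h2 : ∀ s, HasDerivAt φ' (φ'' s) s) {A : ℝ}
    (hA : ∀ s ∈ Icc (0 : ℝ) 3, |φ'' s - φ'' 0| ≤ A) :
    |φ 3 - 3 * φ 2 + 3 * φ 1 - φ 0| ≤ 24 * A := by
  have e1 := abs_le.1 (taylor_two h1 h2 (S := 1) (by norm_num)
    fun s hs => hA s ⟨hs.1, hs.2.trans (by norm_num)⟩)
  have e2 := abs_le.1 (taylor_two h1 h2 (S := 2) (by norm_num)
    fun s hs => hA s ⟨hs.1, hs.2.trans (by norm_num)⟩)
  have e3 := abs_le.1 (taylor_two h1 h2 (S := 3) (by norm_num)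
    fun s hs => hA s ⟨hs.1, hs.2.trans (by norm_num)⟩)
  rw [abs_le]
  constructor <;> nlinarith [e1.1, e1.2, e2.1, e2.2, e3.1, e3.2]

lemma second_diff_le {φ φ' φ'' : ℝ → ℝ} (h1 : ∀ s, HasDerivAt φ (φ' s) s)
    (h2 : ∀ s, HasDerivAt φ' (φ'' s) s) {A : ℝ}
    (hA : ∀ s ∈ Icc (-1 : ℝ) 1, |φ'' s - φ'' 0| ≤ A) :
    |φ 1 + φ (-1) - 2 * φ 0 - φ'' 0| ≤ 2 * A := by
  have e1 := abs_le.1 (taylor_two h1 h2 (S := 1) (by norm_num)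
    fun s hs => hA s ⟨by linarith [hs.1], hs.2⟩)
  have e2 := abs_le.1 (taylor_two (φ := fun s => φ (-s)) (φ' := fun s => -φ' (-s))
    (φ'' := fun s => φ'' (-s)) (S := 1) (A := A)
    (fun s => by simpa [Function.comp_def] using (h1 (-s)).comp s (hasDerivAt_neg s))
    (fun s => by
      have := ((h2 (-s)).comp s (hasDerivAt_neg s)).neg
      rw [mul_neg_one, neg_neg] at this
      exact this) (by norm_num)
    fun s hs => by simpa using hA (-s) ⟨by linarith [hs.2], by linarith [hs.1]⟩)
  simp only [neg_zero] at e2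
  rw [abs_le]
  constructor <;> nlinarith [e1.1, e1.2, e2.1, e2.2]

variable {d : ℕ}

/-! ### Derivatives along the vector fields `D_v` and `∂_t - v · D_x` -/

/-- The derivative of `U` in the direction `e` of the `v` variable. -/
def DV (e : E d) (U : Z d → ℝ) (z : Z d) : ℝ := fderiv ℝ U z (0, 0, e)

/-- The distance of the anisotropic Hölder spaces in `(x, v)`. -/
def dXV (p q : E d × E d) : ℝ := ‖p.1 - q.1‖ ^ (1 / 3 : ℝ) + ‖p.2 - q.2‖

/-- At every time in `I`, the function `f` is Hölder continuous of order `α` with constant `C` in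
`(x, v) ∈ D`. -/
def HolXV (α C : ℝ) (I : Set ℝ) (D : Set (E d × E d)) (f : Z d → ℝ) : Prop :=
  ∀ t ∈ I, ∀ p ∈ D, ∀ q ∈ D, |f (t, p) - f (t, q)| ≤ C * dXV p q ^ α

lemma dXV_nonneg (p q : E d × E d) : 0 ≤ dXV p q := by unfold dXV; positivity

lemma dXV_same_left (x v w : E d) : dXV (x, v) (x, w) = ‖v - w‖ := by
  simp [dXV, Real.zero_rpow]

lemma contDiff_DV {U : Z d → ℝ} (hU : ContDiff ℝ ∞ U) (e : E d) : ContDiff ℝ ∞ (DV e U) := by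
  have := (contDiff_infty_iff_fderiv.1 hU).2
  unfold DV
  fun_prop

lemma contDiff_transport {U : Z d → ℝ} (hU : ContDiff ℝ ∞ U) : ContDiff ℝ ∞ (transport U) := by
  have := (contDiff_infty_iff_fderiv.1 hU).2
  unfold transport
  fun_prop

lemma partialV_eq_DV (i : Fin d) : partialV i = DV (EuclideanSpace.single i (1 : ℝ)) := rfl

lemma hasDerivAt_v {U : Z d → ℝ} (hU : ContDiff ℝ ∞ U) (t : ℝ) (x v e : E d) (s : ℝ) :
    HasDerivAt (fun s : ℝ => U (t, x, v + s • e)) (DV e U (t, x, v + s • e)) s := by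
  have h1 : HasDerivAt (fun s : ℝ => ((t, x, v + s • e) : Z d)) (0, 0, e) s := by
    have : HasDerivAt (fun s : ℝ => v + s • e) e s := by
      simpa using ((hasDerivAt_id s).smul_const e).const_add v
    exact (hasDerivAt_const s t).prodMk ((hasDerivAt_const s x).prodMk this)
  exact ((hU.differentiable (by simp)) (t, x, v + s • e)).hasFDerivAt.comp_hasDerivAt s h1

lemma hasDerivAt_transport {U : Z d → ℝ} (hU : ContDiff ℝ ∞ U) (t : ℝ) (x v : E d) (s : ℝ) :
    HasDerivAt (fun s : ℝ => U (t - s, x + s • v, v)) (-transport U (t - s, x + s • v, v)) s := by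
  have h1 : HasDerivAt (fun s : ℝ => ((t - s, x + s • v, v) : Z d)) (-1, v, 0) s := by
    have h2 : HasDerivAt (fun s : ℝ => x + s • v) v s := by
      simpa using ((hasDerivAt_id s).smul_const v).const_add x
    have h3 : HasDerivAt (fun s : ℝ => t - s) (-1) s := by
      simpa using (hasDerivAt_id s).const_sub t
    exact h3.prodMk (h2.prodMk (hasDerivAt_const s v))
  have := ((hU.differentiable (by simp)) (t - s, x + s • v, v)).hasFDerivAt.comp_hasDerivAt s h1
  refine this.congr_deriv ?_
  rw [transport, ← map_neg]
  simp

lemma DV_smul (c : ℝ) (e : E d) (U : Z d → ℝ) : DV (c • e) U = c • DV e U := by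
  ext z
  simp only [DV, Pi.smul_apply, ← map_smul]
  simp

lemma DV_const_smul (c : ℝ) (e : E d) (U : Z d → ℝ) : DV e (c • U) = c • DV e U := by
  ext z
  simp only [DV, Pi.smul_apply]
  rw [fderiv_const_smul_field]
  rfl

lemma DV_DV_smul (c : ℝ) (e : E d) (U : Z d → ℝ) (z : Z d) :
    DV (c • e) (DV (c • e) U) z = c ^ 2 * DV e (DV e U) z := by
  rw [DV_smul, DV_smul, DV_const_smul]
  simp only [Pi.smul_apply, smul_eq_mul]
  ring

/-! ### Regularity in `x` -/

lemma third_diff_v {α Γ : ℝ} (hα₀ : 0 < α) (hα₁ : α < 1) (hΓ : 0 ≤ Γ) {I : Set ℝ} {U : Z d → ℝ}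
    (hU : ContDiff ℝ ∞ U) (hq : ∀ e : E d, HolXV α (Γ * ‖e‖ ^ 2) I univ (DV e (DV e U)))
    {t : ℝ} (ht : t ∈ I) (x v w : E d) :
    |U (t, x, v + (3 : ℝ) • w) - 3 * U (t, x, v + (2 : ℝ) • w) + 3 * U (t, x, v + (1 : ℝ) • w)
      - U (t, x, v)| ≤ 72 * (Γ * ‖w‖ ^ 2 * ‖w‖ ^ α) := by
  have := third_diff_le (φ := fun s : ℝ => U (t, x, v + s • w))
    (φ' := fun s : ℝ => DV w U (t, x, v + s • w))
    (φ'' := fun s : ℝ => DV w (DV w U) (t, x, v + s • w)) (A := 3 * (Γ * ‖w‖ ^ 2 * ‖w‖ ^ α))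
    (fun s => hasDerivAt_v hU t x v w s) (fun s => hasDerivAt_v (contDiff_DV hU w) t x v w s)
    (fun s hs => by
      refine (hq w t ht _ (mem_univ _) _ (mem_univ _)).trans ?_
      rw [dXV_same_left]
      have h1 : ‖v + s • w - (v + (0 : ℝ) • w)‖ = s * ‖w‖ := by
        rw [zero_smul, add_zero, add_sub_cancel_left, norm_smul, Real.norm_of_nonneg hs.1]
      have h2 : (s * ‖w‖) ^ α ≤ 3 * ‖w‖ ^ α := by
        rw [Real.mul_rpow hs.1 (norm_nonneg _)]
        have : s ^ α ≤ 3 := calc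
          s ^ α ≤ 3 ^ α := Real.rpow_le_rpow hs.1 hs.2 hα₀.le
          _ ≤ 3 ^ (1 : ℝ) := Real.rpow_le_rpow_of_exponent_le (by norm_num) hα₁.le
          _ = 3 := by norm_num
        gcongr
      rw [h1]
      calc Γ * ‖w‖ ^ 2 * (s * ‖w‖) ^ α ≤ Γ * ‖w‖ ^ 2 * (3 * ‖w‖ ^ α) := by gcongr
        _ = _ := by ring)
  simp only [zero_smul, add_zero] at this
  linarith

lemma abs_sub_le_of_hasDerivAt {ψ ψ' : ℝ → ℝ} (h : ∀ s, HasDerivAt ψ (ψ' s) s) {S C : ℝ}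
    (hS : 0 ≤ S) (hC : ∀ s ∈ Icc 0 S, |ψ' s| ≤ C) : |ψ S - ψ 0| ≤ C * S := by
  have := (convex_Icc (0 : ℝ) S).norm_image_sub_le_of_norm_hasDerivWithin_le
    (fun s _ => (h s).hasDerivWithinAt) hC (left_mem_Icc.2 hS) (right_mem_Icc.2 hS)
  simpa [abs_of_nonneg hS] using this

/-- The third difference of `U` in the direction `(-ε² w, w)` with `|w| = ε` is small: transported
to time `t - ε²`, it becomes a third difference in `v`. -/
lemma third_diff_transport {α Γ M : ℝ} (hα₀ : 0 < α) (hα₁ : α < 1) (hΓ : 0 ≤ Γ) (hM : 0 ≤ M)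
    {I : Set ℝ} (hI : IsLowerSet I) {U : Z d → ℝ} (hU : ContDiff ℝ ∞ U)
    (hq : ∀ e : E d, HolXV α (Γ * ‖e‖ ^ 2) I univ (DV e (DV e U)))
    (hY : HolXV α M I univ (transport U)) {t : ℝ} (ht : t ∈ I) {ε : ℝ} (hε : 0 < ε)
    (x v w : E d) (hw : ‖w‖ = ε) :
    |U (t, x + (3 : ℝ) • (-(ε ^ 2) • w), v + (3 : ℝ) • w)
      - 3 * U (t, x + (2 : ℝ) • (-(ε ^ 2) • w), v + (2 : ℝ) • w)
      + 3 * U (t, x + (1 : ℝ) • (-(ε ^ 2) • w), v + (1 : ℝ) • w)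
      - U (t, x, v)| ≤ 72 * (Γ + M) * ε ^ (2 + α) := by
  have hεα : ε ^ (2 + α) = ε ^ 2 * ε ^ α := by
    rw [Real.rpow_add hε]; norm_num
  -- the point with label `k`, followed backwards along its characteristic
  let P : ℝ → ℝ → Z d := fun k s =>
    (t - s, x + k • (-(ε ^ 2) • w) + s • (v + k • w), v + k • w)
  have hd : ∀ k s, HasDerivAt (fun s => U (P k s)) (-transport U (P k s)) s :=
    fun k s => hasDerivAt_transport hU t _ _ s
  have hmv := abs_sub_le_of_hasDerivAt (S := ε ^ 2) (C := 35 * M * ε ^ α)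
    (ψ := fun s => U (P 3 s) - 3 * U (P 2 s) + 3 * U (P 1 s) - U (P 0 s))
    (fun s => ((((hd 3 s).sub ((hd 2 s).const_mul 3)).add ((hd 1 s).const_mul 3)).sub (hd 0 s)))
    (by positivity) (fun s hs => by
      have hY' : ∀ k ∈ Icc (0 : ℝ) 3,
          |transport U (P k s) - transport U (P 0 s)| ≤ 5 * M * ε ^ α := by
        intro k hk
        refine (hY (t - s) (hI (by linarith [hs.1] : t - s ≤ t) ht) _ (mem_univ _) _
          (mem_univ _)).trans ?_
        have h1 : dXV (P k s).2 (P 0 s).2 ≤ 5 * ε := by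
          have e1 : (P k s).2.1 - (P 0 s).2.1 = (k * (s - ε ^ 2)) • w := by
            simp only [P]; module
          have e2 : (P k s).2.2 - (P 0 s).2.2 = k • w := by
            simp only [P]; module
          have h3 : ‖(k * (s - ε ^ 2)) • w‖ ≤ (2 * ε) ^ 3 := by
            rw [norm_smul, hw, Real.norm_eq_abs, abs_mul, abs_of_nonneg hk.1,
              abs_of_nonpos (by linarith [hs.2])]
            have : k * (-(s - ε ^ 2)) ≤ 3 * ε ^ 2 :=
              mul_le_mul hk.2 (by linarith [hs.1]) (by linarith [hs.2]) (by norm_num)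
            nlinarith [pow_pos hε 3]
          rw [dXV, e1, e2, norm_smul k w, hw, Real.norm_of_nonneg hk.1]
          have h4 : ‖(k * (s - ε ^ 2)) • w‖ ^ (1 / 3 : ℝ) ≤ 2 * ε := by
            calc _ ≤ ((2 * ε) ^ 3) ^ (1 / 3 : ℝ) :=
                  Real.rpow_le_rpow (norm_nonneg _) h3 (by norm_num)
              _ = 2 * ε := by
                  rw [← Real.rpow_natCast, ← Real.rpow_mul (by positivity)]; norm_num
          nlinarith [hk.2]
        have h2 : dXV (P k s).2 (P 0 s).2 ^ α ≤ 5 * ε ^ α := by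
          calc _ ≤ (5 * ε) ^ α := Real.rpow_le_rpow (dXV_nonneg _ _) h1 hα₀.le
            _ = 5 ^ α * ε ^ α := Real.mul_rpow (by norm_num) hε.le
            _ ≤ 5 ^ (1 : ℝ) * ε ^ α := by
              gcongr
              norm_num
            _ = _ := by norm_num
        calc _ ≤ M * (5 * ε ^ α) := by gcongr
          _ = _ := by ring
      have a1 := abs_le.1 (hY' 1 (by norm_num))
      have a2 := abs_le.1 (hY' 2 (by norm_num))
      have a3 := abs_le.1 (hY' 3 (by norm_num))
      rw [abs_le]
      constructor <;> linarith [a1.1, a1.2, a2.1, a2.2, a3.1, a3.2])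
  have h3 := third_diff_v hα₀ hα₁ hΓ hU hq
    (hI (by nlinarith : t - ε ^ 2 ≤ t) ht) (x + ε ^ 2 • v) v w
  have hP : ∀ k : ℝ, P k (ε ^ 2) = (t - ε ^ 2, x + ε ^ 2 • v, v + k • w) := by
    intro k
    simp only [P, Prod.mk.injEq, true_and, and_true]
    module
  have hP0 : ∀ k : ℝ, P k 0 = (t, x + k • (-(ε ^ 2) • w), v + k • w) := by
    intro k
    simp [P]
  simp only [hP, hP0, zero_smul, add_zero] at hmv
  rw [hw] at h3
  rw [abs_le] at h3 hmv ⊢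
  rw [hεα]
  have : 0 ≤ M * (ε ^ 2 * ε ^ α) := by positivity
  constructor <;> nlinarith [h3.1, h3.2, hmv.1, hmv.2]

/-- A fifth difference in `x` is a combination of third differences in the directions `(0, w)` and
`(-ε² w, w)`, where `ε = |y|^{1/3}` and `ε² w = -y`. -/
lemma fifth_diff_x {α Γ M : ℝ} (hα₀ : 0 < α) (hα₁ : α < 1) (hΓ : 0 ≤ Γ) (hM : 0 ≤ M)
    {I : Set ℝ} (hI : IsLowerSet I) {U : Z d → ℝ} (hU : ContDiff ℝ ∞ U)
    (hq : ∀ e : E d, HolXV α (Γ * ‖e‖ ^ 2) I univ (DV e (DV e U)))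
    (hY : HolXV α M I univ (transport U)) {t : ℝ} (ht : t ∈ I) (x v y : E d) :
    |U (t, x + (5 : ℝ) • y, v) - 5 * U (t, x + (4 : ℝ) • y, v) + 10 * U (t, x + (3 : ℝ) • y, v)
      - 10 * U (t, x + (2 : ℝ) • y, v) + 5 * U (t, x + (1 : ℝ) • y, v) - U (t, x, v)|
      ≤ 5760 * (Γ + M) * ‖y‖ ^ ((2 + α) / 3) := by
  rcases eq_or_ne y 0 with rfl | hy
  · simp only [smul_zero, add_zero]
    have : 0 ≤ 5760 * (Γ + M) * ‖(0 : E d)‖ ^ ((2 + α) / 3) := by positivity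
    convert this using 1
    rw [abs_eq_zero]
    ring
  have hy' : 0 < ‖y‖ := norm_pos_iff.2 hy
  set ε : ℝ := ‖y‖ ^ (1 / 3 : ℝ) with hεdef
  have hε : 0 < ε := by positivity
  have hε3 : ε ^ 3 = ‖y‖ := by
    rw [hεdef, ← Real.rpow_natCast, ← Real.rpow_mul hy'.le]; norm_num
  have hpow : ‖y‖ ^ ((2 + α) / 3) = ε ^ (2 + α) := by
    rw [hεdef, ← Real.rpow_mul hy'.le]; congr 1; ring
  set w : E d := (-(ε ^ 2)⁻¹) • y with hwdef
  have hwn : ‖w‖ = ε := by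
    rw [hwdef, norm_smul, norm_neg, Real.norm_of_nonneg (by positivity), ← hε3]
    field_simp
  have hwy : -(ε ^ 2) • w = y := by
    rw [hwdef, smul_smul, neg_mul_neg, mul_inv_cancel₀ (by positivity), one_smul]
  have hεα : ε ^ (2 + α) = ε ^ 2 * ε ^ α := by
    rw [Real.rpow_add hε]; norm_num
  have := fifth_diff_le (W := fun j m => U (t, x + (j : ℝ) • y, v + (m : ℝ) • w))
    (A := 72 * (Γ + M) * ε ^ (2 + α))
    (fun j m => by
      have h := third_diff_v hα₀ hα₁ hΓ hU hq ht (x + (j : ℝ) • y) (v + (m : ℝ) • w) w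
      simp only [add_assoc, ← add_smul] at h
      push_cast
      refine h.trans ?_
      rw [hwn, hεα]
      have : 0 ≤ M * (ε ^ 2 * ε ^ α) := by positivity
      nlinarith)
    (fun j m => by
      have h := third_diff_transport hα₀ hα₁ hΓ hM hI hU hq hY ht hε (x + (j : ℝ) • y)
        (v + (m : ℝ) • w) w hwn
      rw [hwy] at h
      simp only [add_assoc, ← add_smul] at h
      push_cast
      exact h)
  simp only [Nat.cast_zero, zero_smul, add_zero, Nat.cast_ofNat, Nat.cast_one] at this
  rw [hpow]
  linarith

/-- **Regularity in `x`**: `U` is Hölder continuous of order `(2 + α) / 3` in `x`. The constant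
does not depend on the size of `U`. -/
lemma exists_hol_x {α : ℝ} (hα₀ : 0 < α) (hα₁ : α < 1) :
    ∃ C : ℝ, 0 ≤ C ∧ ∀ {d : ℕ} {Γ M B : ℝ} {I : Set ℝ} {U : Z d → ℝ}, 0 ≤ Γ → 0 ≤ M →
      IsLowerSet I → ContDiff ℝ ∞ U → (∀ t ∈ I, ∀ p, |U (t, p)| ≤ B) →
      (∀ e : E d, HolXV α (Γ * ‖e‖ ^ 2) I univ (DV e (DV e U))) →
      HolXV α M I univ (transport U) → ∀ t ∈ I, ∀ x v y : E d,
        |U (t, x + y, v) - U (t, x, v)| ≤ C * (Γ + M) * ‖y‖ ^ ((2 + α) / 3) := by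
  obtain ⟨C, hC, h⟩ := marchaud_five (γ := (2 + α) / 3) (by linarith)
  refine ⟨C * 5760, by positivity, ?_⟩
  intro d Γ M B I U hΓ hM hI hU hB hq hY t ht x v y
  have := h (fun s => U (t, x + s • y, v)) (5760 * (Γ + M) * ‖y‖ ^ ((2 + α) / 3)) B
    (fun a => hB t ht _) (fun s a hs => by
      have h5 := fifth_diff_x hα₀ hα₁ hΓ hM hI hU hq hY ht (x + a • y) v (s • y)
      rw [norm_smul, Real.norm_of_nonneg hs.le, Real.mul_rpow hs.le (norm_nonneg _)] at h5
      have e : ∀ k : ℝ, x + a • y + k • s • y = x + (a + k * s) • y := fun k => by module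
      simp only [e] at h5
      have i2 : a + s + s = a + 2 * s := by ring
      have i3 : a + 2 * s + s = a + 3 * s := by ring
      have i4 : a + 3 * s + s = a + 4 * s := by ring
      have i5 : a + 4 * s + s = a + 5 * s := by ring
      simp only [fdiff, i2, i3, i4, i5]
      rw [one_mul] at h5
      rw [abs_le] at h5 ⊢
      constructor <;> linarith [h5.1, h5.2])
  simp only [one_smul, zero_smul, add_zero] at this
  linarith

/-! ### Regularity in time -/

/-- The second derivatives in `v` are Hölder continuous of order `α / 2` along the
characteristics of the transport operator. They are replaced by second differences with step
`ε = √h`; the characteristics of the three points involved separate by `h ε = ε³` in `x`, which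
the regularity in `x` compensates. -/
lemma exists_hol_time {α : ℝ} (hα₀ : 0 < α) (hα₁ : α < 1) :
    ∃ C : ℝ, 0 ≤ C ∧ ∀ {d : ℕ} {Γ M B : ℝ} {I : Set ℝ} {U : Z d → ℝ}, 0 ≤ Γ → 0 ≤ M →
      IsLowerSet I → ContDiff ℝ ∞ U → (∀ t ∈ I, ∀ p, |U (t, p)| ≤ B) →
      (∀ e : E d, HolXV α (Γ * ‖e‖ ^ 2) I univ (DV e (DV e U))) →
      HolXV α M I univ (transport U) → ∀ t ∈ I, ∀ h, 0 < h → ∀ x v e : E d, ‖e‖ = 1 →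
        |DV e (DV e U) (t, x, v) - DV e (DV e U) (t - h, x + h • v, v)| ≤
          C * (Γ + M) * h ^ (α / 2) := by
  obtain ⟨C, hC, hX⟩ := exists_hol_x hα₀ hα₁
  refine ⟨2 * C + 8, by positivity, ?_⟩
  intro d Γ M B I U hΓ hM hI hU hB hq hY t ht h hh x v e he
  have hth : t - h ∈ I := hI (by linarith) ht
  set ε : ℝ := Real.sqrt h with hεdef
  have hε : 0 < ε := Real.sqrt_pos.2 hh
  have hε2 : ε ^ 2 = h := Real.sq_sqrt hh.le
  have hεα : h ^ (α / 2) = ε ^ α := by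
    rw [hεdef, Real.sqrt_eq_rpow, ← Real.rpow_mul hh.le]; congr 1; ring
  set w : E d := ε • e with hw
  have hwn : ‖w‖ = ε := by rw [hw, norm_smul, he, mul_one, Real.norm_of_nonneg hε.le]
  -- second differences approximate second derivatives
  have hsec : ∀ t ∈ I, ∀ x v : E d, |U (t, x, v + w) + U (t, x, v - w) - 2 * U (t, x, v)
      - ε ^ 2 * DV e (DV e U) (t, x, v)| ≤ 2 * (Γ * ε ^ 2 * ε ^ α) := by
    intro t ht x v
    have := second_diff_le (φ := fun s : ℝ => U (t, x, v + s • w))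
      (φ' := fun s : ℝ => DV w U (t, x, v + s • w))
      (φ'' := fun s : ℝ => DV w (DV w U) (t, x, v + s • w)) (A := Γ * ε ^ 2 * ε ^ α)
      (fun s => hasDerivAt_v hU t x v w s) (fun s => hasDerivAt_v (contDiff_DV hU w) t x v w s)
      (fun s hs => by
        refine (hq w t ht _ (mem_univ _) _ (mem_univ _)).trans ?_
        rw [dXV_same_left, hwn]
        have h1 : ‖v + s • w - (v + (0 : ℝ) • w)‖ ≤ ε := by
          rw [zero_smul, add_zero, add_sub_cancel_left, norm_smul, hwn, Real.norm_eq_abs]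
          have := abs_le.2 hs
          nlinarith
        gcongr)
    simp only [zero_smul, add_zero, one_smul, neg_smul, ← sub_eq_add_neg] at this
    rwa [hw, DV_DV_smul, ← hw] at this
  have s1 := hsec t ht x v
  have s2 := hsec (t - h) hth (x + h • v) v
  -- transport of the three points at time `t - h` to time `t`
  let P : ℝ → ℝ → Z d := fun k s =>
    (t - s, x + k • (-h • w) + s • (v + k • w), v + k • w)
  have hd : ∀ k s, HasDerivAt (fun s => U (P k s)) (-transport U (P k s)) s :=
    fun k s => hasDerivAt_transport hU t _ _ s
  have hmv := abs_sub_le_of_hasDerivAt (S := h) (C := 4 * M * ε ^ α)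
    (ψ := fun s => U (P 1 s) + U (P (-1) s) - 2 * U (P 0 s))
    (fun s => (((hd 1 s).add (hd (-1) s)).sub ((hd 0 s).const_mul 2)))
    hh.le (fun s hs => by
      have hY' : ∀ k : ℝ, |k| = 1 →
          |transport U (P k s) - transport U (P 0 s)| ≤ 2 * M * ε ^ α := by
        intro k hk
        refine (hY (t - s) (hI (by linarith [hs.1] : t - s ≤ t) ht) _ (mem_univ _) _
          (mem_univ _)).trans ?_
        have h1 : dXV (P k s).2 (P 0 s).2 ≤ 2 * ε := by
          have e1 : (P k s).2.1 - (P 0 s).2.1 = (k * (s - h)) • w := by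
            simp only [P]; module
          have e2 : (P k s).2.2 - (P 0 s).2.2 = k • w := by
            simp only [P]; module
          have h3 : ‖(k * (s - h)) • w‖ ≤ ε ^ 3 := by
            rw [norm_smul, hwn, Real.norm_eq_abs, abs_mul, hk,
              abs_of_nonpos (by linarith [hs.2])]
            have : 1 * -(s - h) ≤ ε ^ 2 := by rw [hε2]; linarith [hs.1]
            nlinarith
          rw [dXV, e1, e2, norm_smul k w, hwn, Real.norm_eq_abs, hk]
          have h4 : ‖(k * (s - h)) • w‖ ^ (1 / 3 : ℝ) ≤ ε := by
            calc _ ≤ (ε ^ 3) ^ (1 / 3 : ℝ) :=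
                  Real.rpow_le_rpow (norm_nonneg _) h3 (by norm_num)
              _ = ε := by
                  rw [← Real.rpow_natCast, ← Real.rpow_mul hε.le]; norm_num
          linarith
        have h2 : dXV (P k s).2 (P 0 s).2 ^ α ≤ 2 * ε ^ α := by
          calc _ ≤ (2 * ε) ^ α := Real.rpow_le_rpow (dXV_nonneg _ _) h1 hα₀.le
            _ = 2 ^ α * ε ^ α := Real.mul_rpow (by norm_num) hε.le
            _ ≤ 2 ^ (1 : ℝ) * ε ^ α := by
              gcongr
              norm_num
            _ = _ := by norm_num
        calc _ ≤ M * (2 * ε ^ α) := by gcongr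
          _ = _ := by ring
      have a1 := abs_le.1 (hY' 1 (by norm_num))
      have a2 := abs_le.1 (hY' (-1) (by norm_num))
      rw [abs_le]
      constructor <;> linarith [a1.1, a1.2, a2.1, a2.2])
  have hP : ∀ k : ℝ, P k h = (t - h, x + h • v, v + k • w) := by
    intro k
    simp only [P, Prod.mk.injEq, true_and, and_true]
    module
  have hP0 : ∀ k : ℝ, P k 0 = (t, x + k • (-h • w), v + k • w) := by
    intro k
    simp [P]
  simp only [hP, hP0, zero_smul, add_zero, one_smul, neg_smul, ← sub_eq_add_neg, sub_neg_eq_add,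
    smul_neg, sub_zero] at hmv
  -- the shifts in `x`
  have hxs : ‖h • w‖ ^ ((2 + α) / 3) = ε ^ 2 * ε ^ α := by
    rw [norm_smul, hwn, Real.norm_of_nonneg hh.le, ← hε2, ← pow_succ, ← Real.rpow_natCast,
      ← Real.rpow_mul hε.le, ← Real.rpow_two, ← Real.rpow_add hε]
    congr 1
    push_cast
    ring
  have x1 := hX hΓ hM hI hU hB hq hY t ht x (v + w) (-(h • w))
  have x2 := hX hΓ hM hI hU hB hq hY t ht x (v - w) (h • w)
  rw [norm_neg] at x1
  rw [hxs] at x1 x2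
  rw [← sub_eq_add_neg] at x1
  rw [hεα]
  have hfin : ε ^ 2 * |DV e (DV e U) (t, x, v) - DV e (DV e U) (t - h, x + h • v, v)| ≤
      ε ^ 2 * ((2 * C + 8) * (Γ + M) * ε ^ α) := by
    rw [← abs_of_nonneg (sq_nonneg ε), ← abs_mul, abs_of_nonneg (sq_nonneg ε)]
    rw [← hε2] at *
    rw [abs_le] at *
    have g1 : 0 ≤ M * (ε ^ 2 * ε ^ α) := by positivity
    have g2 : 0 ≤ Γ * (ε ^ 2 * ε ^ α) := by positivity
    constructor <;> nlinarith [s1.1, s1.2, s2.1, s2.2, hmv.1, hmv.2, x1.1, x1.2, x2.1, x2.2]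
  exact le_of_mul_le_mul_left hfin (by positivity)

/-! ### Integrals depending on a parameter -/

section Param

variable {G : Type*} [NormedAddCommGroup G] [NormedSpace ℝ G] [FiniteDimensional ℝ G]
  [MeasurableSpace G] [BorelSpace G] {μ : Measure G}

/-- Differentiation under the integral sign for a smooth kernel with compact support. -/
lemma hasDerivAt_integral_kernel {k : ℝ × G → ℝ} (hk : ContDiff ℝ 1 k) {K : Set G}
    (hK : IsCompact K) (s₀ : ℝ) (hkK : ∀ s ∈ Metric.ball s₀ 1, ∀ x ∉ K, k (s, x) = 0)
    {f : G → ℝ} (hf : LocallyIntegrable f μ) :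
    HasDerivAt (fun s => ∫ x, k (s, x) * f x ∂μ)
      (∫ x, fderiv ℝ k (s₀, x) (1, 0) * f x ∂μ) s₀ := by
  have hfd : Continuous (fun p => fderiv ℝ k p (1, 0)) :=
    (hk.continuous_fderiv one_ne_zero).clm_apply continuous_const
  obtain ⟨C, hC⟩ := ((isCompact_closedBall s₀ 1).prod hK).exists_bound_of_continuousOn
    hfd.continuousOn
  have hfK : IntegrableOn f K μ := hf.integrableOn_isCompact hK
  have hd : ∀ x s, HasDerivAt (fun s => k (s, x)) (fderiv ℝ k (s, x) (1, 0)) s := fun x s =>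
    ((hk.differentiable one_ne_zero) (s, x)).hasFDerivAt.comp_hasDerivAt s
      ((hasDerivAt_id s).prodMk (hasDerivAt_const s x))
  have hz : ∀ s ∈ Metric.ball s₀ 1, ∀ x ∉ K, fderiv ℝ k (s, x) (1, 0) = 0 := by
    intro s hs x hx
    refine (hd x s).unique ((hasDerivAt_const s (0 : ℝ)).congr_of_eventuallyEq ?_)
    filter_upwards [Metric.isOpen_ball.mem_nhds hs] with s' hs' using hkK s' hs' x hx
  have hms : ∀ c : ℝ × G → ℝ, Continuous c → ∀ s,
      AEStronglyMeasurable (fun x => c (s, x) * f x) μ := fun c hc s =>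
    (hc.comp (by fun_prop : Continuous fun x : G => (s, x))).aestronglyMeasurable.mul
      hf.aestronglyMeasurable
  refine (hasDerivAt_integral_of_dominated_loc_of_deriv_le (s := Metric.ball s₀ 1)
    (F := fun s x => k (s, x) * f x) (F' := fun s x => fderiv ℝ k (s, x) (1, 0) * f x)
    (bound := K.indicator fun x => C * ‖f x‖) (Metric.ball_mem_nhds s₀ one_pos)
    (Eventually.of_forall fun s => hms k hk.continuous s) ?_ (hms _ hfd s₀) ?_ ?_ ?_).2
  · obtain ⟨C', hC'⟩ := hK.exists_bound_of_continuousOn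
      (f := fun x => k (s₀, x)) (hk.continuous.comp (by fun_prop)).continuousOn
    have : Integrable (K.indicator fun x => C' * ‖f x‖) μ :=
      (integrable_indicator_iff hK.measurableSet).2 (hfK.norm.const_mul C')
    refine this.mono' (hms k hk.continuous s₀) (Eventually.of_forall fun x => ?_)
    by_cases hx : x ∈ K
    · rw [indicator_of_mem hx, norm_mul]
      exact mul_le_mul_of_nonneg_right (hC' x hx) (norm_nonneg _)
    · rw [indicator_of_notMem hx, hkK s₀ (Metric.mem_ball_self one_pos) x hx]
      simp
  · refine Eventually.of_forall fun x s hs => ?_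
    by_cases hx : x ∈ K
    · rw [indicator_of_mem hx, norm_mul]
      exact mul_le_mul_of_nonneg_right (hC (s, x) ⟨Metric.ball_subset_closedBall hs, hx⟩)
        (norm_nonneg _)
    · rw [indicator_of_notMem hx, hz s hs x hx]
      simp
  · exact (integrable_indicator_iff hK.measurableSet).2 (hfK.norm.const_mul C)
  · exact Eventually.of_forall fun x s _ => (hd x s).mul_const (f x)

end Param

/-! ### Averaging and the Laplacian -/


/-- The derivative of `F` in the direction `e`. -/
def dd (e : E d) (F : E d → ℝ) (w : E d) : ℝ := fderiv ℝ F w e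

lemma contDiff_dd {F : E d → ℝ} (hF : ContDiff ℝ ∞ F) (e : E d) : ContDiff ℝ ∞ (dd e F) := by
  have := (contDiff_infty_iff_fderiv.1 hF).2
  unfold dd
  fun_prop

lemma hasCompactSupport_dd {F : E d → ℝ} (hF : HasCompactSupport F) (e : E d) :
    HasCompactSupport (dd e F) := hF.fderiv_apply ℝ e

lemma tsupport_dd_subset (F : E d → ℝ) (e : E d) : tsupport (dd e F) ⊆ tsupport F :=
  tsupport_fderiv_apply_subset ℝ e

lemma dd_dd_eq {F : E d → ℝ} (hF : ContDiff ℝ ∞ F) (a b w : E d) :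
    dd a (dd b F) w = fderiv ℝ (fderiv ℝ F) w a b := by
  have h2 : DifferentiableAt ℝ (fderiv ℝ F) w :=
    ((contDiff_infty_iff_fderiv.1 hF).2.differentiable (by simp)) w
  unfold dd
  rw [fderiv_clm_apply h2 (differentiableAt_const b)]
  simp

lemma dd_comm {F : E d → ℝ} (hF : ContDiff ℝ ∞ F) (e e' : E d) :
    dd e (dd e' F) = dd e' (dd e F) := by
  ext w
  have hs : IsSymmSndFDerivAt ℝ F w :=
    (hF.contDiffAt (x := w)).isSymmSndFDerivAt (by
      rw [minSmoothness_of_isRCLikeNormedField]; exact WithTop.coe_le_coe.2 le_top)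
  rw [dd_dd_eq hF, dd_dd_eq hF]
  exact hs.eq e e'

lemma dd_comp_affine {F : E d → ℝ} (hF : ContDiff ℝ ∞ F) (e v : E d) (r : ℝ) :
    dd e (fun w => F (v + r • w)) = fun w => r * dd e F (v + r • w) := by
  ext w
  have h1 : HasFDerivAt (fun w : E d => v + r • w) (r • ContinuousLinearMap.id ℝ (E d)) w :=
    ((hasFDerivAt_id w).const_smul r).const_add v
  have h2 := ((hF.differentiable (by simp)) (v + r • w)).hasFDerivAt.comp w h1
  unfold dd
  have h3 : fderiv ℝ (fun w => F (v + r • w)) w = _ := h2.fderiv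
  rw [h3]
  simp

lemma integral_mul_dd {f g : E d → ℝ} (hf : ContDiff ℝ ∞ f) (hfc : HasCompactSupport f)
    (hg : ContDiff ℝ ∞ g) (e : E d) : ∫ w, f w * dd e g w = -∫ w, dd e f w * g w := by
  refine integral_mul_fderiv_eq_neg_fderiv_mul_of_integrable (f := f) (g := g) (v := e) ?_ ?_ ?_
    (fun x _ => hf.differentiable (by simp) x) (fun x _ => hg.differentiable (by simp) x)
  · exact ((contDiff_dd hf e).continuous.mul hg.continuous).integrable_of_hasCompactSupport
      (hasCompactSupport_dd hfc e).mul_right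
  · exact (hf.continuous.mul (contDiff_dd hg e).continuous).integrable_of_hasCompactSupport
      hfc.mul_right
  · exact (hf.continuous.mul hg.continuous).integrable_of_hasCompactSupport hfc.mul_right

lemma integral_mul_dd_dd {f g : E d → ℝ} (hf : ContDiff ℝ ∞ f) (hfc : HasCompactSupport f)
    (hg : ContDiff ℝ ∞ g) (e : E d) :
    ∫ w, f w * dd e (dd e g) w = ∫ w, dd e (dd e f) w * g w := by
  rw [integral_mul_dd hf hfc (contDiff_dd hg e),
    integral_mul_dd (contDiff_dd hf e) (hasCompactSupport_dd hfc e) hg, neg_neg]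

/-- A radial averaging kernel `a` of mass one such that the vector field `a(w) w` is the gradient
of a function `b` with compact support. -/
structure IsKernel (a b : E d → ℝ) : Prop where
  smooth_a : ContDiff ℝ ∞ a
  smooth_b : ContDiff ℝ ∞ b
  supp_a : tsupport a ⊆ Metric.closedBall 0 1
  supp_b : tsupport b ⊆ Metric.closedBall 0 1
  integral_a : ∫ w, a w = 1
  grad : ∀ w e, a w * inner ℝ w e = dd e b w

lemma hasCompactSupport_of_tsupport_subset {f : E d → ℝ}
    (h : tsupport f ⊆ Metric.closedBall 0 1) : HasCompactSupport f :=
  (isCompact_closedBall (0 : E d) 1).of_isClosed_subset (isClosed_tsupport f) h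

lemma exists_isKernel (hd : 1 ≤ d) : ∃ a b : E d → ℝ, IsKernel a b := by
  -- `b₀(w) = β(|w|²)` with `β` decreasing, so `a₀(w) = 2 β'(|w|²)` has a nonzero integral
  set β : ℝ → ℝ := fun s => Real.smoothTransition (2 - 2 * s) with hβ
  have hβs : ContDiff ℝ ∞ β := Real.smoothTransition.contDiff.comp (by fun_prop)
  have hβd : ∀ s, HasDerivAt β (deriv β s) s := fun s =>
    (hβs.differentiable (by simp) s).hasDerivAt
  have hβ's : ContDiff ℝ ∞ (deriv β) := (contDiff_infty_iff_deriv.1 hβs).2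
  have hβa : Antitone β := fun s t hst =>
    Real.smoothTransition.monotone (by linarith)
  have hβ0 : ∀ s, 1 ≤ s → β s = 0 := fun s hs =>
    Real.smoothTransition.zero_of_nonpos (by linarith)
  have hβ1 : β (1 / 2) = 1 := Real.smoothTransition.one_of_one_le (by norm_num)
  have hβ'0 : ∀ s, 1 < s → deriv β s = 0 := by
    intro s hs
    refine (hβd s).unique ((hasDerivAt_const s (0 : ℝ)).congr_of_eventuallyEq ?_)
    filter_upwards [lt_mem_nhds hs] with x hx using hβ0 x hx.le
  obtain ⟨s₀, hs₀, hs₀'⟩ := exists_hasDerivAt_eq_slope β (deriv β)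
    (by norm_num : (1 / 2 : ℝ) < 1) hβs.continuous.continuousOn (fun x _ => hβd x)
  have hs₀ne : deriv β s₀ ≠ 0 := by
    rw [hs₀', hβ1, hβ0 1 le_rfl]; norm_num
  have hns : ContDiff ℝ ∞ fun w : E d => ‖w‖ ^ 2 := contDiff_norm_sq ℝ
  set b : E d → ℝ := fun w => β (‖w‖ ^ 2) with hb
  set a : E d → ℝ := fun w => 2 * deriv β (‖w‖ ^ 2) with ha
  have hbs : ContDiff ℝ ∞ b := hβs.comp hns
  have has : ContDiff ℝ ∞ a := contDiff_const.mul (hβ's.comp hns)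
  have hsq : ∀ w : E d, w ∉ Metric.closedBall (0 : E d) 1 → 1 < ‖w‖ ^ 2 := by
    intro w hw
    rw [mem_closedBall_zero_iff, not_le] at hw
    nlinarith
  have hsa : tsupport a ⊆ Metric.closedBall 0 1 := by
    refine closure_minimal (fun w hw => ?_) Metric.isClosed_closedBall
    by_contra h
    exact hw (by simp [ha, hβ'0 _ (hsq w h)])
  have hsb : tsupport b ⊆ Metric.closedBall 0 1 := by
    refine closure_minimal (fun w hw => ?_) Metric.isClosed_closedBall
    by_contra h
    exact hw (by simp [hb, hβ0 _ (hsq w h).le])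
  have hgrad : ∀ w e, a w * inner ℝ w e = dd e b w := by
    intro w e
    have h1 : HasFDerivAt (fun w : E d => ‖w‖ ^ 2) _ w := (hasStrictFDerivAt_norm_sq w).hasFDerivAt
    have h2 := (hβd (‖w‖ ^ 2)).comp_hasFDerivAt w h1
    have h3 : fderiv ℝ b w = _ := h2.fderiv
    rw [dd, h3]
    simp [ha]
    ring
  have : Nonempty (Fin d) := ⟨⟨0, hd⟩⟩
  have : Nontrivial (E d) := inferInstance
  obtain ⟨w₀, hw₀⟩ := exists_norm_eq (E d) (Real.sqrt_nonneg s₀)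
  have hpos : 0 < ∫ w, -a w := by
    refine Continuous.integral_pos_of_hasCompactSupport_nonneg_nonzero (x := w₀)
      has.continuous.neg (hasCompactSupport_of_tsupport_subset hsa).neg ?_ ?_
    · intro w
      have := hβa.deriv_nonpos (x := ‖w‖ ^ 2)
      simp only [Pi.zero_apply, ha]
      linarith
    · simp only [ha, hw₀, Real.sq_sqrt (by linarith [hs₀.1] : (0 : ℝ) ≤ s₀)]
      simpa using hs₀ne
  rw [integral_neg] at hpos
  set c : ℝ := ∫ w, a w with hc
  have hc0 : c ≠ 0 := by linarith
  refine ⟨fun w => c⁻¹ * a w, fun w => c⁻¹ * b w, ?_, ?_, ?_, ?_, ?_, ?_⟩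
  · exact contDiff_const.mul has
  · exact contDiff_const.mul hbs
  · exact (tsupport_mul_subset_right).trans hsa
  · exact (tsupport_mul_subset_right).trans hsb
  · rw [integral_const_mul, ← hc, inv_mul_cancel₀ hc0]
  · intro w e
    have : dd e (fun w => c⁻¹ * b w) w = c⁻¹ * dd e b w := by
      unfold dd
      rw [fderiv_const_mul (hbs.differentiable (by simp) w)]
      simp
    rw [this, ← hgrad]
    ring

/-- The Laplacian on `ℝ^d`. -/
def lapl (F : E d → ℝ) (w : E d) : ℝ :=
  ∑ i : Fin d, dd (EuclideanSpace.single i 1) (dd (EuclideanSpace.single i 1) F) w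

/-- Averaging a function `Q` at scale `s` changes with `s` according to the Laplacian of `Q`,
because `a(w) w · D_v Q = D b · D_v Q` can be integrated by parts. -/
lemma IsKernel.hasDerivAt_average {a b : E d → ℝ} (hab : IsKernel a b) {Q : E d → ℝ}
    (hQ : ContDiff ℝ ∞ Q) (v : E d) (s : ℝ) :
    HasDerivAt (fun s => ∫ w, a w * Q (v + s • w)) (-(s * ∫ w, b w * lapl Q (v + s • w))) s := by
  have hbc := hasCompactSupport_of_tsupport_subset hab.supp_b
  have h1 := hasDerivAt_integral_kernel (μ := (volume : Measure (E d)))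
    (k := fun p : ℝ × E d => a p.2 * Q (v + p.1 • p.2))
    ((hab.smooth_a.comp contDiff_snd).mul (hQ.comp (by fun_prop)) |>.of_le (by simp))
    (isCompact_closedBall (0 : E d) 1) s
    (fun s _ x hx => by
      have : a x = 0 := image_eq_zero_of_notMem_tsupport fun h => hx (hab.supp_a h)
      simp [this]) (f := fun _ => (1 : ℝ)) (locallyIntegrable_const 1)
  simp only [mul_one] at h1
  refine h1.congr_deriv ?_
  have e1 : ∀ w : E d, fderiv ℝ (fun p : ℝ × E d => a p.2 * Q (v + p.1 • p.2)) (s, w) (1, 0) =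
      ∑ i : Fin d, dd (EuclideanSpace.single i 1) b w *
        dd (EuclideanSpace.single i 1) Q (v + s • w) := by
    intro w
    have hk : ContDiff ℝ ∞ (fun p : ℝ × E d => a p.2 * Q (v + p.1 • p.2)) :=
      (hab.smooth_a.comp contDiff_snd).mul (hQ.comp (by fun_prop))
    have e2 : HasDerivAt (fun s : ℝ => a w * Q (v + s • w))
        (fderiv ℝ (fun p : ℝ × E d => a p.2 * Q (v + p.1 • p.2)) (s, w) (1, 0)) s :=
      HasFDerivAt.comp_hasDerivAt (f := fun s : ℝ => (s, w)) s
        (hk.differentiable (by simp) (s, w)).hasFDerivAt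
        ((hasDerivAt_id s).prodMk (hasDerivAt_const s w))
    have e3 : HasDerivAt (fun s : ℝ => a w * Q (v + s • w)) (a w * fderiv ℝ Q (v + s • w) w) s := by
      have : HasDerivAt (fun s : ℝ => v + s • w) w s := by
        simpa using ((hasDerivAt_id s).smul_const w).const_add v
      exact ((hQ.differentiable (by simp) (v + s • w)).hasFDerivAt.comp_hasDerivAt s
        this).const_mul (a w)
    rw [e2.unique e3]
    have hw : w = ∑ i : Fin d, (inner ℝ w (EuclideanSpace.single i (1 : ℝ))) •
        EuclideanSpace.single i (1 : ℝ) := by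
      conv_lhs => rw [← (EuclideanSpace.basisFun (Fin d) ℝ).sum_repr w]
      refine Finset.sum_congr rfl fun i _ => ?_
      simp [EuclideanSpace.inner_single_right]
    conv_lhs => enter [2, 2]; rw [hw]
    rw [map_sum, Finset.mul_sum]
    refine Finset.sum_congr rfl fun i _ => ?_
    rw [map_smul, ← hab.grad, smul_eq_mul, dd]
    ring
  simp only [e1]
  have hcd : ∀ F : E d → ℝ, ContDiff ℝ ∞ F → Continuous fun w => F (v + s • w) := fun F hF =>
    hF.continuous.comp (by fun_prop)
  rw [integral_finsetSum]
  · unfold lapl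
    simp only [Finset.mul_sum]
    rw [integral_finsetSum, Finset.mul_sum, ← Finset.sum_neg_distrib]
    · refine Finset.sum_congr rfl fun i _ => ?_
      set e : E d := EuclideanSpace.single i 1
      have := integral_mul_dd hab.smooth_b hbc (g := fun w => dd e Q (v + s • w))
        ((contDiff_dd hQ e).comp (by fun_prop)) e
      rw [dd_comp_affine (contDiff_dd hQ e)] at this
      rw [← neg_eq_iff_eq_neg.2 this, ← integral_const_mul]
      congr 2
      ext w
      ring
    · intro i _
      exact (hab.smooth_b.continuous.mul
        (hcd _ (contDiff_dd (contDiff_dd hQ _) _))).integrable_of_hasCompactSupport hbc.mul_right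
  · intro i _
    exact ((contDiff_dd hab.smooth_b _).continuous.mul
      (hcd _ (contDiff_dd hQ _))).integrable_of_hasCompactSupport
      (hasCompactSupport_dd hbc _).mul_right

lemma dd_sub {F G : E d → ℝ} (hF : ContDiff ℝ ∞ F) (hG : ContDiff ℝ ∞ G) (e : E d) :
    dd e (fun w => F w - G w) = fun w => dd e F w - dd e G w := by
  ext w
  unfold dd
  rw [fderiv_fun_sub (hF.differentiable (by simp) w) (hG.differentiable (by simp) w)]
  rfl

lemma dd_sum {ι : Type*} (s : Finset ι) {F : ι → E d → ℝ} (hF : ∀ i, ContDiff ℝ ∞ (F i))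
    (e : E d) : dd e (fun w => ∑ i ∈ s, F i w) = fun w => ∑ i ∈ s, dd e (F i) w := by
  ext w
  unfold dd
  rw [fderiv_fun_sum fun i _ => (hF i).differentiable (by simp) w]
  simp

lemma contDiff_lapl {F : E d → ℝ} (hF : ContDiff ℝ ∞ F) : ContDiff ℝ ∞ (lapl F) :=
  ContDiff.sum fun _ _ => contDiff_dd (contDiff_dd hF _) _

lemma lapl_dd_dd {F : E d → ℝ} (hF : ContDiff ℝ ∞ F) (e : E d) :
    lapl (dd e (dd e F)) = dd e (dd e (lapl F)) := by
  have h2 := fun e' : E d => contDiff_dd (contDiff_dd hF e') e'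
  have : dd e (dd e (lapl F)) = fun w => ∑ i : Fin d, dd e (dd e
      (dd (EuclideanSpace.single i 1) (dd (EuclideanSpace.single i 1) F))) w := by
    have h := dd_sum Finset.univ (F := fun (i : Fin d) => dd (EuclideanSpace.single i 1)
      (dd (EuclideanSpace.single i 1) F)) (fun i => h2 _) e
    have h' := dd_sum Finset.univ (F := fun (i : Fin d) => dd e (dd (EuclideanSpace.single i 1)
      (dd (EuclideanSpace.single i 1) F))) (fun i => contDiff_dd (h2 _) e) e
    rw [← h', ← h]
    rfl
  rw [this]
  ext w
  refine Finset.sum_congr rfl fun i _ => ?_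
  set ei : E d := EuclideanSpace.single i 1
  rw [dd_comm (contDiff_dd hF e) ei e, dd_comm hF ei e,
    dd_comm (contDiff_dd (contDiff_dd hF ei) e) ei e, dd_comm (contDiff_dd hF ei) ei e]

lemma exists_norm_le_of_hasCompactSupport {X F : Type*} [TopologicalSpace X]
    [NormedAddCommGroup F] {g : X → F} (hg : Continuous g) (hc : HasCompactSupport g) :
    ∃ C, 0 ≤ C ∧ ∀ w, ‖g w‖ ≤ C := by
  obtain ⟨C, hC⟩ := hc.exists_bound_of_continuous hg
  exact ⟨max C 0, le_max_right _ _, fun w => (hC w).trans (le_max_left _ _)⟩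

lemma exists_lipschitz_of_hasCompactSupport {X : Type*} [NormedAddCommGroup X] [NormedSpace ℝ X]
    {g : X → ℝ} (hg : ContDiff ℝ ∞ g) (hc : HasCompactSupport g) :
    ∃ C, 0 ≤ C ∧ ∀ w w', |g w - g w'| ≤ C * ‖w - w'‖ := by
  obtain ⟨C, hC0, hC⟩ := exists_norm_le_of_hasCompactSupport
    (contDiff_infty_iff_fderiv.1 hg).2.continuous (hc.fderiv ℝ)
  refine ⟨C, hC0, fun w w' => ?_⟩
  exact convex_univ.norm_image_sub_le_of_norm_fderiv_le
    (fun x _ => hg.differentiable (by simp) x) (fun x _ => hC x) (mem_univ w') (mem_univ w)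

/-- Second derivatives of compactly supported smooth functions are bounded, quadratically in the
direction. -/
lemma exists_dd_dd_bound {b : E d → ℝ} (hb : ContDiff ℝ ∞ b) (hbc : HasCompactSupport b) :
    ∃ C, 0 ≤ C ∧ ∀ e w, |dd e (dd e b) w| ≤ C * ‖e‖ ^ 2 := by
  have hb1 := (contDiff_infty_iff_fderiv.1 hb).2
  have hb2 := (contDiff_infty_iff_fderiv.1 hb1).2
  have hc2 : HasCompactSupport (fderiv ℝ (fderiv ℝ b)) := (hbc.fderiv ℝ).fderiv ℝ
  obtain ⟨C, hC0, hC'⟩ := exists_norm_le_of_hasCompactSupport hb2.continuous hc2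
  refine ⟨C, hC0, fun e w => ?_⟩
  rw [dd_dd_eq hb, ← Real.norm_eq_abs]
  have h1 := (fderiv ℝ (fderiv ℝ b) w).le_opNorm₂ e e
  have h2 : ‖fderiv ℝ (fderiv ℝ b) w‖ * ‖e‖ * ‖e‖ ≤ C * ‖e‖ * ‖e‖ := by
    gcongr
    exact hC' w
  exact (h1.trans h2).trans_eq (by ring)

lemma abs_integral_le_of_supp {f : E d → ℝ} {B ρ : ℝ}
    (hs : ∀ w ∉ Metric.closedBall (0 : E d) ρ, f w = 0)
    (hB : ∀ w ∈ Metric.closedBall (0 : E d) ρ, |f w| ≤ B) :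
    |∫ w, f w| ≤ B * (volume : Measure (E d)).real (Metric.closedBall 0 ρ) := by
  rw [← setIntegral_eq_integral_of_forall_compl_eq_zero hs]
  exact norm_setIntegral_le_of_norm_le_const (f := f) (C := B) measure_closedBall_lt_top hB

/-- Averages of a second derivative of `F` approximate it up to the Hölder seminorm of the
Laplacian alone: by `IsKernel.hasDerivAt_average`, the derivative of the average in the scale
involves only the Laplacian, and both derivatives in `e` can be moved to `b`. -/
lemma IsKernel.exists_average_sub_le {a b : E d → ℝ} (hab : IsKernel a b) {α : ℝ} (hα₀ : 0 < α) :
    ∃ C, 0 ≤ C ∧ ∀ (F : E d → ℝ), ContDiff ℝ ∞ F → ∀ (e v : E d) (M : ℝ), 0 ≤ M →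
      (∀ w, |lapl F (v + w) - lapl F v| ≤ M * ‖w‖ ^ α) → ∀ r, 0 < r →
        |(∫ w, a w * dd e (dd e F) (v + r • w)) - dd e (dd e F) v| ≤ C * ‖e‖ ^ 2 * M * r ^ α := by
  have hbc := hasCompactSupport_of_tsupport_subset hab.supp_b
  obtain ⟨Cb, hCb0, hCb⟩ := exists_dd_dd_bound hab.smooth_b hbc
  set V : ℝ := (volume : Measure (E d)).real (Metric.closedBall 0 1) with hV
  have hV0 : 0 ≤ V := measureReal_nonneg
  refine ⟨Cb * V / α, by positivity, fun F hF e v M hM hL r hr => ?_⟩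
  have hQ := contDiff_dd (contDiff_dd hF e) e
  set Q := dd e (dd e F) with hQdef
  set φ : ℝ → ℝ := fun s => ∫ w, a w * Q (v + s • w) with hφ
  set φ' : ℝ → ℝ := fun s => -(s * ∫ w, b w * lapl Q (v + s • w)) with hφ'
  have hder : ∀ s, HasDerivAt φ (φ' s) s := fun s => hab.hasDerivAt_average hQ v s
  set D : ℝ := Cb * ‖e‖ ^ 2 * M * V with hD
  have hD0 : 0 ≤ D := by positivity
  have hbd : ∀ s, 0 < s → |φ' s| ≤ D * s ^ (α - 1) := by
    intro s hs
    -- two integrations by parts, after subtracting the value of the Laplacian at `v`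
    set g : E d → ℝ := fun w => lapl F (v + s • w) - lapl F v with hg
    have hgs : ContDiff ℝ ∞ g := ((contDiff_lapl hF).comp (by fun_prop)).sub contDiff_const
    have hgdd : dd e (dd e g) = fun w => s * (s * lapl Q (v + s • w)) := by
      have h1 : dd e g = fun w => s * dd e (lapl F) (v + s • w) := by
        rw [← dd_comp_affine (contDiff_lapl hF) e v s]
        ext w
        simp only [hg, dd, fderiv_sub_const]
      have h2 := dd_comp_affine (contDiff_dd (contDiff_lapl hF) e) e v s
      rw [h1, hQdef, lapl_dd_dd hF]
      ext w
      have h3 : dd e (fun w => s * dd e (lapl F) (v + s • w)) w =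
          s * dd e (fun w => dd e (lapl F) (v + s • w)) w := by
        have : DifferentiableAt ℝ (fun w => dd e (lapl F) (v + s • w)) w :=
          ((contDiff_dd (contDiff_lapl hF) e).comp (by fun_prop :
            ContDiff ℝ ∞ fun w : E d => v + s • w)).differentiable (by simp) w
        unfold dd at this ⊢
        rw [fderiv_const_mul this]
        simp
      rw [h3, h2]
    have hibp := integral_mul_dd_dd hab.smooth_b hbc hgs e
    have e1 : ∫ w, b w * dd e (dd e g) w = s * (s * ∫ w, b w * lapl Q (v + s • w)) := by
      rw [hgdd, ← integral_const_mul, ← integral_const_mul]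
      congr 1
      ext w
      ring
    have e2 : |∫ w, dd e (dd e b) w * g w| ≤ Cb * ‖e‖ ^ 2 * (M * s ^ α) * V := by
      refine abs_integral_le_of_supp (fun w hw => ?_) (fun w hw => ?_)
      · have : dd e (dd e b) w = 0 := image_eq_zero_of_notMem_tsupport fun h => hw
          (hab.supp_b (tsupport_dd_subset _ _ (tsupport_dd_subset _ _ h)))
        rw [this, zero_mul]
      · rw [abs_mul]
        refine mul_le_mul (hCb e w) ?_ (abs_nonneg _) (by positivity)
        refine (hL (s • w)).trans ?_
        have h4 : ‖s • w‖ ≤ s := by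
          rw [norm_smul, Real.norm_of_nonneg hs.le]
          have := mem_closedBall_zero_iff.1 hw
          nlinarith
        gcongr
    rw [← hibp, e1, abs_mul, abs_of_pos hs] at e2
    rw [hφ', abs_neg, Real.rpow_sub_one hs.ne', hD]
    rw [← mul_div_assoc, le_div_iff₀ hs]
    linarith
  have hφ0 : φ 0 = Q v := by
    simp only [hφ, zero_smul, add_zero]
    rw [integral_mul_const, hab.integral_a, one_mul]
  have hφc : Continuous φ := continuous_iff_continuousAt.2 fun s => (hder s).continuousAt
  have hpow : ∀ s, 0 < s → HasDerivAt (fun s : ℝ => D / α * s ^ α) (D * s ^ (α - 1)) s := by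
    intro s hs
    refine ((Real.hasDerivAt_rpow_const (Or.inl hs.ne')).const_mul (D / α)).congr_deriv ?_
    field_simp
  have hpc : Continuous fun s : ℝ => D / α * s ^ α :=
    continuous_const.mul (Real.continuous_rpow_const hα₀.le)
  have hanti : ∀ c : ℝ, |c| = 1 → c * φ r - D / α * r ^ α ≤ c * φ 0 := by
    intro c hc
    have hd : ∀ s, 0 < s → HasDerivAt (fun s => c * φ s - D / α * s ^ α)
        (c * φ' s - D * s ^ (α - 1)) s := fun s hs =>
      ((hder s).const_mul c).sub (hpow s hs)
    have := antitoneOn_of_deriv_nonpos (convex_Icc 0 r)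
      (f := fun s => c * φ s - D / α * s ^ α)
      ((continuous_const.mul hφc).sub hpc).continuousOn
      (fun s hs => by
        rw [interior_Icc] at hs
        exact (hd s hs.1).differentiableAt.differentiableWithinAt)
      (fun s hs => by
        rw [interior_Icc] at hs
        rw [(hd s hs.1).deriv]
        have h5 := hbd s hs.1
        have h6 : c * φ' s ≤ |φ' s| := by
          calc c * φ' s ≤ |c * φ' s| := le_abs_self _
            _ = |φ' s| := by rw [abs_mul, hc, one_mul]
        linarith)
      (left_mem_Icc.2 hr.le) (right_mem_Icc.2 hr.le) hr.le
    simpa [Real.zero_rpow hα₀.ne'] using this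
  have u1 := hanti 1 (by norm_num)
  have u2 := hanti (-1) (by norm_num)
  rw [hφ0] at u1 u2
  have hconst : Cb * V / α * ‖e‖ ^ 2 * M * r ^ α = D / α * r ^ α := by rw [hD]; ring
  change |φ r - Q v| ≤ _
  rw [hconst, abs_le]
  constructor <;> linarith


/-! ### The a priori estimate for smooth functions -/

/-- The Laplacian in `v` of a smooth function. -/
def lapZ (U : Z d → ℝ) (z : Z d) : ℝ :=
  ∑ i : Fin d, DV (EuclideanSpace.single i 1) (DV (EuclideanSpace.single i 1) U) z

lemma dd_slice {U : Z d → ℝ} (hU : ContDiff ℝ ∞ U) (t : ℝ) (x e : E d) :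
    dd e (fun w => U (t, x, w)) = fun w => DV e U (t, x, w) := by
  ext w
  have h1 : HasFDerivAt (fun w : E d => ((t, x, w) : Z d))
      ((0 : E d →L[ℝ] ℝ).prod ((0 : E d →L[ℝ] E d).prod (ContinuousLinearMap.id ℝ (E d)))) w :=
    (hasFDerivAt_const t w).prodMk ((hasFDerivAt_const x w).prodMk (hasFDerivAt_id w))
  have h2 := (hU.differentiable (by simp) (t, x, w)).hasFDerivAt.comp w h1
  have h3 : fderiv ℝ (fun w : E d => U (t, x, w)) w = _ := h2.fderiv
  rw [dd, h3]
  simp [DV]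

lemma dd_const_mul {F : E d → ℝ} (hF : ContDiff ℝ ∞ F) (c : ℝ) (e : E d) :
    dd e (fun w => c * F w) = fun w => c * dd e F w := by
  ext w
  simp only [dd]
  rw [fderiv_const_mul (hF.differentiable (by simp) w)]
  simp

lemma contDiff_slice {U : Z d → ℝ} (hU : ContDiff ℝ ∞ U) (t : ℝ) (x : E d) :
    ContDiff ℝ ∞ fun w => U (t, x, w) := hU.comp (by fun_prop)

lemma dd_dd_slice {U : Z d → ℝ} (hU : ContDiff ℝ ∞ U) (t : ℝ) (x e : E d) :
    dd e (dd e (fun w => U (t, x, w))) = fun w => DV e (DV e U) (t, x, w) := by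
  rw [dd_slice hU, dd_slice (contDiff_DV hU e)]

lemma lapl_slice {U : Z d → ℝ} (hU : ContDiff ℝ ∞ U) (t : ℝ) (x w : E d) :
    lapl (fun w => U (t, x, w)) w = lapZ U (t, x, w) := by
  simp only [lapl, lapZ, dd_dd_slice hU]

/-- The oscillation of averages of `Q` at scale `r` under a translation by `r ζ`. -/
lemma IsKernel.exists_translate_le {a b : E d → ℝ} (hab : IsKernel a b) {α : ℝ} (hα₀ : 0 < α)
    (hα₁ : α < 1) :
    ∃ C, 0 ≤ C ∧ ∀ (Q : E d → ℝ), Continuous Q → ∀ (v ζ : E d) (G r : ℝ), 0 ≤ G → 0 < r →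
      ‖ζ‖ ≤ 1 → (∀ w, |Q (v + w) - Q v| ≤ G * ‖w‖ ^ α) →
        |(∫ w, a w * Q (v + r • ζ + r • w)) - ∫ w, a w * Q (v + r • w)| ≤
          C * G * r ^ α * ‖ζ‖ := by
  have hac := hasCompactSupport_of_tsupport_subset hab.supp_a
  obtain ⟨C, hC0, hC⟩ := exists_lipschitz_of_hasCompactSupport hab.smooth_a hac
  set V : ℝ := (volume : Measure (E d)).real (Metric.closedBall 0 2)
  have hV0 : 0 ≤ V := measureReal_nonneg
  refine ⟨2 * C * V, by positivity, fun Q hQ v ζ G r hG hr hζ hol => ?_⟩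
  have hcont : Continuous fun w : E d => Q (v + r • w) := hQ.comp (by fun_prop)
  have hcs : HasCompactSupport fun w => a (w - ζ) := by
    simpa [sub_eq_add_neg, Function.comp_def] using
      hac.comp_homeomorph (Homeomorph.addRight (-ζ))
  have hca : Continuous fun w => a (w - ζ) := hab.smooth_a.continuous.comp (by fun_prop)
  have e1 : ∫ w, a w * Q (v + r • ζ + r • w) = ∫ w, a (w - ζ) * Q (v + r • w) := by
    rw [← integral_sub_right_eq_self (fun w => a w * Q (v + r • ζ + r • w)) ζ]
    congr 1
    ext w
    congr 2
    module
  have e2 : ∫ w, (a (w - ζ) - a w) * Q v = 0 := by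
    rw [integral_mul_const, integral_sub (hca.integrable_of_hasCompactSupport hcs)
      (hab.smooth_a.continuous.integrable_of_hasCompactSupport hac),
      integral_sub_right_eq_self a ζ, sub_self, zero_mul]
  have i1 : Integrable fun w => a (w - ζ) * Q (v + r • w) :=
    (hca.mul hcont).integrable_of_hasCompactSupport hcs.mul_right
  have i2 : Integrable fun w => a w * Q (v + r • w) :=
    (hab.smooth_a.continuous.mul hcont).integrable_of_hasCompactSupport hac.mul_right
  have i3 : Integrable fun w => (a (w - ζ) - a w) * Q v :=
    ((hca.integrable_of_hasCompactSupport hcs).sub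
      (hab.smooth_a.continuous.integrable_of_hasCompactSupport hac)).mul_const _
  have e3 : (∫ w, a w * Q (v + r • ζ + r • w)) - ∫ w, a w * Q (v + r • w) =
      ∫ w, (a (w - ζ) - a w) * (Q (v + r • w) - Q v) := by
    have : (fun w => (a (w - ζ) - a w) * (Q (v + r • w) - Q v)) = fun w =>
        (a (w - ζ) * Q (v + r • w) - a w * Q (v + r • w)) - (a (w - ζ) - a w) * Q v := by
      ext w; ring
    have i12 : Integrable fun w => a (w - ζ) * Q (v + r • w) - a w * Q (v + r • w) := i1.sub i2
    rw [e1, this, integral_sub i12 i3, e2, sub_zero, integral_sub i1 i2]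
  rw [e3]
  have := abs_integral_le_of_supp (f := fun w => (a (w - ζ) - a w) * (Q (v + r • w) - Q v))
    (B := C * ‖ζ‖ * (G * (2 * r ^ α))) (ρ := 2) (fun w hw => by
      rw [mem_closedBall_zero_iff, not_le] at hw
      have h0 : ∀ w, 1 < ‖w‖ → a w = 0 := fun w hw =>
        image_eq_zero_of_notMem_tsupport fun h => by
          have := mem_closedBall_zero_iff.1 (hab.supp_a h)
          linarith
      rw [h0 w (by linarith), h0 (w - ζ) (by linarith [norm_sub_norm_le w ζ])]
      simp) (fun w hw => by
      rw [mem_closedBall_zero_iff] at hw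
      rw [abs_mul]
      refine mul_le_mul ?_ ?_ (abs_nonneg _) (by positivity)
      · simpa using hC (w - ζ) w
      · refine (hol _).trans ?_
        gcongr
        rw [norm_smul, Real.norm_of_nonneg hr.le]
        calc (r * ‖w‖) ^ α ≤ (2 * r) ^ α :=
              Real.rpow_le_rpow (by positivity) (by nlinarith) hα₀.le
          _ = 2 ^ α * r ^ α := Real.mul_rpow (by norm_num) hr.le
          _ ≤ 2 ^ (1 : ℝ) * r ^ α := by
            gcongr
            norm_num
          _ = 2 * r ^ α := by norm_num)
  refine this.trans_eq ?_
  ring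

/-- **Absorption**: the seminorm of the Hessian on each time slice improves itself. Differences in
`v` are compared with averages at a large multiple `L` of their length; differences in `x` are
compared with averages in `v`, for which the regularity of `U` in `x` is available. -/
lemma exists_absorb (hd : 1 ≤ d) {α : ℝ} (hα₀ : 0 < α) (hα₁ : α < 1) :
    ∃ C : ℝ, 0 ≤ C ∧ ∀ {Γ M B : ℝ} {I : Set ℝ} {U : Z d → ℝ}, 0 ≤ Γ → 0 ≤ M →
      IsLowerSet I → ContDiff ℝ ∞ U → (∀ t ∈ I, ∀ p, |U (t, p)| ≤ B) →
      (∀ e : E d, HolXV α (Γ * ‖e‖ ^ 2) I univ (DV e (DV e U))) →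
      HolXV α M I univ (transport U) → HolXV α M I univ (lapZ U) →
      ∀ e : E d, HolXV α ((Γ / 2 + C * M) * ‖e‖ ^ 2) I univ (DV e (DV e U)) := by
  obtain ⟨a, b, hab⟩ := exists_isKernel hd
  obtain ⟨C₁, hC₁, h1⟩ := hab.exists_average_sub_le hα₀
  obtain ⟨C₂, hC₂, h2⟩ := hab.exists_translate_le hα₀ hα₁
  obtain ⟨C₃, hC₃, h3⟩ := exists_hol_x hα₀ hα₁
  have hac := hasCompactSupport_of_tsupport_subset hab.supp_a
  obtain ⟨C₄, hC₄, h4⟩ := exists_dd_dd_bound hab.smooth_a hac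
  set V : ℝ := (volume : Measure (E d)).real (Metric.closedBall 0 1)
  have hV0 : 0 ≤ V := measureReal_nonneg
  -- `L` is so large that the old constant `Γ` only contributes a half of itself
  obtain ⟨L, hL1, hL⟩ : ∃ L : ℝ, 1 ≤ L ∧ (C₂ + C₄ * C₃ * V) * L ^ (α - 1) ≤ 1 / 2 := by
    have ht : Tendsto (fun L : ℝ => (C₂ + C₄ * C₃ * V) * L ^ (α - 1)) atTop (𝓝 0) := by
      have := (tendsto_rpow_neg_atTop (y := 1 - α) (by linarith)).const_mul (C₂ + C₄ * C₃ * V)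
      simpa using this
    have := ht.eventually (eventually_le_nhds (by norm_num : (0 : ℝ) < 1 / 2))
    obtain ⟨L, hL⟩ := (this.and (eventually_ge_atTop 1)).exists
    exact ⟨L, hL.2, hL.1⟩
  have hL0 : 0 < L := by linarith
  refine ⟨4 * C₁ * L ^ α + C₄ * C₃ * V, by positivity, ?_⟩
  intro Γ M B I U hΓ hM hI hU hB hq hY hΔ e t ht p _ p' _
  obtain ⟨x, v⟩ := p
  obtain ⟨x', v'⟩ := p'
  have hsl := fun x => contDiff_slice hU t x
  have hlap : ∀ x v w, |lapl (fun w => U (t, x, w)) (v + w) - lapl (fun w => U (t, x, w)) v|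
      ≤ M * ‖w‖ ^ α := by
    intro x v w
    rw [lapl_slice hU, lapl_slice hU]
    have := hΔ t ht (x, v + w) (mem_univ _) (x, v) (mem_univ _)
    rwa [dXV_same_left, add_sub_cancel_left] at this
  have hav : ∀ x v r, 0 < r → |(∫ w, a w * DV e (DV e U) (t, x, v + r • w)) -
      DV e (DV e U) (t, x, v)| ≤ C₁ * ‖e‖ ^ 2 * M * r ^ α := by
    intro x v r hr
    have := h1 _ (hsl x) e v M hM (hlap x v) r hr
    simpa only [dd_dd_slice hU] using this
  -- differences in `v`
  have hv : ∀ x v η, |DV e (DV e U) (t, x, v + η) - DV e (DV e U) (t, x, v)| ≤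
      (C₂ * L ^ (α - 1) * Γ + 2 * C₁ * L ^ α * M) * ‖e‖ ^ 2 * ‖η‖ ^ α := by
    intro x v η
    rcases eq_or_ne η 0 with rfl | hη
    · simp only [add_zero, sub_self, abs_zero]
      positivity
    have hη' : 0 < ‖η‖ := norm_pos_iff.2 hη
    set r : ℝ := L * ‖η‖ with hr
    have hr0 : 0 < r := by positivity
    have hζ : ‖r⁻¹ • η‖ = L⁻¹ := by
      rw [norm_smul, Real.norm_of_nonneg (by positivity), hr]
      field_simp
    have hrζ : r • r⁻¹ • η = η := smul_inv_smul₀ hr0.ne' η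
    have t1 := hav x (v + η) r hr0
    have t2 := hav x v r hr0
    have t3 := h2 (fun w => DV e (DV e U) (t, x, w))
      (contDiff_slice (contDiff_DV (contDiff_DV hU e) e) t x).continuous v (r⁻¹ • η)
      (Γ * ‖e‖ ^ 2) r (by positivity) hr0 (by rw [hζ]; exact inv_le_one_of_one_le₀ hL1)
      (fun w => by
        have := hq e t ht (x, v + w) (mem_univ _) (x, v) (mem_univ _)
        rwa [dXV_same_left, add_sub_cancel_left] at this)
    rw [hrζ, hζ] at t3
    have hrα : r ^ α = L ^ α * ‖η‖ ^ α := Real.mul_rpow hL0.le (norm_nonneg _)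
    have hLα : L ^ (α - 1) = L ^ α * L⁻¹ := by rw [Real.rpow_sub_one hL0.ne', div_eq_mul_inv]
    rw [hrα] at t1 t2 t3
    rw [hLα]
    rw [abs_le] at *
    constructor <;> linarith [t1.1, t1.2, t2.1, t2.2, t3.1, t3.2]
  -- differences in `x`
  have hx : ∀ x y v, |DV e (DV e U) (t, x + y, v) - DV e (DV e U) (t, x, v)| ≤
      (C₄ * C₃ * V * L ^ (α - 1) * (Γ + M) + 2 * C₁ * L ^ α * M) * ‖e‖ ^ 2 *
        (‖y‖ ^ (1 / 3 : ℝ)) ^ α := by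
    intro x y v
    rcases eq_or_ne y 0 with rfl | hy
    · simp only [add_zero, sub_self, abs_zero]
      positivity
    have hy' : 0 < ‖y‖ := norm_pos_iff.2 hy
    set ε : ℝ := ‖y‖ ^ (1 / 3 : ℝ) with hε
    have hε0 : 0 < ε := by positivity
    set r : ℝ := L * ε with hr
    have hr0 : 0 < r := by positivity
    have t1 := hav (x + y) v r hr0
    have t2 := hav x v r hr0
    set f : E d → ℝ := fun w => U (t, x + y, v + r • w) - U (t, x, v + r • w) with hf
    have hfs : ∀ x, ContDiff ℝ ∞ fun w => U (t, x, v + r • w) := fun x =>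
      (hsl x).comp (by fun_prop : ContDiff ℝ ∞ fun w : E d => v + r • w)
    have hdd : ∀ x, dd e (dd e fun w => U (t, x, v + r • w)) =
        fun w => r * (r * DV e (DV e U) (t, x, v + r • w)) := by
      intro x
      rw [dd_comp_affine (hsl x) e v r, dd_slice hU]
      have g1 := contDiff_slice (contDiff_DV hU e) t x
      have g2 := dd_comp_affine g1 e v r
      rw [dd_slice (contDiff_DV hU e)] at g2
      have g3 : ContDiff ℝ ∞ fun w => DV e U (t, x, v + r • w) :=
        g1.comp (by fun_prop : ContDiff ℝ ∞ fun w : E d => v + r • w)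
      change dd e (fun w => r * DV e U (t, x, v + r • w)) = _
      rw [dd_const_mul g3, g2]
    have hddf : dd e (dd e f) = fun w => r * (r * DV e (DV e U) (t, x + y, v + r • w)) -
        r * (r * DV e (DV e U) (t, x, v + r • w)) := by
      rw [hf, dd_sub (hfs _) (hfs _), dd_sub (contDiff_dd (hfs _) e) (contDiff_dd (hfs _) e),
        hdd, hdd]
    have hI1 : ∀ x, Integrable fun w => a w * DV e (DV e U) (t, x, v + r • w) := fun x =>
      (hab.smooth_a.continuous.mul ((contDiff_slice (contDiff_DV (contDiff_DV hU e) e) t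
        x).continuous.comp (by fun_prop))).integrable_of_hasCompactSupport hac.mul_right
    have e1 : ∫ w, dd e (dd e a) w * f w = r ^ 2 * ((∫ w, a w * DV e (DV e U)
        (t, x + y, v + r • w)) - ∫ w, a w * DV e (DV e U) (t, x, v + r • w)) := by
      rw [← integral_mul_dd_dd hab.smooth_a hac ((hfs _).sub (hfs _)) e, hddf,
        ← integral_sub (hI1 _) (hI1 _), ← integral_const_mul]
      congr 1
      ext w
      ring
    have e2 : |∫ w, dd e (dd e a) w * f w| ≤
        C₄ * ‖e‖ ^ 2 * (C₃ * (Γ + M) * (ε ^ 2 * ε ^ α)) * V := by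
      refine abs_integral_le_of_supp (fun w hw => ?_) (fun w _ => ?_)
      · have : dd e (dd e a) w = 0 := image_eq_zero_of_notMem_tsupport fun h => hw
          (hab.supp_a (tsupport_dd_subset _ _ (tsupport_dd_subset _ _ h)))
        rw [this, zero_mul]
      · rw [abs_mul]
        refine mul_le_mul (h4 e w) ?_ (abs_nonneg _) (by positivity)
        have := h3 hΓ hM hI hU hB hq hY t ht x (v + r • w) y
        refine this.trans_eq ?_
        rw [hε, ← Real.rpow_natCast, ← Real.rpow_mul hy'.le, ← Real.rpow_mul hy'.le,
          ← Real.rpow_add hy']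
        congr 2
        push_cast
        ring
    rw [e1, abs_mul, abs_of_nonneg (sq_nonneg r)] at e2
    have t3 : |(∫ w, a w * DV e (DV e U) (t, x + y, v + r • w)) -
        ∫ w, a w * DV e (DV e U) (t, x, v + r • w)| ≤
        C₄ * C₃ * V * L ^ (α - 1) * (Γ + M) * ‖e‖ ^ 2 * ε ^ α := by
      have hL2 : 1 ≤ L ^ 2 * L ^ (α - 1) := by
        rw [← Real.rpow_two, ← Real.rpow_add hL0]
        exact Real.one_le_rpow hL1 (by linarith)
      refine le_of_mul_le_mul_left (e2.trans ?_) (by positivity : 0 < r ^ 2)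
      calc _ = (C₄ * C₃ * V * (Γ + M) * ‖e‖ ^ 2 * ε ^ α * ε ^ 2) * 1 := by ring
        _ ≤ (C₄ * C₃ * V * (Γ + M) * ‖e‖ ^ 2 * ε ^ α * ε ^ 2) * (L ^ 2 * L ^ (α - 1)) := by
          gcongr
        _ = _ := by rw [hr]; ring
    have hrα : r ^ α = L ^ α * ε ^ α := Real.mul_rpow hL0.le hε0.le
    rw [hrα] at t1 t2
    rw [abs_le] at *
    constructor <;> linarith [t1.1, t1.2, t2.1, t2.2, t3.1, t3.2]
  have kv := hv x v' (v - v')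
  have kx := hx x' (x - x') v'
  rw [add_sub_cancel] at kv kx
  set D : ℝ := dXV (x, v) (x', v')
  have m1 : ‖v - v'‖ ^ α ≤ D ^ α := Real.rpow_le_rpow (norm_nonneg _)
    (le_add_of_nonneg_left (by positivity)) hα₀.le
  have m2 : (‖x - x'‖ ^ (1 / 3 : ℝ)) ^ α ≤ D ^ α := Real.rpow_le_rpow (by positivity)
    (le_add_of_nonneg_right (norm_nonneg _)) hα₀.le
  have hLle : L ^ (α - 1) ≤ 1 := Real.rpow_le_one_of_one_le_of_nonpos hL1 (by linarith)
  have n1 := kv.trans (mul_le_mul_of_nonneg_left m1 (by positivity))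
  have n2 := kx.trans (mul_le_mul_of_nonneg_left m2 (by positivity))
  have hD : 0 ≤ ‖e‖ ^ 2 * D ^ α := mul_nonneg (by positivity)
    (Real.rpow_nonneg (dXV_nonneg _ _) _)
  have n3 : |DV e (DV e U) (t, x, v) - DV e (DV e U) (t, x', v')| ≤
      ((C₂ + C₄ * C₃ * V) * L ^ (α - 1) * Γ + (4 * C₁ * L ^ α +
        C₄ * C₃ * V * L ^ (α - 1)) * M) * (‖e‖ ^ 2 * D ^ α) := by
    rw [abs_le] at *
    constructor <;> linarith [n1.1, n1.2, n2.1, n2.2]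
  refine n3.trans ?_
  rw [mul_assoc _ (‖e‖ ^ 2) (D ^ α)]
  refine mul_le_mul_of_nonneg_right ?_ hD
  have o1 := mul_le_mul_of_nonneg_right hL hΓ
  have o2 : C₄ * C₃ * V * L ^ (α - 1) * M ≤ C₄ * C₃ * V * M := by
    have : C₄ * C₃ * V * L ^ (α - 1) ≤ C₄ * C₃ * V := mul_le_of_le_one_right (by positivity) hLle
    exact mul_le_mul_of_nonneg_right this hM
  linarith

/-- The seminorm of the Hessian on time slices is controlled by those of the transport derivative
and of the Laplacian. -/
lemma exists_slice_bound (hd : 1 ≤ d) {α : ℝ} (hα₀ : 0 < α) (hα₁ : α < 1) :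
    ∃ C : ℝ, 0 ≤ C ∧ ∀ {Γ M B : ℝ} {I : Set ℝ} {U : Z d → ℝ}, 0 ≤ Γ → 0 ≤ M →
      IsLowerSet I → ContDiff ℝ ∞ U → (∀ t ∈ I, ∀ p, |U (t, p)| ≤ B) →
      (∀ e : E d, HolXV α (Γ * ‖e‖ ^ 2) I univ (DV e (DV e U))) →
      HolXV α M I univ (transport U) → HolXV α M I univ (lapZ U) →
      ∀ e : E d, HolXV α (C * M * ‖e‖ ^ 2) I univ (DV e (DV e U)) := by
  obtain ⟨C, hC, h⟩ := exists_absorb hd hα₀ hα₁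
  refine ⟨2 * C, by positivity, ?_⟩
  intro Γ M B I U hΓ hM hI hU hB hq hY hΔ
  have key : ∀ n : ℕ, ∀ e : E d,
      HolXV α ((Γ / 2 ^ n + 2 * C * M) * ‖e‖ ^ 2) I univ (DV e (DV e U)) := by
    intro n
    induction n with
    | zero =>
      intro e t ht p hp q hq'
      refine (hq e t ht p hp q hq').trans ?_
      have := Real.rpow_nonneg (dXV_nonneg p q) α
      gcongr
      rw [pow_zero, div_one]
      exact le_add_of_nonneg_right (by positivity)
    | succ n ih =>
      intro e
      have := h (by positivity) hM hI hU hB ih hY hΔ e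
      have e1 : (Γ / 2 ^ n + 2 * C * M) / 2 + C * M = Γ / 2 ^ (n + 1) + 2 * C * M := by
        rw [pow_succ]; ring
      rwa [e1] at this
  intro e t ht p hp q hq'
  have hlim : Tendsto (fun n : ℕ => (Γ / 2 ^ n + 2 * C * M) * ‖e‖ ^ 2 * dXV p q ^ α) atTop
      (𝓝 ((0 + 2 * C * M) * ‖e‖ ^ 2 * dXV p q ^ α)) := by
    have e2 : Tendsto (fun n : ℕ => Γ / 2 ^ n) atTop (𝓝 0) := by
      have := (tendsto_pow_atTop_nhds_zero_of_lt_one (r := (1 / 2 : ℝ)) (by norm_num)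
        (by norm_num)).const_mul Γ
      simpa [div_eq_mul_inv] using this
    exact ((e2.add_const _).mul_const _).mul_const _
  rw [zero_add] at hlim
  exact ge_of_tendsto' hlim fun n => key n e t ht p hp q hq'

lemma rho_nonneg (z z₀ : Z d) : 0 ≤ rho z z₀ :=
  le_max_of_le_left (by positivity)

/-- Regularity on time slices and along characteristics gives kinetic Hölder regularity. -/
lemma abs_sub_le_rho {α : ℝ} (hα₀ : 0 < α) (hα₁ : α < 1) {A : ℝ} (hA : 0 ≤ A) {I : Set ℝ}
    {f : Z d → ℝ} (hf : HolXV α A I univ f)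
    (hft : ∀ t ∈ I, ∀ h, 0 < h → ∀ x v : E d,
      |f (t, x, v) - f (t - h, x + h • v, v)| ≤ A * h ^ (α / 2))
    {z z₀ : Z d} (hz : z.1 ∈ I) (hz₀ : z₀.1 ∈ I) : |f z - f z₀| ≤ 4 * A * rho z z₀ ^ α := by
  obtain ⟨t, x, v⟩ := z
  obtain ⟨t₀, x₀, v₀⟩ := z₀
  set R : ℝ := rho (t, x, v) (t₀, x₀, v₀) with hR
  have hR0 : 0 ≤ R := rho_nonneg _ _
  have r1 : |t - t₀| ^ (1 / 2 : ℝ) ≤ R := le_max_left _ _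
  have r2 : ‖x - x₀ + (t - t₀) • v₀‖ ^ (1 / 3 : ℝ) ≤ R :=
    (le_max_left _ _).trans (le_max_right _ _)
  have r3 : ‖v - v₀‖ ≤ R := (le_max_right _ _).trans (le_max_right _ _)
  have r1' : |t - t₀| ≤ R ^ 2 := by
    have := pow_le_pow_left₀ (by positivity) r1 2
    rwa [← Real.rpow_natCast, ← Real.rpow_mul (abs_nonneg _), Nat.cast_ofNat,
      one_div_mul_cancel two_ne_zero, Real.rpow_one] at this
  have r2' : ‖x - x₀ + (t - t₀) • v₀‖ ≤ R ^ 3 := by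
    have := pow_le_pow_left₀ (by positivity) r2 3
    rwa [← Real.rpow_natCast, ← Real.rpow_mul (norm_nonneg _), Nat.cast_ofNat,
      one_div_mul_cancel three_ne_zero, Real.rpow_one] at this
  have hR3 : ((2 * R) ^ 3) ^ (1 / 3 : ℝ) = 2 * R := by
    rw [← Real.rpow_natCast, ← Real.rpow_mul (by positivity)]; norm_num
  have h3 : (3 * R) ^ α ≤ 3 * R ^ α := by
    rw [Real.mul_rpow (by norm_num) hR0]
    have : (3 : ℝ) ^ α ≤ 3 ^ (1 : ℝ) := Real.rpow_le_rpow_of_exponent_le (by norm_num) hα₁.le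
    rw [Real.rpow_one] at this
    gcongr
  -- spatial differences at one time
  have hsp : ∀ t ∈ I, ∀ p q : E d × E d, ‖p.1 - q.1‖ ≤ (2 * R) ^ 3 → ‖p.2 - q.2‖ ≤ R →
      |f (t, p) - f (t, q)| ≤ 3 * A * R ^ α := by
    intro t ht p q h1 h2
    refine (hf t ht p (mem_univ _) q (mem_univ _)).trans ?_
    have : dXV p q ≤ 3 * R := by
      have := Real.rpow_le_rpow (norm_nonneg _) h1 (by norm_num : (0 : ℝ) ≤ 1 / 3)
      rw [hR3] at this
      unfold dXV
      linarith
    calc A * dXV p q ^ α ≤ A * (3 * R) ^ α := by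
          gcongr
          exact dXV_nonneg _ _
      _ ≤ A * (3 * R ^ α) := by gcongr
      _ = _ := by ring
  have hsq : |t - t₀| ^ (α / 2) ≤ R ^ α := by
    have := Real.rpow_le_rpow (by positivity) r1 hα₀.le
    rw [← Real.rpow_mul (abs_nonneg _)] at this
    convert this using 2
    ring
  have htm : A * |t - t₀| ^ (α / 2) ≤ A * R ^ α := by gcongr
  have hR38 : R ^ 3 ≤ (2 * R) ^ 3 := by gcongr; linarith
  rcases lt_trichotomy t t₀ with h | h | h
  · have k1 := hft t₀ hz₀ (t₀ - t) (by linarith) x₀ v₀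
    rw [sub_sub_cancel] at k1
    have k2 := hsp t hz (x, v) (x₀ + (t₀ - t) • v₀, v₀) (by
      refine le_trans (le_of_eq ?_) (r2'.trans hR38)
      congr 1
      simp only
      module) r3
    rw [abs_of_neg (by linarith), neg_sub] at htm
    rw [abs_le] at *
    constructor <;> linarith [k1.1, k1.2, k2.1, k2.2]
  · subst h
    have k2 := hsp t hz (x, v) (x₀, v₀) (by
      refine le_trans (le_of_eq ?_) (r2'.trans hR38)
      congr 1
      simp) r3
    have : 0 ≤ A * R ^ α := by positivity
    linarith
  · have k1 := hft t hz (t - t₀) (by linarith) x v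
    rw [sub_sub_cancel] at k1
    have k2 := hsp t₀ hz₀ (x + (t - t₀) • v, v) (x₀, v₀) (by
      have e1 : x + (t - t₀) • v - x₀ = (x - x₀ + (t - t₀) • v₀) + (t - t₀) • (v - v₀) := by
        module
      simp only [e1]
      refine (norm_add_le _ _).trans ?_
      rw [norm_smul, Real.norm_eq_abs]
      have : |t - t₀| * ‖v - v₀‖ ≤ R ^ 2 * R := mul_le_mul r1' r3 (norm_nonneg _) (by positivity)
      nlinarith [pow_nonneg hR0 3]) r3
    rw [abs_of_pos (by linarith)] at htm
    rw [abs_le] at *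
    constructor <;> linarith [k1.1, k1.2, k2.1, k2.2]

/-- **A priori estimate** for smooth functions: the kinetic seminorm of the second derivatives is
controlled by the seminorms of the transport derivative and of the Laplacian on time slices. -/
theorem exists_kinetic_bound (hd : 1 ≤ d) {α : ℝ} (hα₀ : 0 < α) (hα₁ : α < 1) :
    ∃ C : ℝ, 0 ≤ C ∧ ∀ {Γ M B : ℝ} {I : Set ℝ} {U : Z d → ℝ}, 0 ≤ Γ → 0 ≤ M →
      IsLowerSet I → ContDiff ℝ ∞ U → (∀ t ∈ I, ∀ p, |U (t, p)| ≤ B) →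
      (∀ e : E d, HolXV α (Γ * ‖e‖ ^ 2) I univ (DV e (DV e U))) →
      HolXV α M I univ (transport U) → HolXV α M I univ (lapZ U) →
      ∀ (e : E d) (z z₀ : Z d), z.1 ∈ I → z₀.1 ∈ I →
        |DV e (DV e U) z - DV e (DV e U) z₀| ≤ C * M * ‖e‖ ^ 2 * rho z z₀ ^ α := by
  obtain ⟨C, hC, h⟩ := exists_slice_bound hd hα₀ hα₁
  obtain ⟨C', hC', h'⟩ := exists_hol_time hα₀ hα₁
  refine ⟨4 * (C + C' * (C + 1)), by positivity, ?_⟩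
  intro Γ M B I U hΓ hM hI hU hB hq hY hΔ e z z₀ hz hz₀
  have hq' := h hΓ hM hI hU hB hq hY hΔ
  have := abs_sub_le_rho (A := (C + C' * (C + 1)) * M * ‖e‖ ^ 2) hα₀ hα₁ (by positivity)
    (f := DV e (DV e U)) (I := I)
    (fun t ht p hp q hqq => by
      refine (hq' e t ht p hp q hqq).trans ?_
      have := Real.rpow_nonneg (dXV_nonneg p q) α
      gcongr
      exact le_add_of_nonneg_right (by positivity))
    (fun t ht s hs x v => by
      rcases eq_or_ne e 0 with rfl | he
      · have : ∀ U : Z d → ℝ, DV 0 U = 0 := fun U => by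
          ext z
          exact map_zero (fderiv ℝ U z)
        rw [this]
        simp
      have he' : 0 < ‖e‖ := norm_pos_iff.2 he
      have e1 : e = ‖e‖ • (‖e‖⁻¹ • e) := (smul_inv_smul₀ he'.ne' e).symm
      have k := h' (by positivity : 0 ≤ C * M) hM hI hU hB hq' hY t ht s hs x v (‖e‖⁻¹ • e)
        (by rw [norm_smul, norm_inv, norm_norm, inv_mul_cancel₀ he'.ne'])
      have k2 : ∀ z, DV e (DV e U) z = ‖e‖ ^ 2 * DV (‖e‖⁻¹ • e) (DV (‖e‖⁻¹ • e) U) z := by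
        intro z
        rw [← DV_DV_smul, ← e1]
      rw [k2, k2, ← mul_sub, abs_mul, abs_of_nonneg (sq_nonneg _)]
      have hs' : 0 ≤ s ^ (α / 2) := by positivity
      calc _ ≤ ‖e‖ ^ 2 * (C' * (C * M + M) * s ^ (α / 2)) := by gcongr
        _ = (C' * (C + 1) * M * ‖e‖ ^ 2) * s ^ (α / 2) := by ring
        _ ≤ _ := by
          gcongr
          exact le_add_of_nonneg_left hC) hz hz₀
  refine this.trans_eq ?_
  ring

/-- A function which is bounded together with its transport derivative and Hölder continuous on
time slices is kinetic Hölder continuous. -/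
lemma kinetic_bound_self {α : ℝ} (hα₀ : 0 < α) (hα₁ : α < 1) {A : ℝ} (hA : 0 ≤ A) {I : Set ℝ}
    (hI : IsLowerSet I) {U : Z d → ℝ} (hU : ContDiff ℝ ∞ U) (hB : ∀ t ∈ I, ∀ p, |U (t, p)| ≤ A)
    (hol : HolXV α A I univ U) (hY : ∀ t ∈ I, ∀ p, |transport U (t, p)| ≤ A) (z z₀ : Z d)
    (hz : z.1 ∈ I) (hz₀ : z₀.1 ∈ I) : |U z - U z₀| ≤ 8 * A * rho z z₀ ^ α := by
  have := abs_sub_le_rho (A := 2 * A) hα₀ hα₁ (by positivity) (f := U) (I := I)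
    (fun t ht p hp q hq => (hol t ht p hp q hq).trans (by
      have := Real.rpow_nonneg (dXV_nonneg p q) α
      gcongr
      linarith))
    (fun t ht h hh x v => by
      have k1 := abs_sub_le_of_hasDerivAt (S := h) (C := A)
        (fun s => hasDerivAt_transport hU t x v s) hh.le (fun s hs => by
          rw [abs_neg]
          exact hY _ (hI (by linarith [hs.1] : t - s ≤ t) ht) _)
      simp only [sub_zero, zero_smul, add_zero] at k1
      rw [abs_sub_comm] at k1
      rcases le_total h 1 with h1 | h1
      · have : h ≤ h ^ (α / 2) := by
          simpa using Real.rpow_le_rpow_of_exponent_ge hh h1 (by linarith : α / 2 ≤ 1)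
        nlinarith
      · have h2 : 1 ≤ h ^ (α / 2) := Real.one_le_rpow h1 (by linarith)
        have k2 := abs_le.1 (hB t ht (x, v))
        have k3 := abs_le.1 (hB (t - h) (hI (by linarith : t - h ≤ t) ht) (x + h • v, v))
        rw [abs_le]
        constructor <;> nlinarith [k2.1, k2.2, k3.1, k3.2]) hz hz₀
  refine this.trans_eq ?_
  ring


/-! ### Mollification adapted to the kinetic group -/

instance isAddHaarMeasure_volume_Z : (volume : Measure (Z d)).IsAddHaarMeasure := by
  have h : (volume : Measure (E d × E d)).IsAddHaarMeasure :=
    Measure.prod.instIsAddHaarMeasure volume volume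
  exact Measure.prod.instIsAddHaarMeasure volume volume

/-- The product `z₀ ∘ z` of the kinetic group, for which `∂_t - v · D_x` and `D_v` are left
invariant. -/
def trl (z₀ z : Z d) : Z d := (z₀.1 + z.1, z₀.2.1 + z.2.1 - z.1 • z₀.2.2, z₀.2.2 + z.2.2)

/-- The kernel `φ(ζ ∘ z⁻¹)`. -/
def ker (φ : Z d → ℝ) (z ζ : Z d) : ℝ :=
  φ (ζ.1 - z.1, ζ.2.1 - z.2.1 + z.1 • (ζ.2.2 - z.2.2), ζ.2.2 - z.2.2)

/-- The mollification `z ↦ ∫ φ(z₀) u(z₀ ∘ z) dz₀`, written as an integral against the smooth kernel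
`ker φ`. -/
def moll (φ u : Z d → ℝ) (z : Z d) : ℝ := ∫ ζ, ker φ z ζ * u ζ

lemma ker_trl (φ : Z d → ℝ) (z₀ z : Z d) : ker φ z (trl z₀ z) = φ z₀ := by
  unfold ker trl
  congr 1
  ext : 1
  · simp
  · ext : 1
    · simp only; module
    · simp only; module

lemma eq_trl (z ζ : Z d) :
    ζ = trl (ζ.1 - z.1, ζ.2.1 - z.2.1 + z.1 • (ζ.2.2 - z.2.2), ζ.2.2 - z.2.2) z := by
  unfold trl
  ext : 1
  · simp
  · ext : 1
    · simp only; module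
    · simp only; module

lemma continuous_trl : Continuous fun p : Z d × Z d => trl p.1 p.2 := by
  unfold trl
  fun_prop

lemma contDiff_ker {φ : Z d → ℝ} (hφ : ContDiff ℝ ∞ φ) :
    ContDiff ℝ ∞ fun p : Z d × Z d => ker φ p.1 p.2 := by
  unfold ker
  exact hφ.comp (by fun_prop)

lemma measurePreserving_trl (z : Z d) : MeasurePreserving (fun z₀ => trl z₀ z) := by
  obtain ⟨t, x, v⟩ := z
  have h1 : MeasurePreserving (fun p : E d × E d => (p.1 + v, p.2 + (x - t • p.1)))
      (volume.prod volume) (volume.prod volume) :=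
    (measurePreserving_add_right volume v).skew_product (g := fun a b => b + (x - t • a))
      (by fun_prop) (Eventually.of_forall fun a =>
        (measurePreserving_add_right volume (x - t • a)).map_eq)
  have h2 : MeasurePreserving (fun p : E d × E d => (p.1 + (x - t • p.2), p.2 + v))
      (volume.prod volume) (volume.prod volume) :=
    (Measure.measurePreserving_swap.comp (h1.comp Measure.measurePreserving_swap))
  have h3 := (measurePreserving_add_right (volume : Measure ℝ) t).prod h2
  have h4 : (fun z₀ : Z d => trl z₀ (t, x, v)) =
      Prod.map (fun s => s + t) fun p : E d × E d => (p.1 + (x - t • p.2), p.2 + v) := by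
    ext z : 1
    simp only [trl, Prod.map, Prod.mk.injEq, true_and, and_true]
    module
  rw [h4]
  exact h3

/-- The right translation `z₀ ↦ z₀ ∘ z` of the kinetic group, as a homeomorphism. -/
def trlHomeomorph (z : Z d) : Z d ≃ₜ Z d where
  toFun z₀ := trl z₀ z
  invFun ζ := (ζ.1 - z.1, ζ.2.1 - z.2.1 + z.1 • (ζ.2.2 - z.2.2), ζ.2.2 - z.2.2)
  left_inv z₀ := by
    unfold trl
    ext : 1
    · simp
    · ext : 1
      · simp only; module
      · simp only; module
  right_inv ζ := (eq_trl z ζ).symm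
  continuous_toFun := by unfold trl; fun_prop
  continuous_invFun := by fun_prop

lemma moll_eq (φ u : Z d → ℝ) (z : Z d) : moll φ u z = ∫ z₀, φ z₀ * u (trl z₀ z) := by
  have := (measurePreserving_trl z).integral_comp (trlHomeomorph z).measurableEmbedding
    (fun ζ => ker φ z ζ * u ζ)
  rw [moll, ← this]
  simp only [ker_trl]

lemma integrable_moll {φ u : Z d → ℝ} (hφ : Continuous φ) (hφc : HasCompactSupport φ)
    (hu : LocallyIntegrable u) (z : Z d) : Integrable fun z₀ => φ z₀ * u (trl z₀ z) := by
  have hk : Continuous (ker φ z) := by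
    unfold ker
    exact hφ.comp (by fun_prop)
  have hc : HasCompactSupport (ker φ z) := hφc.comp_homeomorph (trlHomeomorph z).symm
  have h1 : Integrable fun ζ => ker φ z ζ * u ζ := by
    simpa using hu.integrable_smul_left_of_hasCompactSupport hk hc
  have h2 := (measurePreserving_trl z).integrable_comp_of_integrable h1
  simpa [Function.comp_def, ker_trl] using h2

/-- Smooth kernels on pairs of points, locally uniformly of compact support in the second one, and
invariant under simultaneous translations in `v`. Derivatives in `v` of `ker φ` are again of this
form. -/
structure IsSmoothKer (κ : Z d → Z d → ℝ) : Prop where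
  smooth : ContDiff ℝ ∞ fun p : Z d × Z d => κ p.1 p.2
  supp : ∀ z₁ : Z d, ∃ K : Set (Z d), IsCompact K ∧
    ∀ z ∈ Metric.ball z₁ 1, ∀ ζ ∉ K, κ z ζ = 0
  inv : ∀ (z ζ : Z d) (e : E d) (s : ℝ), κ (z + s • (0, 0, e)) ζ = κ z (ζ - s • (0, 0, e))

lemma isSmoothKer_ker {φ : Z d → ℝ} (hφ : ContDiff ℝ ∞ φ) (hφc : HasCompactSupport φ) :
    IsSmoothKer (ker φ) where
  smooth := contDiff_ker hφ
  supp z₁ := by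
    refine ⟨(fun p : Z d × Z d => trl p.1 p.2) '' (tsupport φ ×ˢ Metric.closedBall z₁ 1),
      (hφc.isCompact.prod (isCompact_closedBall z₁ 1)).image continuous_trl, ?_⟩
    intro z hz ζ hζ
    refine image_eq_zero_of_notMem_tsupport (f := φ) fun h => hζ ?_
    exact ⟨(_, z), ⟨h, Metric.ball_subset_closedBall hz⟩, (eq_trl z ζ).symm⟩
  inv z ζ e s := by
    unfold ker
    congr 1
    ext : 1
    · simp
    · ext : 1
      · simp only [Prod.fst_add, Prod.snd_add, Prod.smul_fst, Prod.smul_snd, Prod.fst_sub,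
          Prod.snd_sub, smul_zero, smul_eq_mul, mul_zero]
        module
      · simp only [Prod.snd_add, Prod.smul_snd, Prod.snd_sub]
        module

lemma contDiff_ker_right {κ : Z d → Z d → ℝ} (hκ : IsSmoothKer κ) (z : Z d) :
    ContDiff ℝ ∞ (κ z) :=
  hκ.smooth.comp (by fun_prop : ContDiff ℝ ∞ fun ζ : Z d => (z, ζ))

lemma isSmoothKer_DV {κ : Z d → Z d → ℝ} (hκ : IsSmoothKer κ) (e : E d) :
    IsSmoothKer fun z ζ => DV e (κ z) ζ where
  smooth := by
    have h1 : ∀ p : Z d × Z d, DV e (κ p.1) p.2 =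
        fderiv ℝ (fun p : Z d × Z d => κ p.1 p.2) p (0, 0, 0, e) := by
      rintro ⟨z, ζ⟩
      have h2 : HasFDerivAt (fun ζ : Z d => ((z, ζ) : Z d × Z d))
          ((0 : Z d →L[ℝ] Z d).prod (ContinuousLinearMap.id ℝ (Z d))) ζ :=
        (hasFDerivAt_const z ζ).prodMk (hasFDerivAt_id ζ)
      have h3 := (hκ.smooth.differentiable (by simp) (z, ζ)).hasFDerivAt.comp ζ h2
      have h4 : fderiv ℝ (κ z) ζ = _ := h3.fderiv
      rw [DV, h4]
      rfl
    simp only [h1]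
    have := (contDiff_infty_iff_fderiv.1 hκ.smooth).2
    fun_prop
  supp z₁ := by
    obtain ⟨K, hK, h⟩ := hκ.supp z₁
    refine ⟨K, hK, fun z hz ζ hζ => ?_⟩
    have : κ z =ᶠ[𝓝 ζ] fun _ => 0 := by
      filter_upwards [hK.isClosed.isOpen_compl.mem_nhds hζ] with ζ' h' using h z hz ζ' h'
    rw [DV, this.fderiv_eq]
    simp
  inv z ζ e' s := by
    have h1 : κ (z + s • (0, 0, e')) = fun ζ => κ z (ζ - s • (0, 0, e')) := by
      ext ζ
      exact hκ.inv z ζ e' s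
    rw [DV, DV, h1, fderiv_comp_sub]

lemma contDiff_integral_ker {κ : Z d → Z d → ℝ} (hκ : IsSmoothKer κ) {u : Z d → ℝ}
    (hu : LocallyIntegrable u) : ContDiff ℝ ∞ fun z => ∫ ζ, κ z ζ * u ζ := by
  rw [contDiff_iff_contDiffAt]
  intro z₁
  obtain ⟨K, hK, h⟩ := hκ.supp z₁
  have := contDiffOn_convolution_right_with_param_comp (n := ⊤) (μ := (volume : Measure (Z d)))
    (ContinuousLinearMap.mul ℝ ℝ) (s := Metric.ball z₁ 1) (v := fun _ => (0 : Z d))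
    contDiffOn_const (f := u) (g := fun z ζ => κ z (-ζ)) (k := -K) Metric.isOpen_ball hK.neg
    (fun z ζ hz hζ => h z hz _ (by simpa using hζ)) hu
    ((hκ.smooth.comp (by fun_prop : ContDiff ℝ ∞ fun p : Z d × Z d => (p.1, -p.2))).contDiffOn)
  have h2 := this.contDiffAt (Metric.ball_mem_nhds z₁ one_pos)
  refine h2.congr_of_eventuallyEq (Eventually.of_forall fun z => ?_)
  simp only [convolution_def, zero_sub, neg_neg, ContinuousLinearMap.mul_apply']
  congr 1
  ext ζ
  ring

/-- If the kernel `κ` is invariant when its first variable moves along `a` and its second one along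
the field `b`, then a derivative of `∫ κ(z, ζ) u(ζ) dζ` along `a` falls on the second variable of
`κ`, with the opposite sign. -/
lemma fderiv_integral_ker {κ : Z d → Z d → ℝ} (hκ : IsSmoothKer κ) {u : Z d → ℝ}
    (hu : LocallyIntegrable u) (z a : Z d) (b : Z d → Z d)
    (hab : ∀ ζ (s : ℝ), κ (z + s • a) ζ = κ z (ζ - s • b ζ)) :
    fderiv ℝ (fun z => ∫ ζ, κ z ζ * u ζ) z a = -∫ ζ, fderiv ℝ (κ z) ζ (b ζ) * u ζ := by
  have hdir := ((contDiff_integral_ker hκ hu).differentiable (by simp) z).hasFDerivAt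
  have hline : HasDerivAt (fun s : ℝ => z + s • a) a 0 := by
    simpa using ((hasDerivAt_id (0 : ℝ)).smul_const a).const_add z
  have h1 : HasDerivAt (fun s : ℝ => ∫ ζ, κ (z + s • a) ζ * u ζ)
      (fderiv ℝ (fun z => ∫ ζ, κ z ζ * u ζ) z a) 0 := by
    refine HasFDerivAt.comp_hasDerivAt (f := fun s : ℝ => z + s • a)
      (l := fun z => ∫ ζ, κ z ζ * u ζ) 0 ?_ hline
    simpa using hdir
  -- the supports are uniformly compact along a short piece of the line
  obtain ⟨K, hK, hsupp⟩ := hκ.supp z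
  set c : ℝ := (1 + ‖a‖)⁻¹ with hc
  have hc0 : 0 < c := by positivity
  set k : ℝ × Z d → ℝ := fun p => κ (z + (p.1 * c) • a) p.2 with hk
  have hks : ContDiff ℝ ∞ k := hκ.smooth.comp
    (by fun_prop : ContDiff ℝ ∞ fun p : ℝ × Z d => (z + (p.1 * c) • a, p.2))
  have h2 := hasDerivAt_integral_kernel (μ := (volume : Measure (Z d))) (k := k)
    (hks.of_le (by simp)) hK 0 (fun s hs ζ hζ => by
      refine hsupp _ ?_ ζ hζ
      rw [mem_ball_zero_iff, Real.norm_eq_abs] at hs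
      rw [mem_ball_iff_norm, add_sub_cancel_left, norm_smul, Real.norm_eq_abs, abs_mul,
        abs_of_pos hc0]
      have h5 : c * ‖a‖ < 1 := by
        rw [hc, inv_mul_lt_iff₀ (by positivity)]; linarith
      have h6 : |s| * (c * ‖a‖) ≤ 1 * (c * ‖a‖) := by gcongr
      linarith [mul_assoc |s| c ‖a‖]) hu
  have h3 : HasDerivAt (fun s : ℝ => ∫ ζ, k (s, ζ) * u ζ)
      (fderiv ℝ (fun z => ∫ ζ, κ z ζ * u ζ) z a * c) 0 := by
    have hin : HasDerivAt (fun s : ℝ => s * c) c 0 := by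
      simpa using (hasDerivAt_id (0 : ℝ)).mul_const c
    have h1' : HasDerivAt (fun s : ℝ => ∫ ζ, κ (z + s • a) ζ * u ζ)
      (fderiv ℝ (fun z => ∫ ζ, κ z ζ * u ζ) z a) (0 * c) := by rwa [zero_mul]
    exact HasDerivAt.comp (h₂ := fun s : ℝ => ∫ ζ, κ (z + s • a) ζ * u ζ)
      (h := fun s : ℝ => s * c) 0 h1' hin
  have h4 : ∀ ζ, fderiv ℝ k (0, ζ) (1, 0) = -(c * fderiv ℝ (κ z) ζ (b ζ)) := by
    intro ζ
    have d1 : HasDerivAt (fun s : ℝ => k (s, ζ)) (fderiv ℝ k (0, ζ) (1, 0)) 0 :=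
      HasFDerivAt.comp_hasDerivAt (f := fun s : ℝ => (s, ζ)) 0
        (hks.differentiable (by simp) (0, ζ)).hasFDerivAt
        ((hasDerivAt_id 0).prodMk (hasDerivAt_const 0 ζ))
    have d2 : HasDerivAt (fun s : ℝ => ζ - (s * c) • b ζ) (-(c • b ζ)) 0 := by
      simpa using (((hasDerivAt_id (0 : ℝ)).mul_const c).smul_const (b ζ)).const_sub ζ
    have d3 : HasDerivAt (fun s : ℝ => κ z (ζ - (s * c) • b ζ))
        (fderiv ℝ (κ z) ζ (-(c • b ζ))) 0 := by
      refine HasFDerivAt.comp_hasDerivAt (f := fun s : ℝ => ζ - (s * c) • b ζ) 0 ?_ d2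
      simpa using ((contDiff_ker_right hκ z).differentiable (by simp) ζ).hasFDerivAt
    have d4 : (fun s : ℝ => k (s, ζ)) = fun s : ℝ => κ z (ζ - (s * c) • b ζ) := by
      ext s
      exact hab ζ (s * c)
    rw [d4] at d1
    rw [d1.unique d3, map_neg, map_smul, smul_eq_mul]
  have h5 := h3.unique h2
  simp only [h4] at h5
  have h6 : ∫ ζ, -(c * fderiv ℝ (κ z) ζ (b ζ)) * u ζ =
      c * -∫ ζ, fderiv ℝ (κ z) ζ (b ζ) * u ζ := by
    rw [← integral_neg, ← integral_const_mul]
    congr 1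
    ext ζ
    ring
  rw [h6, mul_comm] at h5
  exact mul_left_cancel₀ hc0.ne' h5

lemma DV_integral_ker {κ : Z d → Z d → ℝ} (hκ : IsSmoothKer κ) {u : Z d → ℝ}
    (hu : LocallyIntegrable u) (e : E d) (z : Z d) :
    DV e (fun z => ∫ ζ, κ z ζ * u ζ) z = -∫ ζ, DV e (κ z) ζ * u ζ :=
  fderiv_integral_ker hκ hu z _ (fun _ => (0, 0, e)) fun ζ s => hκ.inv z ζ e s

lemma contDiff_moll {φ u : Z d → ℝ} (hφ : ContDiff ℝ ∞ φ) (hφc : HasCompactSupport φ)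
    (hu : LocallyIntegrable u) : ContDiff ℝ ∞ (moll φ u) :=
  contDiff_integral_ker (isSmoothKer_ker hφ hφc) hu

lemma DV_moll {φ u : Z d → ℝ} (hφ : ContDiff ℝ ∞ φ) (hφc : HasCompactSupport φ)
    (hu : LocallyIntegrable u) (e : E d) (z : Z d) :
    DV e (moll φ u) z = -∫ ζ, DV e (ker φ z) ζ * u ζ :=
  DV_integral_ker (isSmoothKer_ker hφ hφc) hu e z

lemma DV_DV_moll {φ u : Z d → ℝ} (hφ : ContDiff ℝ ∞ φ) (hφc : HasCompactSupport φ)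
    (hu : LocallyIntegrable u) (e e' : E d) (z : Z d) :
    DV e (DV e' (moll φ u)) z = ∫ ζ, DV e (DV e' (ker φ z)) ζ * u ζ := by
  have h1 : DV e' (moll φ u) = -fun z => ∫ ζ, DV e' (ker φ z) ζ * u ζ := by
    ext z
    exact DV_moll hφ hφc hu e' z
  have h2 := DV_integral_ker (isSmoothKer_DV (isSmoothKer_ker hφ hφc) e') hu e z
  rw [h1, DV, fderiv_neg]
  rw [DV] at h2
  simp only [neg_apply, h2, neg_neg]

lemma transport_moll {φ u : Z d → ℝ} (hφ : ContDiff ℝ ∞ φ) (hφc : HasCompactSupport φ)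
    (hu : LocallyIntegrable u) (z : Z d) :
    transport (moll φ u) z = -∫ ζ, transport (ker φ z) ζ * u ζ := by
  refine fderiv_integral_ker (isSmoothKer_ker hφ hφc) hu z _ (fun ζ => (1, -ζ.2.2, 0))
    fun ζ s => ?_
  unfold ker
  congr 1
  ext : 1
  · simp only [Prod.fst_add, Prod.smul_fst, Prod.fst_sub, smul_eq_mul, mul_one]
    ring
  · ext : 1
    · simp only [Prod.fst_add, Prod.snd_add, Prod.smul_fst, Prod.smul_snd, Prod.fst_sub,
        Prod.snd_sub, smul_zero, smul_eq_mul, mul_one, add_zero, sub_zero]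
      module
    · simp


/-! ### Mollification of weak derivatives -/

/-- A mollifier at scale `ε`, supported at negative times, so that mollification only looks into
the past. -/
structure IsMollifier (ε : ℝ) (φ : Z d → ℝ) : Prop where
  smooth : ContDiff ℝ ∞ φ
  compact : HasCompactSupport φ
  nonneg : ∀ z, 0 ≤ φ z
  integral : ∫ z, φ z = 1
  norm_le : ∀ z ∈ tsupport φ, ‖z‖ ≤ 3 * ε
  neg : ∀ z ∈ tsupport φ, z.1 < 0
  le : ∀ z, φ z ≤ 1 / (volume : Measure (Z d)).real (Metric.closedBall 0 (ε / 2))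

lemma exists_isMollifier {ε : ℝ} (hε : 0 < ε) : ∃ φ : Z d → ℝ, IsMollifier ε φ := by
  let c : Z d := (-(2 * ε), 0, 0)
  let f : ContDiffBump c := ⟨ε / 2, ε, by positivity, by linarith⟩
  have hc : ‖c‖ = 2 * ε := by
    simp [c, Prod.norm_def, abs_of_pos hε, hε.le]
  have hts : tsupport (f.normed volume) = Metric.closedBall c ε := f.tsupport_normed_eq
  refine ⟨f.normed volume, f.contDiff_normed, f.hasCompactSupport_normed,
    fun z => f.nonneg_normed z, f.integral_normed, fun z hz => ?_, fun z hz => ?_, fun z => ?_⟩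
  · rw [hts, mem_closedBall_iff_norm] at hz
    have := norm_sub_norm_le z c
    linarith
  · rw [hts, mem_closedBall_iff_norm] at hz
    have h1 := (norm_fst_le (z - c)).trans hz
    rw [Real.norm_eq_abs, abs_le] at h1
    simp only [Prod.fst_sub, c] at h1
    linarith [h1.2]
  · have := f.normed_le_div_measure_closedBall_rIn volume z
    rwa [measureReal_def, Measure.addHaar_closedBall_center] at this

/-- The points whose mollification only involves values on `G`. -/
def Reaches (G : Set (Z d)) (φ : Z d → ℝ) (z : Z d) : Prop :=
  ∀ z₀ ∈ tsupport φ, trl z₀ z ∈ G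

lemma isTest_ker {G : Set (Z d)} {φ : Z d → ℝ} (hφ : ContDiff ℝ ∞ φ) (hφc : HasCompactSupport φ)
    {z : Z d} (hz : Reaches G φ z) : IsTest G (ker φ z) where
  smooth := contDiff_ker_right (isSmoothKer_ker hφ hφc) z
  compact := hφc.comp_homeomorph (trlHomeomorph z).symm
  support := by
    have hcl : IsClosed ((fun z₀ => trl z₀ z) '' tsupport φ) :=
      (hφc.isCompact.image (trlHomeomorph z).continuous).isClosed
    refine (closure_minimal (fun ζ hζ => ?_) hcl).trans
      (image_subset_iff.2 fun z₀ h => hz z₀ h)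
    exact ⟨_, subset_closure hζ, (eq_trl z ζ).symm⟩

lemma integral_mul_indicator {X : Type*} [MeasurableSpace X] {μ : Measure X} {G : Set X}
    (hG : MeasurableSet G) (k u : X → ℝ) :
    ∫ ζ, k ζ * G.indicator u ζ ∂μ = ∫ ζ in G, u ζ * k ζ ∂μ := by
  rw [← integral_indicator hG]
  congr 1
  ext ζ
  by_cases h : ζ ∈ G
  · simp [h, mul_comm]
  · simp [h]

lemma partialV_partialV_moll {G : Set (Z d)} (hG : MeasurableSet G) {φ : Z d → ℝ}
    (hφ : ContDiff ℝ ∞ φ) (hφc : HasCompactSupport φ) {u : Z d → ℝ}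
    (hu : LocallyIntegrable (G.indicator u)) {D2u : Z d → EuclideanSpace ℝ (Fin d × Fin d)}
    (h : IsWeakHessV G u D2u) {z : Z d} (hz : Reaches G φ z) (i j : Fin d) :
    partialV i (partialV j (moll φ (G.indicator u))) z =
      moll φ (G.indicator fun z => D2u z (i, j)) z := by
  have h1 := DV_DV_moll hφ hφc hu (EuclideanSpace.single i 1) (EuclideanSpace.single j 1) z
  have h2 := h.integral_eq _ (isTest_ker hφ hφc hz) i j
  rw [partialV_eq_DV, partialV_eq_DV, h1, moll, integral_mul_indicator hG,
    integral_mul_indicator hG, h2]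
  rfl

lemma partialV_moll {G : Set (Z d)} (hG : MeasurableSet G) {φ : Z d → ℝ}
    (hφ : ContDiff ℝ ∞ φ) (hφc : HasCompactSupport φ) {u : Z d → ℝ}
    (hu : LocallyIntegrable (G.indicator u)) {Du : Z d → E d}
    (h : IsWeakGradV G u Du) {z : Z d} (hz : Reaches G φ z) (i : Fin d) :
    partialV i (moll φ (G.indicator u)) z = moll φ (G.indicator fun z => Du z i) z := by
  have h1 := DV_moll hφ hφc hu (EuclideanSpace.single i 1) z
  have h2 := h.integral_eq _ (isTest_ker hφ hφc hz) i
  rw [partialV_eq_DV, h1, moll, integral_mul_indicator hG, integral_mul_indicator hG, h2]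
  rfl

lemma transport_moll_indicator {G : Set (Z d)} (hG : MeasurableSet G) {φ : Z d → ℝ}
    (hφ : ContDiff ℝ ∞ φ) (hφc : HasCompactSupport φ) {u : Z d → ℝ}
    (hu : LocallyIntegrable (G.indicator u)) {Yu : Z d → ℝ}
    (h : IsWeakTransport G u Yu) {z : Z d} (hz : Reaches G φ z) :
    transport (moll φ (G.indicator u)) z = moll φ (G.indicator Yu) z := by
  rw [transport_moll hφ hφc hu, moll, integral_mul_indicator hG, integral_mul_indicator hG,
    h.integral_eq _ (isTest_ker hφ hφc hz)]

/-! ### Mollification preserves bounds -/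

/-- A bounded measurable function on `G`, extended by zero, is locally integrable. -/
lemma locallyIntegrable_indicator {G : Set (Z d)} (hG : MeasurableSet G) {g : Z d → ℝ} {B : ℝ}
    (hg : AEStronglyMeasurable g (volume.restrict G))
    (hB : ∀ᵐ z ∂(volume.restrict G), |g z| ≤ B) : LocallyIntegrable (G.indicator g) := by
  have hm : AEStronglyMeasurable (G.indicator g) volume :=
    (aestronglyMeasurable_indicator_iff hG).2 hg
  refine (locallyIntegrable_const (|B|)).mono hm ?_
  rw [ae_restrict_iff' hG] at hB
  filter_upwards [hB] with z hz
  by_cases h : z ∈ G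
  · rw [indicator_of_mem h, Real.norm_eq_abs, Real.norm_eq_abs, abs_abs]
    exact (hz h).trans (le_abs_self B)
  · simp [h]

lemma abs_moll_le {ε : ℝ} {φ : Z d → ℝ} (hφ : IsMollifier ε φ) {G : Set (Z d)}
    (hG : MeasurableSet G) {g : Z d → ℝ} {B : ℝ} (hB0 : 0 ≤ B)
    (hB : ∀ᵐ z ∂(volume.restrict G), |g z| ≤ B) (z : Z d) :
    |moll φ (G.indicator g) z| ≤ B := by
  rw [moll_eq, ← Real.norm_eq_abs]
  rw [ae_restrict_iff' hG] at hB
  have hB' := (measurePreserving_trl z).quasiMeasurePreserving.ae hB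
  have hint : Integrable φ := hφ.smooth.continuous.integrable_of_hasCompactSupport hφ.compact
  have := norm_integral_le_of_norm_le (f := fun z₀ => φ z₀ * G.indicator g (trl z₀ z))
    (hint.mul_const B) (by
      filter_upwards [hB'] with z₀ h
      rw [norm_mul, Real.norm_of_nonneg (hφ.nonneg z₀)]
      refine mul_le_mul_of_nonneg_left ?_ (hφ.nonneg z₀)
      by_cases hm : trl z₀ z ∈ G
      · rw [indicator_of_mem hm]
        exact h hm
      · simpa [hm] using hB0)
  rwa [integral_mul_const, hφ.integral, one_mul] at this

/-- Up to a null set, `g` is Hölder continuous in `(x, v) ∈ D` at almost every time in `I`. -/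
def AEHol (α C : ℝ) (I : Set ℝ) (D : Set (E d × E d)) (g : Z d → ℝ) : Prop :=
  ∃ w : Z d → ℝ, w =ᵐ[volume.restrict (I ×ˢ D)] g ∧
    ∀ᵐ t ∂(volume.restrict I), ∀ p ∈ D, ∀ q ∈ D, |w (t, p) - w (t, q)| ≤ C * dXV p q ^ α

lemma dXV_trl (z₀ : Z d) (t : ℝ) (p q : E d × E d) :
    dXV (trl z₀ (t, p)).2 (trl z₀ (t, q)).2 = dXV p q := by
  have h1 : (trl z₀ (t, p)).2.1 - (trl z₀ (t, q)).2.1 = p.1 - q.1 := by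
    simp only [trl]; module
  have h2 : (trl z₀ (t, p)).2.2 - (trl z₀ (t, q)).2.2 = p.2 - q.2 := by
    simp only [trl]; module
  rw [dXV, h1, h2, dXV]

lemma hol_moll {ε : ℝ} {φ : Z d → ℝ} (hφ : IsMollifier ε φ) {α C : ℝ} {I : Set ℝ}
    {D : Set (E d × E d)} (hI : MeasurableSet I) (hD : MeasurableSet D)
    {g : Z d → ℝ} (hgl : LocallyIntegrable ((I ×ˢ D).indicator g)) (hg : AEHol α C I D g)
    {t : ℝ} {p q : E d × E d} (hp : Reaches (I ×ˢ D) φ (t, p)) (hq : Reaches (I ×ˢ D) φ (t, q)) :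
    |moll φ ((I ×ˢ D).indicator g) (t, p) - moll φ ((I ×ˢ D).indicator g) (t, q)| ≤
      C * dXV p q ^ α := by
  obtain ⟨w, hw, hwt⟩ := hg
  set G : Set (Z d) := I ×ˢ D with hGdef
  have hG : MeasurableSet G := hI.prod hD
  rw [Filter.EventuallyEq, ae_restrict_iff' hG] at hw
  rw [ae_restrict_iff' hI] at hwt
  have a1 := (measurePreserving_trl (t, p)).quasiMeasurePreserving.ae hw
  have a2 := (measurePreserving_trl (t, q)).quasiMeasurePreserving.ae hw
  have hfst : Measure.QuasiMeasurePreserving (Prod.fst : Z d → ℝ) volume volume :=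
    Measure.quasiMeasurePreserving_fst
  have a3 := (hfst.comp (measurePreserving_trl (t, p)).quasiMeasurePreserving).ae hwt
  have hint : Integrable φ := hφ.smooth.continuous.integrable_of_hasCompactSupport hφ.compact
  rw [moll_eq, moll_eq, ← integral_sub (integrable_moll hφ.smooth.continuous hφ.compact hgl _)
    (integrable_moll hφ.smooth.continuous hφ.compact hgl _), ← Real.norm_eq_abs]
  have := norm_integral_le_of_norm_le (f := fun z₀ => φ z₀ * G.indicator g (trl z₀ (t, p)) -
      φ z₀ * G.indicator g (trl z₀ (t, q))) (hint.mul_const (C * dXV p q ^ α)) (by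
      filter_upwards [a1, a2, a3] with z₀ h1 h2 h3
      by_cases hs : z₀ ∈ tsupport φ
      · have m1 := hp z₀ hs
        have m2 := hq z₀ hs
        rw [indicator_of_mem m1, indicator_of_mem m2, ← h1 m1, ← h2 m2, ← mul_sub, norm_mul,
          Real.norm_of_nonneg (hφ.nonneg z₀)]
        refine mul_le_mul_of_nonneg_left ?_ (hφ.nonneg z₀)
        have := h3 m1.1 _ m1.2 _ m2.2
        rwa [dXV_trl] at this
      · simp [image_eq_zero_of_notMem_tsupport hs])
  rwa [integral_mul_const, hφ.integral, one_mul] at this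

/-! ### Convergence of the mollifications -/

lemma norm_trl_sub_le (z₀ z : Z d) : ‖trl z₀ z - z‖ ≤ (1 + |z.1|) * ‖z₀‖ := by
  have h1 : ‖z₀.1‖ ≤ ‖z₀‖ := norm_fst_le z₀
  have h2 : ‖z₀.2.1‖ ≤ ‖z₀‖ := (norm_fst_le z₀.2).trans (norm_snd_le z₀)
  have h3 : ‖z₀.2.2‖ ≤ ‖z₀‖ := (norm_snd_le z₀.2).trans (norm_snd_le z₀)
  have h4 : 0 ≤ |z.1| * ‖z₀‖ := by positivity
  have e : trl z₀ z - z = (z₀.1, z₀.2.1 - z.1 • z₀.2.2, z₀.2.2) := by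
    unfold trl
    ext : 1
    · simp
    · ext : 1
      · simp only [Prod.snd_sub, Prod.fst_sub]; module
      · simp
  rw [e, Prod.norm_def, Prod.norm_def]
  refine max_le ?_ (max_le ?_ ?_)
  · simp only; linarith
  · have := norm_sub_le z₀.2.1 (z.1 • z₀.2.2)
    rw [norm_smul, Real.norm_eq_abs] at this
    have h5 : |z.1| * ‖z₀.2.2‖ ≤ |z.1| * ‖z₀‖ := by gcongr
    simp only
    linarith
  · simp only; linarith

/-- Mollifications converge almost everywhere, by Lebesgue's differentiation theorem. -/
lemma ae_tendsto_moll {ε : ℕ → ℝ} (hε : ∀ n, 0 < ε n) (hlim : Tendsto ε atTop (𝓝 0))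
    {φ : ℕ → Z d → ℝ} (hφ : ∀ n, IsMollifier (ε n) (φ n)) {g : Z d → ℝ}
    (hg : LocallyIntegrable g) :
    ∀ᵐ z, Tendsto (fun n => moll (φ n) g z) atTop (𝓝 (g z)) := by
  filter_upwards [IsUnifLocDoublingMeasure.ae_tendsto_average_norm_sub volume hg 1] with z hz
  set K : ℝ := 3 * (1 + |z.1|) with hK
  have hK0 : 0 < K := by positivity
  have h1 := hz (fun _ : ℕ => z) (fun n => K * ε n) (l := atTop) (by
      rw [tendsto_nhdsWithin_iff]
      refine ⟨by simpa using hlim.const_mul K, Eventually.of_forall fun n => ?_⟩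
      exact mul_pos hK0 (hε n))
    (Eventually.of_forall fun n => Metric.mem_closedBall_self (by
      have := hε n
      positivity))
  set m := Module.finrank ℝ (Z d) with hm
  have h2 : ∀ n, |moll (φ n) g z - g z| ≤
      (2 * K) ^ m * ⨍ y in Metric.closedBall z (K * ε n), ‖g y - g z‖ := by
    intro n
    set S := Metric.closedBall z (K * ε n) with hS
    have hεn := hε n
    have hk : Continuous (ker (φ n) z) :=
      (contDiff_ker_right (isSmoothKer_ker (hφ n).smooth (hφ n).compact) z).continuous
    have hkc : HasCompactSupport (ker (φ n) z) :=
      (hφ n).compact.comp_homeomorph (trlHomeomorph z).symm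
    have hk1 : ∫ ζ, ker (φ n) z ζ = 1 := by
      have := (measurePreserving_trl z).integral_comp (trlHomeomorph z).measurableEmbedding
        (ker (φ n) z)
      rw [← this]
      simp only [ker_trl]
      exact (hφ n).integral
    have hki : Integrable (ker (φ n) z) := hk.integrable_of_hasCompactSupport hkc
    have hkg : Integrable fun ζ => ker (φ n) z ζ * g ζ := by
      simpa using hg.integrable_smul_left_of_hasCompactSupport hk hkc
    have e1 : moll (φ n) g z - g z = ∫ ζ, ker (φ n) z ζ * (g ζ - g z) := by
      have : (fun ζ => ker (φ n) z ζ * (g ζ - g z)) =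
          fun ζ => ker (φ n) z ζ * g ζ - ker (φ n) z ζ * g z := by
        ext ζ; ring
      rw [this, integral_sub hkg (hki.mul_const _), integral_mul_const, hk1, one_mul, moll]
    have hsupp : ∀ ζ ∉ S, ker (φ n) z ζ * (g ζ - g z) = 0 := by
      intro ζ hζ
      have : ker (φ n) z ζ = 0 := by
        refine image_eq_zero_of_notMem_tsupport (f := φ n) fun h => hζ ?_
        have hb := (hφ n).norm_le _ h
        have ht := norm_trl_sub_le (ζ.1 - z.1, ζ.2.1 - z.2.1 + z.1 • (ζ.2.2 - z.2.2),
          ζ.2.2 - z.2.2) z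
        rw [← eq_trl] at ht
        rw [hS, mem_closedBall_iff_norm]
        refine ht.trans ?_
        calc _ ≤ (1 + |z.1|) * (3 * ε n) := by gcongr
          _ = _ := by rw [hK]; ring
      rw [this, zero_mul]
    rw [e1, ← setIntegral_eq_integral_of_forall_compl_eq_zero hsupp, ← Real.norm_eq_abs]
    set c : ℝ := 1 / (volume : Measure (Z d)).real (Metric.closedBall 0 (ε n / 2)) with hc
    have hgS : IntegrableOn (fun y => ‖g y - g z‖) S :=
      ((hg.integrableOn_isCompact (isCompact_closedBall _ _)).sub
        (integrableOn_const (isCompact_closedBall _ _).measure_lt_top.ne)).norm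
    have h3 : ‖∫ ζ in S, ker (φ n) z ζ * (g ζ - g z)‖ ≤ ∫ ζ in S, c * ‖g ζ - g z‖ := by
      refine norm_integral_le_of_norm_le (hgS.const_mul c) (Eventually.of_forall fun ζ => ?_)
      rw [norm_mul, Real.norm_of_nonneg (show 0 ≤ ker (φ n) z ζ from (hφ n).nonneg _)]
      exact mul_le_mul_of_nonneg_right ((hφ n).le _) (norm_nonneg _)
    refine h3.trans (le_of_eq ?_)
    have hV1 : (volume : Measure (Z d)).real S =
        (2 * K) ^ m * (volume : Measure (Z d)).real (Metric.closedBall 0 (ε n / 2)) := by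
      rw [measureReal_def, measureReal_def, hS, Measure.addHaar_closedBall _ _ (by positivity),
        Measure.addHaar_closedBall _ _ (by positivity), ENNReal.toReal_mul, ENNReal.toReal_mul,
        ENNReal.toReal_ofReal (by positivity), ENNReal.toReal_ofReal (by positivity), ← mul_assoc,
        ← mul_pow]
      congr 2
      ring
    have hVpos : 0 < (volume : Measure (Z d)).real (Metric.closedBall 0 (ε n / 2)) :=
      ENNReal.toReal_pos (Metric.measure_closedBall_pos _ _ (by positivity)).ne'
        measure_closedBall_lt_top.ne
    rw [integral_const_mul, setAverage_eq, hV1, smul_eq_mul, hc]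
    field_simp
  rw [tendsto_iff_norm_sub_tendsto_zero]
  refine squeeze_zero (fun n => norm_nonneg _) h2 ?_
  simpa using h1.const_mul ((2 * K) ^ m)


/-! ### Directional second derivatives and the Hessian -/

lemma DV_DV_eq {U : Z d → ℝ} (hU : ContDiff ℝ ∞ U) (a b : E d) (z : Z d) :
    DV a (DV b U) z = fderiv ℝ (fderiv ℝ U) z (0, 0, a) (0, 0, b) := by
  have h2 : DifferentiableAt ℝ (fderiv ℝ U) z :=
    ((contDiff_infty_iff_fderiv.1 hU).2.differentiable (by simp)) z
  unfold DV
  rw [fderiv_clm_apply h2 (differentiableAt_const _)]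
  simp

lemma DV_DV_symm {U : Z d → ℝ} (hU : ContDiff ℝ ∞ U) (a b : E d) (z : Z d) :
    DV a (DV b U) z = DV b (DV a U) z := by
  have hs : IsSymmSndFDerivAt ℝ U z :=
    (hU.contDiffAt (x := z)).isSymmSndFDerivAt (by
      rw [minSmoothness_of_isRCLikeNormedField]; exact WithTop.coe_le_coe.2 le_top)
  rw [DV_DV_eq hU, DV_DV_eq hU]
  exact hs.eq _ _

lemma DV_DV_add {U : Z d → ℝ} (hU : ContDiff ℝ ∞ U) (a b : E d) (z : Z d) :
    DV (a + b) (DV (a + b) U) z =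
      DV a (DV a U) z + DV b (DV b U) z + 2 * DV a (DV b U) z := by
  have h : ((0, 0, a + b) : Z d) = (0, 0, a) + (0, 0, b) := by simp
  have hs := DV_DV_symm hU b a z
  rw [DV_DV_eq hU, DV_DV_eq hU] at hs
  rw [DV_DV_eq hU, DV_DV_eq hU, DV_DV_eq hU, DV_DV_eq hU, h, map_add, map_add]
  simp only [add_apply]
  linarith

/-- Mixed derivatives by polarization. -/
lemma abs_partialV_sub_le {U : Z d → ℝ} (hU : ContDiff ℝ ∞ U) {z z' : Z d} {K : ℝ}
    (h : ∀ e, |DV e (DV e U) z - DV e (DV e U) z'| ≤ K * ‖e‖ ^ 2) (i j : Fin d) :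
    |partialV i (partialV j U) z - partialV i (partialV j U) z'| ≤ 3 * K := by
  set a : E d := EuclideanSpace.single i 1
  set b : E d := EuclideanSpace.single j 1
  have ha : ‖a‖ = 1 := by simp [a]
  have hb : ‖b‖ = 1 := by simp [b]
  have hK : 0 ≤ K := by
    have := (abs_nonneg _).trans (h a)
    simpa [ha] using this
  have hab : K * ‖a + b‖ ^ 2 ≤ K * 4 := by
    have h1 : ‖a + b‖ ≤ 2 := by
      have := norm_add_le a b
      linarith
    have h2 : ‖a + b‖ ^ 2 ≤ 4 := by nlinarith [norm_nonneg (a + b)]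
    gcongr
  have h1 := h a
  have h2 := h b
  have h3 := (h (a + b)).trans hab
  rw [ha] at h1
  rw [hb] at h2
  rw [DV_DV_add hU, DV_DV_add hU] at h3
  change |DV a (DV b U) z - DV a (DV b U) z'| ≤ _
  rw [abs_le] at *
  constructor <;> linarith [h1.1, h1.2, h2.1, h2.2, h3.1, h3.2]

lemma DV_DV_eq_sum {U : Z d → ℝ} (hU : ContDiff ℝ ∞ U) (e : E d) (z : Z d) :
    DV e (DV e U) z = ∑ i, ∑ j, e i * e j * partialV i (partialV j U) z := by
  let L : E d →ₗ[ℝ] Z d := (LinearMap.inr ℝ ℝ (E d × E d)).comp (LinearMap.inr ℝ (E d) (E d))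
  have hL : ∀ a, ((0, 0, a) : Z d) = L a := fun a => rfl
  have he : e = ∑ i, e i • EuclideanSpace.single i (1 : ℝ) := by
    conv_lhs => rw [← (EuclideanSpace.basisFun (Fin d) ℝ).sum_repr e]
    simp
  have h1 : L e = ∑ i, e i • L (EuclideanSpace.single i (1 : ℝ)) := by
    conv_lhs => rw [he]
    simp only [map_sum, map_smul]
  rw [DV_DV_eq hU, hL, h1]
  simp only [map_sum, map_smul, sum_apply, smul_apply]
  refine Finset.sum_congr rfl fun i _ => ?_
  rw [Finset.smul_sum]
  refine Finset.sum_congr rfl fun j _ => ?_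
  rw [partialV_eq_DV, partialV_eq_DV, DV_DV_symm hU, DV_DV_eq hU, hL, hL, smul_eq_mul, smul_eq_mul,
    mul_assoc]

lemma abs_DV_DV_sub_le {U : Z d → ℝ} (hU : ContDiff ℝ ∞ U) {z z' : Z d} {K : ℝ}
    (h : ∀ i j, |partialV i (partialV j U) z - partialV i (partialV j U) z'| ≤ K) (e : E d) :
    |DV e (DV e U) z - DV e (DV e U) z'| ≤ (d : ℝ) ^ 2 * K * ‖e‖ ^ 2 := by
  rw [DV_DV_eq_sum hU, DV_DV_eq_sum hU, ← Finset.sum_sub_distrib]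
  have hi : ∀ i, |e i| ≤ ‖e‖ := fun i => PiLp.norm_apply_le e i
  have h1 : ∀ i, |∑ j, e i * e j * partialV i (partialV j U) z -
      ∑ j, e i * e j * partialV i (partialV j U) z'| ≤ d * (‖e‖ * ‖e‖ * K) := by
    intro i
    rw [← Finset.sum_sub_distrib]
    refine (Finset.abs_sum_le_sum_abs _ _).trans ?_
    refine (Finset.sum_le_card_nsmul _ _ (‖e‖ * ‖e‖ * K) fun j _ => ?_).trans_eq (by simp)
    rw [← mul_sub, abs_mul, abs_mul]
    exact mul_le_mul (mul_le_mul (hi i) (hi j) (abs_nonneg _) (norm_nonneg _)) (h i j)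
      (abs_nonneg _) (by positivity)
  refine (Finset.abs_sum_le_sum_abs _ _).trans ?_
  refine (Finset.sum_le_card_nsmul _ _ _ fun i _ => h1 i).trans_eq ?_
  simp
  ring

lemma hol_DV_DV {α C : ℝ} {I : Set ℝ} {D : Set (E d × E d)} {U : Z d → ℝ}
    (hU : ContDiff ℝ ∞ U) (h : ∀ i j, HolXV α C I D (partialV i (partialV j U))) (e : E d) :
    HolXV α ((d : ℝ) ^ 2 * C * ‖e‖ ^ 2) I D (DV e (DV e U)) := by
  intro t ht p hp q hq
  refine (abs_DV_DV_sub_le hU (fun i j => h i j t ht p hp q hq) e).trans_eq ?_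
  ring

/-! ### Representatives -/

section Rep

variable {F : Type*} [NormedAddCommGroup F]

/-- A strict bound on the seminorm is a Hölder estimate for some representative, outside a null
set of times. -/
lemma exists_rep {α C : ℝ} {I : Set ℝ} {D : Set (E d × E d)} {u : Z d → F}
    (h : linftyHolderSeminorm α I D u < ENNReal.ofReal C) :
    ∃ w : Z d → F, w =ᵐ[volume.restrict (I ×ˢ D)] u ∧
      ∀ᵐ t ∂(volume.restrict I), ∀ p ∈ D, ∀ q ∈ D, ‖w (t, p) - w (t, q)‖ ≤ C * dXV p q ^ α := by
  rw [linftyHolderSeminorm, iInf_lt_iff] at h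
  obtain ⟨w, h⟩ := h
  rw [iInf_lt_iff] at h
  obtain ⟨hw, h⟩ := h
  have hC : 0 < C := by
    by_contra hC
    rw [ENNReal.ofReal_of_nonpos (not_lt.1 hC)] at h
    exact not_lt_bot h
  refine ⟨w, hw, ?_⟩
  filter_upwards [ENNReal.ae_le_essSup (μ := volume.restrict I)
    (fun t => holderXVSeminorm α D fun p => w (t, p))] with t ht p hp q hq
  rcases eq_or_ne p q with rfl | hpq
  · rw [sub_self, norm_zero]
    have := Real.rpow_nonneg (dXV_nonneg p p) α
    positivity
  have h1 : ‖w (t, p) - w (t, q)‖ₑ / ENNReal.ofReal (dXV p q ^ α) ≤ ENNReal.ofReal C := by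
    refine le_trans ?_ (ht.trans h.le)
    unfold holderXVSeminorm
    exact le_iSup_of_le p (le_iSup_of_le hp (le_iSup_of_le q (le_iSup_of_le hq
      (le_iSup_of_le hpq le_rfl))))
  have hd : 0 < dXV p q := by
    unfold dXV
    by_contra hn
    have h2 : 0 ≤ ‖p.1 - q.1‖ ^ (1 / 3 : ℝ) := by positivity
    have h3 := norm_nonneg (p.2 - q.2)
    have h4 : ‖p.1 - q.1‖ ^ (1 / 3 : ℝ) = 0 := by linarith
    have h5 : ‖p.2 - q.2‖ = 0 := by linarith
    rw [Real.rpow_eq_zero (norm_nonneg _) (by norm_num), norm_eq_zero, sub_eq_zero] at h4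
    rw [norm_eq_zero, sub_eq_zero] at h5
    exact hpq (Prod.ext h4 h5)
  have hdα : 0 < dXV p q ^ α := Real.rpow_pos_of_pos hd α
  rw [ENNReal.div_le_iff (by simpa using hdα) ENNReal.ofReal_ne_top,
    ← ENNReal.ofReal_mul hC.le, ← ofReal_norm, ENNReal.ofReal_le_ofReal_iff (by positivity)] at h1
  exact h1

lemma ae_norm_le {G : Set (Z d)} {u : Z d → F} {B : ℝ} (hB : 0 ≤ B)
    (h : linftyNorm G u ≤ ENNReal.ofReal B) : ∀ᵐ z ∂(volume.restrict G), ‖u z‖ ≤ B := by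
  filter_upwards [ae_le_eLpNormEssSup (f := u) (μ := volume.restrict G)] with z hz
  have := hz.trans h
  rwa [← ofReal_norm, ENNReal.ofReal_le_ofReal_iff hB] at this

/-- The kinetic seminorm is lower semicontinuous under convergence almost everywhere. The limit
along an ultrafilter exists at every point of `G`, and is the representative of `g` that satisfies
the Hölder estimate everywhere. -/
lemma kinSeminorm_le_of_tendsto [ProperSpace F] {α C : ℝ} (hC : 0 ≤ C) {G : Set (Z d)}
    (hG : MeasurableSet G) {gn : ℕ → Z d → F} {g : Z d → F}
    (hlim : ∀ᵐ z ∂(volume.restrict G), Tendsto (fun n => gn n z) atTop (𝓝 (g z)))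
    (hb : ∀ z ∈ G, ∃ B, ∀ᶠ n in atTop, ‖gn n z‖ ≤ B)
    (hk : ∀ z ∈ G, ∀ z' ∈ G, ∀ᶠ n in atTop, ‖gn n z - gn n z'‖ ≤ C * rho z z' ^ α) :
    kinSeminorm α G g ≤ ENNReal.ofReal C := by
  have hle : ((hyperfilter ℕ : Ultrafilter ℕ) : Filter ℕ) ≤ atTop := Nat.hyperfilter_le_atTop
  have hex : ∀ z ∈ G, ∃ a, Tendsto (fun n => gn n z) (hyperfilter ℕ : Ultrafilter ℕ) (𝓝 a) := by
    intro z hz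
    obtain ⟨B, hB⟩ := hb z hz
    obtain ⟨a, -, ha⟩ := (isCompact_closedBall (0 : F) B).ultrafilter_le_nhds
      ((hyperfilter ℕ).map fun n => gn n z) (by
        rw [le_principal_iff]
        have h : {n | ‖gn n z‖ ≤ B} ∈ (hyperfilter ℕ : Ultrafilter ℕ) := hle hB
        exact mem_of_superset h fun n hn => mem_closedBall_zero_iff.2 hn)
    exact ⟨a, ha⟩
  choose! w hw using hex
  have hwg : w =ᵐ[volume.restrict G] g := by
    rw [Filter.EventuallyEq, ae_restrict_iff' hG]
    rw [ae_restrict_iff' hG] at hlim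
    filter_upwards [hlim] with z hz hzG
    exact tendsto_nhds_unique (hw z hzG) ((hz hzG).mono_left hle)
  refine iInf₂_le_of_le w hwg ?_
  refine iSup_le fun z => iSup_le fun hz => iSup_le fun z' => iSup_le fun hz' => iSup_le fun _ => ?_
  refine ENNReal.div_le_of_le_mul ?_
  have h1 : ‖w z - w z'‖ ≤ C * rho z z' ^ α :=
    le_of_tendsto ((hw z hz).sub (hw z' hz')).norm (hle (hk z hz z' hz'))
  rw [← ENNReal.ofReal_mul hC, ← ofReal_norm]
  exact ENNReal.ofReal_le_ofReal h1

end Rep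

lemma norm_le_card_mul {ι : Type*} [Fintype ι] (x : EuclideanSpace ℝ ι) {C : ℝ}
    (h : ∀ i, |x i| ≤ C) : ‖x‖ ≤ Fintype.card ι * C := by
  classical
  have hx : x = ∑ i, x i • EuclideanSpace.single i (1 : ℝ) := by
    conv_lhs => rw [← (EuclideanSpace.basisFun ι ℝ).sum_repr x]
    simp
  rw [hx]
  refine (norm_sum_le _ _).trans ((Finset.sum_le_card_nsmul _ _ C fun i _ => ?_).trans_eq ?_)
  · rw [norm_smul]
    simpa using h i
  · simp

lemma moll_sum {ε : ℝ} {φ : Z d → ℝ} (hφ : IsMollifier ε φ) {ι : Type*} (s : Finset ι)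
    {g : ι → Z d → ℝ} (hg : ∀ i, LocallyIntegrable (g i)) (z : Z d) :
    moll φ (fun z => ∑ i ∈ s, g i z) z = ∑ i ∈ s, moll φ (g i) z := by
  have hk : Continuous (ker φ z) :=
    (contDiff_ker_right (isSmoothKer_ker hφ.smooth hφ.compact) z).continuous
  have hkc : HasCompactSupport (ker φ z) :=
    hφ.compact.comp_homeomorph (trlHomeomorph z).symm
  simp only [moll, Finset.mul_sum]
  rw [integral_finsetSum]
  intro i _
  simpa using (hg i).integrable_smul_left_of_hasCompactSupport hk hkc

/-! ### Uniqueness of weak derivatives -/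

lemma ae_eq_of_forall_integral_eq {G : Set (Z d)} (hG : IsOpen G) {f g : Z d → ℝ}
    (hf : LocallyIntegrableOn f G) (hg : LocallyIntegrableOn g G)
    (h : ∀ φ, IsTest G φ → ∫ z in G, f z * φ z = ∫ z in G, g z * φ z) :
    f =ᵐ[volume.restrict G] g := by
  have hi : ∀ {f : Z d → ℝ}, LocallyIntegrableOn f G → ∀ φ, IsTest G φ →
      IntegrableOn (fun z => f z * φ z) G := by
    intro f hf φ hφ
    have h1 : IntegrableOn (fun z => f z * φ z) (tsupport φ) :=
      (hf.integrableOn_compact_subset hφ.support hφ.compact).mul_continuousOn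
        hφ.smooth.continuous.continuousOn hφ.compact
    refine (integrableOn_iff_integrable_of_support_subset fun z hz => ?_).1 h1 |>.integrableOn
    exact subset_tsupport _ fun h0 => hz (by simp [h0])
  have h0 := hG.ae_eq_zero_of_integral_contDiff_smul_eq_zero (hf.sub hg) (μ := volume)
    (fun φ h1 h2 h3 => by
      have ht : IsTest G φ := ⟨h1, h2, h3⟩
      have hs : ∀ z ∉ G, φ z • (f - g) z = 0 := fun z hz => by
        rw [image_eq_zero_of_notMem_tsupport fun h => hz (h3 h), zero_smul]
      rw [← setIntegral_eq_integral_of_forall_compl_eq_zero hs]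
      have : ∀ z, φ z • (f - g) z = f z * φ z - g z * φ z := fun z => by
        simp only [Pi.sub_apply, smul_eq_mul]; ring
      simp only [this]
      rw [integral_sub (hi hf φ ht) (hi hg φ ht), h φ ht, sub_self])
  rw [Filter.EventuallyEq, ae_restrict_iff' hG.measurableSet]
  filter_upwards [h0] with z hz hzG
  exact sub_eq_zero.1 (hz hzG)

lemma locallyIntegrableOn_apply {G : Set (Z d)} {ι : Type*} [Fintype ι]
    {f : Z d → EuclideanSpace ℝ ι} (hf : LocallyIntegrableOn f G) (i : ι) :
    LocallyIntegrableOn (fun z => f z i) G := by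
  intro z hz
  obtain ⟨s, hs, h⟩ := hf z hz
  exact ⟨s, hs, (EuclideanSpace.proj (𝕜 := ℝ) i).integrable_comp h⟩

lemma IsWeakHessV.ae_eq {G : Set (Z d)} (hG : IsOpen G) {u : Z d → ℝ}
    {A B : Z d → EuclideanSpace ℝ (Fin d × Fin d)} (hA : IsWeakHessV G u A)
    (hB : IsWeakHessV G u B) : A =ᵐ[volume.restrict G] B := by
  have h : ∀ ij : Fin d × Fin d, (fun z => A z ij) =ᵐ[volume.restrict G] fun z => B z ij :=
    fun ij => ae_eq_of_forall_integral_eq hG (locallyIntegrableOn_apply hA.locInt_deriv ij)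
      (locallyIntegrableOn_apply hB.locInt_deriv ij) fun φ hφ =>
        (hA.integral_eq φ hφ ij.1 ij.2).trans (hB.integral_eq φ hφ ij.1 ij.2).symm
  have h' := ae_all_iff.2 h
  filter_upwards [h'] with z hz
  ext ij
  exact hz ij

lemma IsWeakTransport.ae_eq {G : Set (Z d)} (hG : IsOpen G) {u A B : Z d → ℝ}
    (hA : IsWeakTransport G u A) (hB : IsWeakTransport G u B) : A =ᵐ[volume.restrict G] B :=
  ae_eq_of_forall_integral_eq hG hA.locInt_deriv hB.locInt_deriv fun φ hφ =>
    (hA.integral_eq φ hφ).trans (hB.integral_eq φ hφ).symm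

lemma linftyHolderSeminorm_congr {F : Type*} [NormedAddCommGroup F] {α : ℝ} {I : Set ℝ}
    {D : Set (E d × E d)} {u u' : Z d → F} (h : u =ᵐ[volume.restrict (I ×ˢ D)] u') :
    linftyHolderSeminorm α I D u = linftyHolderSeminorm α I D u' := by
  have key : ∀ w, (w =ᵐ[volume.restrict (I ×ˢ D)] u) = (w =ᵐ[volume.restrict (I ×ˢ D)] u') :=
    fun w => propext ⟨fun hw => hw.trans h, fun hw => hw.trans h.symm⟩
  simp only [linftyHolderSeminorm, key]

lemma kinSeminorm_congr {F : Type*} [NormedAddCommGroup F] {α : ℝ} {G : Set (Z d)}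
    {u u' : Z d → F} (h : u =ᵐ[volume.restrict G] u') :
    kinSeminorm α G u = kinSeminorm α G u' := by
  have key : ∀ w, (w =ᵐ[volume.restrict G] u) = (w =ᵐ[volume.restrict G] u') :=
    fun w => propext ⟨fun hw => hw.trans h, fun hw => hw.trans h.symm⟩
  simp only [kinSeminorm, key]


/-! ### Functions with a controlled norm -/

/-- The real function `g` has norm at most `A` in `L_∞(I × D)`, and seminorm at most `A` in
`L_∞ C^{α/3, α}_{x, v}(I × D)`. -/
structure Controlled (α A : ℝ) (I : Set ℝ) (D : Set (E d × E d)) (g : Z d → ℝ) : Prop where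
  meas : AEStronglyMeasurable g (volume.restrict (I ×ˢ D))
  bound : ∀ᵐ z ∂(volume.restrict (I ×ˢ D)), |g z| ≤ A
  hol : AEHol α A I D g

section Controlled

variable {α A : ℝ} {I : Set ℝ} {D : Set (E d × E d)}

lemma aeHol_of_lt {C : ℝ} {g : Z d → ℝ}
    (h : linftyHolderSeminorm α I D g < ENNReal.ofReal C) : AEHol α C I D g :=
  exists_rep h

lemma Controlled.of_lt {g : Z d → ℝ} (hg : MemLinftyHolder α I D g) (hA : 0 ≤ A)
    (h : linftyHolderNorm α I D g < ENNReal.ofReal A) : Controlled α A I D g where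
  meas := hg.1
  bound := ae_norm_le hA (le_self_add.trans h.le)
  hol := exists_rep (le_add_self.trans_lt h)

lemma Controlled.apply_of_lt {ι : Type*} [Fintype ι] {g : Z d → EuclideanSpace ℝ ι}
    (hg : MemLinftyHolder α I D g) (hA : 0 ≤ A)
    (h : linftyHolderNorm α I D g < ENNReal.ofReal A) (i : ι) :
    Controlled α A I D fun z => g z i where
  meas := (EuclideanSpace.proj (𝕜 := ℝ) i).continuous.comp_aestronglyMeasurable hg.1
  bound := by
    filter_upwards [ae_norm_le hA (le_self_add.trans h.le)] with z hz
    exact (PiLp.norm_apply_le (g z) i).trans hz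
  hol := by
    obtain ⟨w, hw, hw'⟩ := exists_rep (le_add_self.trans_lt h)
    refine ⟨fun z => w z i, ?_, ?_⟩
    · filter_upwards [hw] with z hz
      rw [hz]
    · filter_upwards [hw'] with t ht p hp q hq
      exact (PiLp.norm_apply_le (w (t, p) - w (t, q)) i).trans (ht p hp q hq)

lemma Controlled.locallyIntegrable (hI : MeasurableSet I) (hD : MeasurableSet D) {g : Z d → ℝ}
    (hg : Controlled α A I D g) : LocallyIntegrable ((I ×ˢ D).indicator g) :=
  locallyIntegrable_indicator (hI.prod hD) hg.meas hg.bound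

lemma aeHol_sum {ι : Type*} [Fintype ι] {C : ℝ} {g : ι → Z d → ℝ}
    (hg : ∀ i, AEHol α C I D (g i)) :
    AEHol α (Fintype.card ι * C) I D fun z => ∑ i, g i z := by
  choose w hw hw' using hg
  refine ⟨fun z => ∑ i, w i z, ?_, ?_⟩
  · filter_upwards [ae_all_iff.2 hw] with z hz
    exact Finset.sum_congr rfl fun i _ => hz i
  · filter_upwards [ae_all_iff.2 hw'] with t ht p hp q hq
    rw [← Finset.sum_sub_distrib]
    refine (Finset.abs_sum_le_sum_abs _ _).trans ?_
    refine (Finset.sum_le_card_nsmul _ _ _ fun i _ => ht i p hp q hq).trans_eq ?_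
    simp
    ring

end Controlled

/-! ### Passing to the limit in the Hessian -/

section Limit

variable {α : ℝ} {G G₀ : Set (Z d)} {ε : ℕ → ℝ} {φ : ℕ → Z d → ℝ}

lemma kinSeminorm_le_of_moll (hε : ∀ n, 0 < ε n) (hlim : Tendsto ε atTop (𝓝 0))
    (hφ : ∀ n, IsMollifier (ε n) (φ n)) (hG : MeasurableSet G) (hG₀ : MeasurableSet G₀)
    (hsub : G₀ ⊆ G) {ι : Type*} [Fintype ι] {f : Z d → EuclideanSpace ℝ ι} {B K : ℝ}
    (hB : 0 ≤ B) (hK : 0 ≤ K)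
    (hm : ∀ i, AEStronglyMeasurable (fun z => f z i) (volume.restrict G))
    (hb : ∀ i, ∀ᵐ z ∂(volume.restrict G), |f z i| ≤ B)
    (h : ∀ z ∈ G₀, ∀ z' ∈ G₀, ∀ᶠ n in atTop, ∀ i,
      |moll (φ n) (G.indicator fun z => f z i) z - moll (φ n) (G.indicator fun z => f z i) z'| ≤
        K * rho z z' ^ α) :
    kinSeminorm α G₀ f ≤ ENNReal.ofReal (Fintype.card ι * K) := by
  have hli : ∀ i, LocallyIntegrable (G.indicator fun z => f z i) := fun i =>
    locallyIntegrable_indicator hG (hm i) (hb i)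
  refine kinSeminorm_le_of_tendsto (by positivity) hG₀
    (gn := fun n z => WithLp.toLp 2 fun i => moll (φ n) (G.indicator fun z => f z i) z) ?_ ?_ ?_
  · rw [ae_restrict_iff' hG₀]
    filter_upwards [ae_all_iff.2 fun i => ae_tendsto_moll hε hlim hφ (hli i)] with z hz hzG
    have h1 : Tendsto (fun n i => moll (φ n) (G.indicator fun z => f z i) z) atTop
        (𝓝 fun i => f z i) := by
      rw [tendsto_pi_nhds]
      intro i
      have := hz i
      rwa [indicator_of_mem (hsub hzG)] at this
    exact ((PiLp.continuous_toLp 2 fun _ : ι => ℝ).tendsto _).comp h1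
  · intro z _
    exact ⟨Fintype.card ι * B, Eventually.of_forall fun n => norm_le_card_mul _ fun i =>
      abs_moll_le (hφ n) hG hB (hb i) z⟩
  · intro z hz z' hz'
    filter_upwards [h z hz z' hz'] with n hn
    rw [mul_assoc]
    exact norm_le_card_mul _ hn

lemma kinSeminorm_le_of_moll_real (hε : ∀ n, 0 < ε n) (hlim : Tendsto ε atTop (𝓝 0))
    (hφ : ∀ n, IsMollifier (ε n) (φ n)) (hG : MeasurableSet G) (hG₀ : MeasurableSet G₀)
    (hsub : G₀ ⊆ G) {f : Z d → ℝ} {B K : ℝ} (hB : 0 ≤ B) (hK : 0 ≤ K)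
    (hm : AEStronglyMeasurable f (volume.restrict G))
    (hb : ∀ᵐ z ∂(volume.restrict G), |f z| ≤ B)
    (h : ∀ z ∈ G₀, ∀ z' ∈ G₀, ∀ᶠ n in atTop,
      |moll (φ n) (G.indicator f) z - moll (φ n) (G.indicator f) z'| ≤ K * rho z z' ^ α) :
    kinSeminorm α G₀ f ≤ ENNReal.ofReal K := by
  refine kinSeminorm_le_of_tendsto hK hG₀ (gn := fun n => moll (φ n) (G.indicator f)) ?_ ?_ h
  · rw [ae_restrict_iff' hG₀]
    filter_upwards [ae_tendsto_moll hε hlim hφ (locallyIntegrable_indicator hG hm hb)]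
      with z hz hzG
    rwa [indicator_of_mem (hsub hzG)] at hz
  · exact fun z _ => ⟨B, Eventually.of_forall fun n => abs_moll_le (hφ n) hG hB hb z⟩

end Limit

lemma exists_mollifiers : ∃ (ε : ℕ → ℝ) (φ : ℕ → Z d → ℝ), (∀ n, 0 < ε n) ∧
    Tendsto ε atTop (𝓝 0) ∧ ∀ n, IsMollifier (ε n) (φ n) := by
  have h : ∀ n : ℕ, (0 : ℝ) < 1 / ((n : ℝ) + 1) := fun n => by positivity
  choose φ hφ using fun n => exists_isMollifier (d := d) (h n)
  exact ⟨_, φ, h, tendsto_one_div_add_atTop_nhds_zero_nat, hφ⟩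

/-! ### The estimate below a given time -/

lemma isOpen_timeBelow (T : WithTop ℝ) : IsOpen (timeBelow T) := by
  induction T with
  | top => simp [timeBelow]
  | coe T =>
    simp only [timeBelow, WithTop.coe_lt_coe]
    exact isOpen_Iio

lemma isLowerSet_timeBelow (T : WithTop ℝ) : IsLowerSet (timeBelow T) :=
  fun _ _ hab ha => (WithTop.coe_le_coe.2 hab).trans_lt ha

/-- Mollifiers look into the past, so no room is lost below the final time. -/
lemma reaches_of_isLowerSet {I : Set ℝ} (hI : IsLowerSet I) {ε : ℝ} {φ : Z d → ℝ}
    (hφ : IsMollifier ε φ) {z : Z d} (hz : z.1 ∈ I) : Reaches (I ×ˢ univ) φ z :=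
  fun z₀ hz₀ => ⟨hI (show z₀.1 + z.1 ≤ z.1 by linarith [hφ.neg z₀ hz₀]) hz, mem_univ _⟩

lemma moll_laplV {ε : ℝ} {φ : Z d → ℝ} (hφ : IsMollifier ε φ) {G : Set (Z d)}
    {D2u : Z d → EuclideanSpace ℝ (Fin d × Fin d)}
    (h : ∀ ij, LocallyIntegrable (G.indicator fun z => D2u z ij)) (z : Z d) :
    moll φ (G.indicator (laplV D2u)) z =
      ∑ i, moll φ (G.indicator fun z => D2u z (i, i)) z := by
  rw [← moll_sum hφ _ fun i => h (i, i)]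
  congr 1
  ext ζ
  by_cases hζ : ζ ∈ G <;> simp [hζ, laplV]

section LowerSet

variable {α A : ℝ} {I : Set ℝ} {u Yu : Z d → ℝ} {D2u : Z d → EuclideanSpace ℝ (Fin d × Fin d)}

/-- The kinetic estimate of the Hessian on a time interval that is unbounded below. The bound `A`
is only needed to make the mollifications bounded, with bounded seminorms. -/
lemma exists_kinSeminorm_hess_le (hd : 1 ≤ d) (hα₀ : 0 < α) (hα₁ : α < 1) :
    ∃ C : ℝ, 0 ≤ C ∧ ∀ {A M : ℝ} {I : Set ℝ} {u Yu : Z d → ℝ}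
      {D2u : Z d → EuclideanSpace ℝ (Fin d × Fin d)}, IsOpen I → IsLowerSet I → 0 ≤ A → 0 ≤ M →
      Controlled α A I univ u → (∀ ij, Controlled α A I univ fun z => D2u z ij) →
      Controlled α A I univ Yu → IsWeakHessV (I ×ˢ univ) u D2u →
      IsWeakTransport (I ×ˢ univ) u Yu → AEHol α M I univ Yu → AEHol α M I univ (laplV D2u) →
      kinSeminorm α (I ×ˢ univ) D2u ≤ ENNReal.ofReal (C * M) := by
  obtain ⟨C, hC, h⟩ := exists_kinetic_bound hd hα₀ hα₁
  refine ⟨Fintype.card (Fin d × Fin d) * (3 * C), by positivity, ?_⟩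
  intro A M I u Yu D2u hIo hI hA hM hu hD2 hY whess wtr hYM hΔM
  obtain ⟨ε, φ, hε, hlim, hφ⟩ := exists_mollifiers (d := d)
  have hIm := hIo.measurableSet
  have hG : MeasurableSet (I ×ˢ (univ : Set (E d × E d))) := hIm.prod .univ
  have hul := hu.locallyIntegrable hIm .univ
  have hD2l := fun ij => (hD2 ij).locallyIntegrable hIm .univ
  have hR : ∀ n (t : ℝ) (p : E d × E d), t ∈ I → Reaches (I ×ˢ univ) (φ n) (t, p) :=
    fun n t p ht => reaches_of_isLowerSet hI (hφ n) ht
  rw [mul_assoc]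
  refine kinSeminorm_le_of_moll hε hlim hφ hG hG subset_rfl hA (by positivity)
    (fun i => (hD2 i).meas) (fun i => (hD2 i).bound) ?_
  intro z hz z' hz'
  refine Eventually.of_forall fun n => ?_
  set U := moll (φ n) ((I ×ˢ univ).indicator u) with hU
  have hUs : ContDiff ℝ ∞ U := contDiff_moll (hφ n).smooth (hφ n).compact hul
  have hess : ∀ z : Z d, z.1 ∈ I → ∀ i j, partialV i (partialV j U) z =
      moll (φ n) ((I ×ˢ univ).indicator fun z => D2u z (i, j)) z := fun z hz i j =>
    partialV_partialV_moll hG (hφ n).smooth (hφ n).compact hul whess (hR n z.1 z.2 hz) i j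
  have key := h (Γ := (d : ℝ) ^ 2 * A) (B := A) (by positivity) hM hI hUs
    (fun t _ p => abs_moll_le (hφ n) hG hA hu.bound _)
    (hol_DV_DV hUs fun i j t ht p _ q _ => by
      rw [hess _ ht, hess _ ht]
      exact hol_moll (hφ n) hIm .univ (hD2l (i, j)) (hD2 (i, j)).hol (hR n t p ht) (hR n t q ht))
    (fun t ht p _ q _ => by
      rw [transport_moll_indicator hG (hφ n).smooth (hφ n).compact hul wtr (hR n t p ht),
        transport_moll_indicator hG (hφ n).smooth (hφ n).compact hul wtr (hR n t q ht)]
      exact hol_moll (hφ n) hIm .univ (hY.locallyIntegrable hIm .univ) hYM (hR n t p ht)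
        (hR n t q ht))
    (fun t ht p _ q _ => by
      have e : ∀ p, lapZ U (t, p) = moll (φ n) ((I ×ˢ univ).indicator (laplV D2u)) (t, p) := by
        intro p
        rw [moll_laplV (hφ n) hD2l]
        exact Finset.sum_congr rfl fun i _ => hess (t, p) ht i i
      rw [e, e]
      refine hol_moll (hφ n) hIm .univ ?_ hΔM (hR n t p ht) (hR n t q ht)
      have : (I ×ˢ (univ : Set (E d × E d))).indicator (laplV D2u) =
          ∑ i, (I ×ˢ (univ : Set (E d × E d))).indicator fun z => D2u z (i, i) := by
        ext ζ
        rw [Finset.sum_apply]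
        by_cases hζ : ζ ∈ I ×ˢ (univ : Set (E d × E d)) <;> simp [hζ, laplV]
      rw [this]
      exact locallyIntegrable_finsetSum' _ fun i _ => hD2l (i, i))
  rintro ⟨i, j⟩
  rw [← hess z hz.1, ← hess z' hz'.1]
  refine (abs_partialV_sub_le hUs (K := C * M * rho z z' ^ α) (fun e => ?_) i j).trans_eq
    (by ring)
  exact (key e z z' hz.1 hz'.1).trans_eq (by ring)

lemma kinSeminorm_self_le (hα₀ : 0 < α) (hα₁ : α < 1) (hIo : IsOpen I) (hI : IsLowerSet I)
    (hA : 0 ≤ A) (hu : Controlled α A I univ u) (hY : Controlled α A I univ Yu)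
    (wtr : IsWeakTransport (I ×ˢ univ) u Yu) :
    kinSeminorm α (I ×ˢ univ) u ≤ ENNReal.ofReal (8 * A) := by
  obtain ⟨ε, φ, hε, hlim, hφ⟩ := exists_mollifiers (d := d)
  have hIm := hIo.measurableSet
  have hG : MeasurableSet (I ×ˢ (univ : Set (E d × E d))) := hIm.prod .univ
  have hul := hu.locallyIntegrable hIm .univ
  have hR : ∀ n (t : ℝ) (p : E d × E d), t ∈ I → Reaches (I ×ˢ univ) (φ n) (t, p) :=
    fun n t p ht => reaches_of_isLowerSet hI (hφ n) ht
  refine kinSeminorm_le_of_moll_real hε hlim hφ hG hG subset_rfl hA (by positivity) hu.meas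
    hu.bound fun z hz z' hz' => Eventually.of_forall fun n => ?_
  refine kinetic_bound_self hα₀ hα₁ hA hI (contDiff_moll (hφ n).smooth (hφ n).compact hul)
    (fun t _ p => abs_moll_le (hφ n) hG hA hu.bound _)
    (fun t ht p _ q _ => hol_moll (hφ n) hIm .univ hul hu.hol (hR n t p ht) (hR n t q ht))
    (fun t ht p => ?_) z z' hz.1 hz'.1
  rw [transport_moll_indicator hG (hφ n).smooth (hφ n).compact hul wtr (hR n t p ht)]
  exact abs_moll_le (hφ n) hG hA hY.bound _

end LowerSet

lemma laplV_congr {G : Set (Z d)} {A B : Z d → EuclideanSpace ℝ (Fin d × Fin d)}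
    (h : A =ᵐ[volume.restrict G] B) : laplV A =ᵐ[volume.restrict G] laplV B := by
  filter_upwards [h] with z hz
  simp [laplV, hz]

lemma exists_lt_ofReal {x : ℝ≥0∞} (hx : x < ⊤) : ∃ A : ℝ, 0 ≤ A ∧ x < ENNReal.ofReal A := by
  refine ⟨x.toReal + 1, by positivity, ?_⟩
  rw [ENNReal.lt_ofReal_iff_toReal_lt hx.ne]
  linarith

/-- The summand `1` makes the constant positive, so that nothing is claimed if `s = ∞`. -/
lemma le_mul_of_forall_lt {k s : ℝ≥0∞} {C : ℝ} (hC : 0 ≤ C)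
    (h : ∀ M : ℝ, 0 ≤ M → s < ENNReal.ofReal M → k ≤ ENNReal.ofReal (C * M)) :
    k ≤ (C.toNNReal + 1 : ℝ≥0) * s := by
  rcases eq_or_ne s ⊤ with rfl | hs
  · rw [ENNReal.mul_top (by simp)]
    exact le_top
  have h1 : ∀ᶠ δ in 𝓝[>] (0 : ℝ), k ≤ ENNReal.ofReal (C * (s.toReal + δ)) := by
    filter_upwards [self_mem_nhdsWithin] with δ hδ
    have hδ' : 0 < δ := hδ
    refine h _ (by positivity) ?_
    rw [ENNReal.lt_ofReal_iff_toReal_lt hs]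
    linarith
  have h2 : Tendsto (fun δ : ℝ => ENNReal.ofReal (C * (s.toReal + δ))) (𝓝[>] 0)
      (𝓝 (ENNReal.ofReal (C * (s.toReal + 0)))) := by
    refine Tendsto.mono_left (Continuous.tendsto ?_ 0) nhdsWithin_le_nhds
    exact ENNReal.continuous_ofReal.comp (by fun_prop)
  refine (ge_of_tendsto h2 h1).trans ?_
  rw [add_zero, ENNReal.ofReal_mul hC, ENNReal.ofReal_toReal hs]
  gcongr
  rw [ENNReal.ofReal]
  exact_mod_cast le_self_add

lemma exists_global_estimate (hd : 1 ≤ d) {α : ℝ} (hα₀ : 0 < α) (hα₁ : α < 1) :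
    ∃ N : ℝ≥0, ∀ (T : WithTop ℝ) (u : Z d → ℝ), MemC2 α (timeBelow T) univ u →
      MemKin2 α (timeBelow T) univ u ∧
      ∀ (D2u : Z d → EuclideanSpace ℝ (Fin d × Fin d)) (Yu : Z d → ℝ),
        IsWeakHessV (timeBelow T ×ˢ univ) u D2u →
        IsWeakTransport (timeBelow T ×ˢ univ) u Yu →
        kinSeminorm α (timeBelow T ×ˢ univ) D2u ≤
          N * (linftyHolderSeminorm α (timeBelow T) univ Yu +
            linftyHolderSeminorm α (timeBelow T) univ (laplV D2u)) := by
  obtain ⟨C, hC, h⟩ := exists_kinSeminorm_hess_le hd hα₀ hα₁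
  refine ⟨C.toNNReal + 1, ?_⟩
  rintro T u ⟨mu, -, ⟨D2u, wD2, mD2⟩, ⟨Yu, wY, mY⟩⟩
  have hIo := isOpen_timeBelow T
  have hI := isLowerSet_timeBelow T
  have hGo : IsOpen (timeBelow T ×ˢ (univ : Set (E d × E d))) := hIo.prod isOpen_univ
  obtain ⟨A, hA, hAlt⟩ := exists_lt_ofReal
    (ENNReal.add_lt_top.2 ⟨mu.2, ENNReal.add_lt_top.2 ⟨mD2.2, mY.2⟩⟩)
  have cu := Controlled.of_lt mu hA (le_self_add.trans_lt hAlt)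
  have cD2 := Controlled.apply_of_lt mD2 hA ((le_self_add.trans le_add_self).trans_lt hAlt)
  have cY := Controlled.of_lt mY hA ((le_add_self.trans le_add_self).trans_lt hAlt)
  refine ⟨⟨⟨mu.1, le_self_add.trans_lt mu.2, ?_⟩, ⟨Yu, wY, mY⟩, ⟨D2u, wD2, ?_⟩⟩, ?_⟩
  · exact (kinSeminorm_self_le hα₀ hα₁ hIo hI hA cu cY wY).trans_lt ENNReal.ofReal_lt_top
  · have hΔ : AEHol α (d * A) (timeBelow T) univ (laplV D2u) := by
      have := aeHol_sum fun i : Fin d => (cD2 (i, i)).hol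
      rwa [Fintype.card_fin] at this
    have hd' : (1 : ℝ) ≤ d := by exact_mod_cast hd
    have hY' : AEHol α (d * A) (timeBelow T) univ Yu := by
      obtain ⟨w, hw, hw'⟩ := cY.hol
      refine ⟨w, hw, ?_⟩
      filter_upwards [hw'] with t ht p hp q hq
      refine (ht p hp q hq).trans ?_
      have := Real.rpow_nonneg (dXV_nonneg p q) α
      gcongr
      nlinarith
    exact (h hIo hI hA (by positivity) cu cD2 cY wD2 wY hY' hΔ).trans_lt ENNReal.ofReal_lt_top
  · intro D2u' Yu' wD2' wY'
    have e1 := wD2'.ae_eq hGo wD2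
    rw [kinSeminorm_congr e1, linftyHolderSeminorm_congr (wY'.ae_eq hGo wY),
      linftyHolderSeminorm_congr (laplV_congr e1)]
    refine le_mul_of_forall_lt hC fun M hM hlt => ?_
    exact h hIo hI hA hM cu cD2 cY wD2 wY (aeHol_of_lt (le_self_add.trans_lt hlt))
      (aeHol_of_lt (le_add_self.trans_lt hlt))


/-! ### Cutoff functions -/

/-- `g` is bounded by `A` on `I × D`, and Hölder continuous in `(x, v) ∈ D` with constant `A`. -/
def BddHol (α A : ℝ) (I : Set ℝ) (D : Set (E d × E d)) (g : Z d → ℝ) : Prop :=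
  (∀ t ∈ I, ∀ p ∈ D, |g (t, p)| ≤ A) ∧ HolXV α A I D g

lemma BddHol.mono {α A B : ℝ} {I : Set ℝ} {D : Set (E d × E d)} {g : Z d → ℝ}
    (hg : BddHol α A I D g) (hAB : A ≤ B) : BddHol α B I D g := by
  refine ⟨fun t ht p hp => (hg.1 t ht p hp).trans hAB, fun t ht p hp q hq =>
    (hg.2 t ht p hp q hq).trans ?_⟩
  have := Real.rpow_nonneg (dXV_nonneg p q) α
  gcongr

lemma BddHol.sum {α A : ℝ} {I : Set ℝ} {D : Set (E d × E d)} {ι : Type*} [Fintype ι]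
    {g : ι → Z d → ℝ} (hg : ∀ i, BddHol α A I D (g i)) :
    BddHol α (Fintype.card ι * A) I D fun z => ∑ i, g i z := by
  refine ⟨fun t ht p hp => ?_, fun t ht p hp q hq => ?_⟩
  · refine (Finset.abs_sum_le_sum_abs _ _).trans ?_
    exact (Finset.sum_le_card_nsmul _ _ _ fun i _ => (hg i).1 t ht p hp).trans_eq (by simp)
  · rw [← Finset.sum_sub_distrib]
    refine (Finset.abs_sum_le_sum_abs _ _).trans ?_
    refine (Finset.sum_le_card_nsmul _ _ _ fun i _ => (hg i).2 t ht p hp q hq).trans_eq ?_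
    simp
    ring

lemma BddHol.add {α A B : ℝ} {I : Set ℝ} {D : Set (E d × E d)} {f g : Z d → ℝ}
    (hf : BddHol α A I D f) (hg : BddHol α B I D g) :
    BddHol α (A + B) I D fun z => f z + g z := by
  refine ⟨fun t ht p hp => (abs_add_le _ _).trans
    (add_le_add (hf.1 t ht p hp) (hg.1 t ht p hp)), fun t ht p hp q hq => ?_⟩
  rw [add_sub_add_comm, add_mul]
  exact (abs_add_le _ _).trans (add_le_add (hf.2 t ht p hp q hq) (hg.2 t ht p hp q hq))

lemma norm_sub_le_dXV {p q : E d × E d} (h : dXV p q ≤ 1) : ‖p - q‖ ≤ dXV p q := by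
  have h1 : 0 ≤ ‖p.1 - q.1‖ ^ (1 / 3 : ℝ) := by positivity
  have h2 := norm_nonneg (p.2 - q.2)
  have h3 : ‖p.1 - q.1‖ ^ (1 / 3 : ℝ) ≤ 1 := by
    unfold dXV at h
    linarith
  rw [Prod.norm_def]
  refine max_le ?_ (by simp only [Prod.snd_sub, dXV]; linarith)
  have e : ‖p.1 - q.1‖ = (‖p.1 - q.1‖ ^ (1 / 3 : ℝ)) ^ 3 := by
    rw [← Real.rpow_natCast, ← Real.rpow_mul (norm_nonneg _)]
    norm_num
  have h4 : ‖p.1 - q.1‖ ≤ ‖p.1 - q.1‖ ^ (1 / 3 : ℝ) := by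
    conv_lhs => rw [e]
    exact pow_le_of_le_one h1 h3 (by norm_num)
  simp only [Prod.fst_sub, dXV]
  linarith

/-- Multiplication by a smooth compactly supported function `c` that vanishes outside `D` at the
times in `J` turns functions on `I × D` into functions on the whole space. -/
lemma exists_bddHol_mul {α : ℝ} (hα₀ : 0 < α) (hα₁ : α < 1) {I J : Set ℝ} {D : Set (E d × E d)}
    {c : Z d → ℝ} (hc : ContDiff ℝ ∞ c) (hcc : HasCompactSupport c)
    (hcs : ∀ z, z.1 ∈ J → c z ≠ 0 → z.1 ∈ I ∧ z.2 ∈ D) :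
    ∃ K : ℝ, 0 ≤ K ∧ ∀ {A : ℝ} {g : Z d → ℝ}, 0 ≤ A → BddHol α A I D g →
      BddHol α (K * A) J univ fun z => c z * g z := by
  obtain ⟨K₁, hK₁, h₁⟩ := exists_norm_le_of_hasCompactSupport hc.continuous hcc
  obtain ⟨K₂, hK₂, h₂⟩ := exists_lipschitz_of_hasCompactSupport hc hcc
  have hcH : ∀ t (p q : E d × E d), |c (t, p) - c (t, q)| ≤ (2 * K₁ + K₂) * dXV p q ^ α := by
    intro t p q
    have hd0 := dXV_nonneg p q
    have hdα := Real.rpow_nonneg hd0 α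
    rcases le_total (dXV p q) 1 with h | h
    · have e1 : ‖((t, p) : Z d) - (t, q)‖ = ‖p - q‖ := by simp [Prod.norm_def]
      have e2 : dXV p q ≤ dXV p q ^ α := by
        rcases hd0.eq_or_lt with h0 | h0
        · rw [← h0, Real.zero_rpow hα₀.ne']
        · simpa using Real.rpow_le_rpow_of_exponent_ge h0 h hα₁.le
      calc |c (t, p) - c (t, q)| ≤ K₂ * ‖p - q‖ := by rw [← e1]; exact h₂ _ _
        _ ≤ K₂ * dXV p q ^ α := by
          gcongr
          exact (norm_sub_le_dXV h).trans e2
        _ ≤ _ := by gcongr; linarith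
    · have e2 : 1 ≤ dXV p q ^ α := Real.one_le_rpow h hα₀.le
      have h3 := (norm_sub_le (c (t, p)) (c (t, q))).trans (add_le_add (h₁ _) (h₁ _))
      rw [Real.norm_eq_abs] at h3
      nlinarith
  refine ⟨3 * K₁ + K₂, by positivity, fun {A g} hA hg => ⟨fun t ht p _ => ?_,
    fun t ht p _ q _ => ?_⟩⟩
  · beta_reduce
    rcases eq_or_ne (c (t, p)) 0 with h | h
    · rw [h, zero_mul, abs_zero]
      positivity
    · obtain ⟨m1, m2⟩ := hcs _ ht h
      rw [abs_mul]
      refine mul_le_mul ((h₁ (t, p)).trans ?_) (hg.1 t m1 p m2) (abs_nonneg _) (by positivity)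
      linarith
  · have hdα := Real.rpow_nonneg (dXV_nonneg p q) α
    have hcH' := hcH t p q
    beta_reduce
    rcases eq_or_ne (c (t, p)) 0 with hp | hp
    · rcases eq_or_ne (c (t, q)) 0 with hq | hq
      · rw [hp, hq, zero_mul, zero_mul, sub_zero, abs_zero]
        positivity
      · obtain ⟨m1, m2⟩ := hcs _ ht hq
        have e : c (t, p) * g (t, p) - c (t, q) * g (t, q) =
            (c (t, p) - c (t, q)) * g (t, q) := by rw [hp]; ring
        rw [e, abs_mul]
        calc _ ≤ (2 * K₁ + K₂) * dXV p q ^ α * A :=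
              mul_le_mul hcH' (hg.1 t m1 q m2) (abs_nonneg _) (by positivity)
          _ = (2 * K₁ + K₂) * A * dXV p q ^ α := by ring
          _ ≤ _ := by gcongr; linarith
    · obtain ⟨m1, m2⟩ := hcs _ ht hp
      rcases eq_or_ne (c (t, q)) 0 with hq | hq
      · have e : c (t, p) * g (t, p) - c (t, q) * g (t, q) =
            (c (t, p) - c (t, q)) * g (t, p) := by rw [hq]; ring
        rw [e, abs_mul]
        calc _ ≤ (2 * K₁ + K₂) * dXV p q ^ α * A :=
              mul_le_mul hcH' (hg.1 t m1 p m2) (abs_nonneg _) (by positivity)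
          _ = (2 * K₁ + K₂) * A * dXV p q ^ α := by ring
          _ ≤ _ := by gcongr; linarith
      · obtain ⟨-, m3⟩ := hcs _ ht hq
        have e : c (t, p) * g (t, p) - c (t, q) * g (t, q) =
            (c (t, p) - c (t, q)) * g (t, p) + c (t, q) * (g (t, p) - g (t, q)) := by ring
        rw [e]
        refine (abs_add_le _ _).trans ?_
        rw [abs_mul, abs_mul]
        calc _ ≤ (2 * K₁ + K₂) * dXV p q ^ α * A + K₁ * (A * dXV p q ^ α) :=
              add_le_add (mul_le_mul hcH' (hg.1 t m1 p m2) (abs_nonneg _) (by positivity))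
                (mul_le_mul (h₁ _) (hg.2 t m1 p m2 q m3) (abs_nonneg _) hK₁)
          _ = _ := by ring

lemma exists_bddHol_mul_family {α : ℝ} (hα₀ : 0 < α) (hα₁ : α < 1) {I J : Set ℝ}
    {D : Set (E d × E d)} {ι : Type*} [Fintype ι] {c : ι → Z d → ℝ}
    (hc : ∀ i, ContDiff ℝ ∞ (c i)) (hcc : ∀ i, HasCompactSupport (c i))
    (hcs : ∀ i z, z.1 ∈ J → c i z ≠ 0 → z.1 ∈ I ∧ z.2 ∈ D) :
    ∃ K : ℝ, 0 ≤ K ∧ ∀ {A : ℝ} {g : Z d → ℝ}, 0 ≤ A → BddHol α A I D g →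
      ∀ i, BddHol α (K * A) J univ fun z => c i z * g z := by
  choose K hK h using fun i => exists_bddHol_mul hα₀ hα₁ (hc i) (hcc i) (hcs i)
  refine ⟨∑ i, K i, Finset.sum_nonneg fun i _ => hK i, fun {A g} hA hg i => ?_⟩
  refine (h i hA hg).mono ?_
  gcongr
  exact Finset.single_le_sum (fun i _ => hK i) (Finset.mem_univ i)

/-! ### Product rules -/

lemma fderiv_mul_apply {f g : Z d → ℝ} (hf : ContDiff ℝ ∞ f) (hg : ContDiff ℝ ∞ g) (z y : Z d) :
    fderiv ℝ (fun z => f z * g z) z y = f z * fderiv ℝ g z y + fderiv ℝ f z y * g z := by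
  rw [fderiv_fun_mul (hf.differentiable (by simp) z) (hg.differentiable (by simp) z)]
  simp [mul_comm]

lemma transport_mul {f g : Z d → ℝ} (hf : ContDiff ℝ ∞ f) (hg : ContDiff ℝ ∞ g) (z : Z d) :
    transport (fun z => f z * g z) z = f z * transport g z + transport f z * g z :=
  fderiv_mul_apply hf hg z _

lemma DV_mul {f g : Z d → ℝ} (hf : ContDiff ℝ ∞ f) (hg : ContDiff ℝ ∞ g) (e : E d) :
    DV e (fun z => f z * g z) = fun z => f z * DV e g z + DV e f z * g z :=
  funext fun z => fderiv_mul_apply hf hg z _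

lemma partialV_partialV_mul {f g : Z d → ℝ} (hf : ContDiff ℝ ∞ f) (hg : ContDiff ℝ ∞ g)
    (i j : Fin d) (z : Z d) :
    partialV i (partialV j fun z => f z * g z) z =
      f z * partialV i (partialV j g) z + partialV i f z * partialV j g z +
        (partialV j f z * partialV i g z + partialV i (partialV j f) z * g z) := by
  simp only [partialV_eq_DV]
  set a : E d := EuclideanSpace.single i 1
  set b : E d := EuclideanSpace.single j 1
  rw [DV_mul hf hg, DV]
  have h1 := hf.mul (contDiff_DV hg b)
  have h2 := (contDiff_DV hf b).mul hg
  rw [fderiv_fun_add (h1.differentiable (by simp) z) (h2.differentiable (by simp) z),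
    add_apply, fderiv_mul_apply hf (contDiff_DV hg b), fderiv_mul_apply (contDiff_DV hf b) hg]
  rfl

lemma DV_eventuallyEq {f g : Z d → ℝ} {z : Z d} (h : f =ᶠ[𝓝 z] g) (e : E d) :
    DV e f =ᶠ[𝓝 z] DV e g :=
  (h.fderiv (𝕜 := ℝ)).mono fun ζ hζ => by simp only [DV, hζ]

lemma hasCompactSupport_DV {c : Z d → ℝ} (hc : HasCompactSupport c) (e : E d) :
    HasCompactSupport (DV e c) :=
  (hc.fderiv ℝ).mono fun z hz h => hz (by simp [DV, h])

lemma tsupport_DV_subset (c : Z d → ℝ) (e : E d) : tsupport (DV e c) ⊆ tsupport c :=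
  (closure_mono (s := Function.support (DV e c)) (t := Function.support (fderiv ℝ c))
    fun z hz h => hz (by simp [DV, h])).trans (tsupport_fderiv_subset ℝ)

/-- A cutoff function between two kinetic cylinders. Its support leaves the larger cylinder through
the final time `0`, since the a priori estimate only looks into the past. -/
lemma exists_cutoff {r R : ℝ} (hr : 0 < r) (hrR : r < R) :
    ∃ χ : Z d → ℝ, ContDiff ℝ ∞ χ ∧ HasCompactSupport χ ∧
      (∀ z ∈ cylTime r ×ˢ cylSpace d r, χ z = 1) ∧
      ∀ z ∈ tsupport χ, z.1 < 0 → z.1 ∈ cylTime R ∧ z.2 ∈ cylSpace d R := by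
  obtain ⟨a, hra, haR⟩ := exists_between hrR
  have ha : 0 < a := hr.trans hra
  let s : Set (Z d) := Ioo (-(a ^ 2)) 1 ×ˢ Metric.ball 0 (a ^ 3) ×ˢ Metric.ball 0 a
  let k : Set (Z d) := Icc (-(r ^ 2)) 0 ×ˢ Metric.closedBall 0 (r ^ 3) ×ˢ Metric.closedBall 0 r
  have hs : IsOpen s := isOpen_Ioo.prod (Metric.isOpen_ball.prod Metric.isOpen_ball)
  have hk : IsClosed k := isClosed_Icc.prod (Metric.isClosed_closedBall.prod
    Metric.isClosed_closedBall)
  have hks : k ⊆ s := by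
    rintro ⟨t, x, v⟩ ⟨ht, hx, hv⟩
    have h2 : r ^ 2 < a ^ 2 := by gcongr
    have h3 : r ^ 3 < a ^ 3 := by gcongr
    exact ⟨⟨by linarith [ht.1], by linarith [ht.2]⟩, Metric.closedBall_subset_ball h3 hx,
      Metric.closedBall_subset_ball hra hv⟩
  obtain ⟨χ, h0, h1, -⟩ := exists_contMDiffMap_zero_one_of_isClosed (n := ⊤)
    (modelWithCornersSelf ℝ (Z d)) hs.isClosed_compl hk (disjoint_compl_left_iff_subset.2 hks)
  have hts : tsupport (χ : Z d → ℝ) ⊆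
      Icc (-(a ^ 2)) 1 ×ˢ Metric.closedBall 0 (a ^ 3) ×ˢ Metric.closedBall 0 a := by
    refine closure_minimal (fun z hz => ?_) (isClosed_Icc.prod (Metric.isClosed_closedBall.prod
      Metric.isClosed_closedBall))
    by_contra hn
    refine hz (h0 fun hzs => hn ?_)
    exact ⟨Ioo_subset_Icc_self hzs.1, Metric.ball_subset_closedBall hzs.2.1,
      Metric.ball_subset_closedBall hzs.2.2⟩
  refine ⟨χ, contMDiff_iff_contDiff.1 χ.contMDiff, ?_, ?_, ?_⟩
  · exact (isCompact_Icc.prod ((isCompact_closedBall _ _).prod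
      (isCompact_closedBall _ _))).of_isClosed_subset (isClosed_tsupport _) hts
  · intro z hz
    exact h1 ⟨Ioo_subset_Icc_self hz.1, Metric.ball_subset_closedBall hz.2.1,
      Metric.ball_subset_closedBall hz.2.2⟩
  · intro z hz hneg
    obtain ⟨ht, hx, hv⟩ := hts hz
    have h2 : a ^ 2 < R ^ 2 := by gcongr
    have h3 : a ^ 3 < R ^ 3 := by gcongr
    exact ⟨⟨by linarith [ht.1], hneg⟩, Metric.closedBall_subset_ball h3 hx,
      Metric.closedBall_subset_ball haR hv⟩

/-- The interior estimate for smooth functions: the a priori estimate for negative times is applied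
to a product with a cutoff function. -/
lemma exists_smooth_interior_bound (hd : 1 ≤ d) {α : ℝ} (hα₀ : 0 < α) (hα₁ : α < 1) {r R : ℝ}
    (hr : 0 < r) (hrR : r < R) :
    ∃ C : ℝ, 0 ≤ C ∧ ∀ {A : ℝ} {W : Z d → ℝ}, 0 ≤ A → ContDiff ℝ ∞ W →
      BddHol α A (cylTime R) (cylSpace d R) W →
      (∀ i, BddHol α A (cylTime R) (cylSpace d R) (partialV i W)) →
      (∀ i j, BddHol α A (cylTime R) (cylSpace d R) (partialV i (partialV j W))) →
      BddHol α A (cylTime R) (cylSpace d R) (transport W) →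
      ∀ z ∈ cylTime r ×ˢ cylSpace d r, ∀ z' ∈ cylTime r ×ˢ cylSpace d r,
        |W z - W z'| ≤ C * A * rho z z' ^ α ∧
        ∀ i j, |partialV i (partialV j W) z - partialV i (partialV j W) z'| ≤
          C * A * rho z z' ^ α := by
  obtain ⟨χ, hχ, hχc, hχ1, hχs⟩ := exists_cutoff (d := d) hr hrR
  obtain ⟨C, hC, h⟩ := exists_kinetic_bound hd hα₀ hα₁
  have hnz : ∀ {c : Z d → ℝ}, tsupport c ⊆ tsupport χ →
      ∀ z : Z d, z.1 ∈ Iio (0 : ℝ) → c z ≠ 0 → z.1 ∈ cylTime R ∧ z.2 ∈ cylSpace d R :=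
    fun hc z hz h0 => hχs z (hc (subset_tsupport _ h0)) hz
  obtain ⟨K₀, hK₀, m₀⟩ := exists_bddHol_mul hα₀ hα₁ hχ hχc (hnz subset_rfl)
  obtain ⟨K₁, hK₁, m₁⟩ := exists_bddHol_mul_family hα₀ hα₁ (c := fun i => partialV i χ)
    (fun i => contDiff_DV hχ _) (fun i => hasCompactSupport_DV hχc _)
    fun i => hnz (tsupport_DV_subset _ _)
  obtain ⟨K₂, hK₂, m₂⟩ := exists_bddHol_mul_family hα₀ hα₁
    (c := fun ij : Fin d × Fin d => partialV ij.1 (partialV ij.2 χ))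
    (fun i => contDiff_DV (contDiff_DV hχ _) _)
    (fun i => hasCompactSupport_DV (hasCompactSupport_DV hχc _) _)
    fun i => hnz ((tsupport_DV_subset _ _).trans (tsupport_DV_subset _ _))
  have hYsub : Function.support (transport χ) ⊆ Function.support (fderiv ℝ χ) :=
    fun z hz h => hz (by simp [transport, h])
  obtain ⟨K₃, hK₃, m₃⟩ := exists_bddHol_mul hα₀ hα₁ (contDiff_transport hχ)
    ((hχc.fderiv ℝ).mono hYsub)
    (hnz ((closure_mono hYsub).trans (tsupport_fderiv_subset ℝ)))
  set K := K₀ + 2 * K₁ + K₂ + K₃ with hK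
  have hK0 : 0 ≤ K := by positivity
  have hd' : (1 : ℝ) ≤ d := by exact_mod_cast hd
  refine ⟨8 * K + 3 * (C * (d * K)), by positivity, ?_⟩
  intro A W hA hW bW bD bD2 bY z hz z' hz'
  set U : Z d → ℝ := fun z => χ z * W z with hUdef
  have hU : ContDiff ℝ ∞ U := hχ.mul hW
  have cU : BddHol α (K * A) (Iio 0) univ U := (m₀ hA bW).mono (by gcongr; linarith)
  have cD2 : ∀ i j, BddHol α (K * A) (Iio 0) univ (partialV i (partialV j U)) := by
    intro i j
    rw [funext fun z => partialV_partialV_mul hχ hW i j z]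
    refine (((m₀ hA (bD2 i j)).add (m₁ hA (bD j) i)).add
      ((m₁ hA (bD i) j).add (m₂ hA bW (i, j)))).mono ?_
    rw [hK]
    nlinarith [mul_nonneg hK₃ hA]
  have cY : BddHol α (K * A) (Iio 0) univ (transport U) := by
    rw [funext fun z => transport_mul hχ hW z]
    refine ((m₀ hA bY).add (m₃ hA bW)).mono ?_
    rw [hK]
    nlinarith [mul_nonneg hK₁ hA, mul_nonneg hK₂ hA]
  have cΔ : BddHol α (d * (K * A)) (Iio 0) univ (lapZ U) := by
    have := BddHol.sum fun i : Fin d => cD2 i i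
    rwa [Fintype.card_fin] at this
  have hKA : K * A ≤ d * (K * A) := by nlinarith [mul_nonneg hK0 hA]
  have hρ : 0 ≤ rho z z' ^ α :=
    Real.rpow_nonneg ((norm_nonneg _).trans ((le_max_right _ _).trans (le_max_right _ _))) α
  have key₁ := kinetic_bound_self hα₀ hα₁ (mul_nonneg hK0 hA) (isLowerSet_Iio 0) hU
    (fun t ht p => cU.1 t ht p (mem_univ p)) cU.2 (fun t ht p => cY.1 t ht p (mem_univ p))
    z z' hz.1.2 hz'.1.2
  have key₂ := h (Γ := (d : ℝ) ^ 2 * (K * A)) (M := d * (K * A)) (by positivity) (by positivity)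
    (isLowerSet_Iio 0) hU (fun t ht p => cU.1 t ht p (mem_univ p))
    (hol_DV_DV hU fun i j => (cD2 i j).2) (cY.mono hKA).2 cΔ.2
  have hQ : IsOpen (cylTime r ×ˢ cylSpace d r) :=
    isOpen_Ioo.prod (Metric.isOpen_ball.prod Metric.isOpen_ball)
  have hloc : ∀ z ∈ cylTime r ×ˢ cylSpace d r, U =ᶠ[𝓝 z] W := fun z hz => by
    filter_upwards [hQ.mem_nhds hz] with ζ hζ
    simp [hUdef, hχ1 ζ hζ]
  have eD2 : ∀ z ∈ cylTime r ×ˢ cylSpace d r, ∀ i j,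
      partialV i (partialV j U) z = partialV i (partialV j W) z := fun z hz i j =>
    (DV_eventuallyEq (DV_eventuallyEq (hloc z hz) _) _).eq_of_nhds
  constructor
  · rw [← (hloc z hz).eq_of_nhds, ← (hloc z' hz').eq_of_nhds]
    refine key₁.trans ?_
    rw [← mul_assoc]
    gcongr
    have : 0 ≤ 3 * (C * (d * K)) := by positivity
    linarith
  · intro i j
    rw [← eD2 z hz, ← eD2 z' hz']
    refine (abs_partialV_sub_le hU (K := C * (d * (K * A)) * rho z z' ^ α)
      (fun e => (key₂ e z z' hz.1.2 hz'.1.2).trans_eq (by ring)) i j).trans ?_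
    have : 0 ≤ 8 * K * (A * rho z z' ^ α) := by positivity
    linarith


/-! ### Restriction to smaller domains -/

section Restrict

variable {G G₀ : Set (Z d)}

lemma IsTest.mono {φ : Z d → ℝ} (hφ : IsTest G₀ φ) (h : G₀ ⊆ G) : IsTest G φ :=
  ⟨hφ.smooth, hφ.compact, hφ.support.trans h⟩

lemma setIntegral_eq_of_subset {f : Z d → ℝ} (h : G₀ ⊆ G) (hf : Function.support f ⊆ G₀) :
    ∫ z in G₀, f z = ∫ z in G, f z := by
  rw [setIntegral_eq_integral_of_forall_compl_eq_zero fun z hz =>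
      Function.notMem_support.1 fun h' => hz (hf h'),
    setIntegral_eq_integral_of_forall_compl_eq_zero fun z hz =>
      Function.notMem_support.1 fun h' => hz (h (hf h'))]

lemma setIntegral_mul_eq_of_subset {f g : Z d → ℝ} (h : G₀ ⊆ G) (hg : tsupport g ⊆ G₀) :
    ∫ z in G₀, f z * g z = ∫ z in G, f z * g z :=
  setIntegral_eq_of_subset h fun z hz =>
    hg (subset_tsupport _ fun h0 => hz (by simp [h0]))

lemma tsupport_transport_subset (c : Z d → ℝ) : tsupport (transport c) ⊆ tsupport c :=
  (closure_mono (s := Function.support (transport c)) (t := Function.support (fderiv ℝ c))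
    fun z hz h => hz (by simp [transport, h])).trans (tsupport_fderiv_subset ℝ)

lemma IsWeakHessV.mono {u : Z d → ℝ} {D2u : Z d → EuclideanSpace ℝ (Fin d × Fin d)}
    (h : IsWeakHessV G u D2u) (hs : G₀ ⊆ G) : IsWeakHessV G₀ u D2u where
  locInt := h.locInt.mono_set hs
  locInt_deriv := h.locInt_deriv.mono_set hs
  integral_eq φ hφ i j := by
    have h2 : tsupport (partialV i (partialV j φ)) ⊆ G₀ :=
      ((tsupport_DV_subset _ _).trans (tsupport_DV_subset _ _)).trans hφ.support
    rw [setIntegral_mul_eq_of_subset hs hφ.support, setIntegral_mul_eq_of_subset hs h2]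
    exact h.integral_eq φ (hφ.mono hs) i j

lemma IsWeakTransport.mono {u Yu : Z d → ℝ} (h : IsWeakTransport G u Yu) (hs : G₀ ⊆ G) :
    IsWeakTransport G₀ u Yu where
  locInt := h.locInt.mono_set hs
  locInt_deriv := h.locInt_deriv.mono_set hs
  integral_eq φ hφ := by
    rw [setIntegral_mul_eq_of_subset hs hφ.support, setIntegral_mul_eq_of_subset hs
      ((tsupport_transport_subset _).trans hφ.support)]
    exact h.integral_eq φ (hφ.mono hs)

variable {F : Type*} [NormedAddCommGroup F]

lemma linftyNorm_mono {u : Z d → F} (hs : G₀ ⊆ G) : linftyNorm G₀ u ≤ linftyNorm G u :=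
  eLpNormEssSup_mono_measure _ (Measure.restrict_mono hs le_rfl).absolutelyContinuous

lemma linftyHolderSeminorm_mono {α : ℝ} {I I₀ : Set ℝ} {D D₀ : Set (E d × E d)} {u : Z d → F}
    (hI : I₀ ⊆ I) (hD : D₀ ⊆ D) :
    linftyHolderSeminorm α I₀ D₀ u ≤ linftyHolderSeminorm α I D u := by
  refine le_iInf₂ fun w hw => ?_
  refine iInf₂_le_of_le w
    (ae_mono (Measure.restrict_mono (prod_mono hI hD) le_rfl) hw) ?_
  refine (essSup_mono_measure (Measure.restrict_mono hI le_rfl).absolutelyContinuous).trans ?_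
  refine essSup_mono_ae (Eventually.of_forall fun t => ?_)
  exact iSup_le fun p => iSup_le fun hp => iSup_le fun q => iSup_le fun hq => iSup_le fun hpq =>
    le_iSup_of_le p (le_iSup_of_le (hD hp) (le_iSup_of_le q (le_iSup_of_le (hD hq)
      (le_iSup_of_le hpq le_rfl))))

lemma MemLinftyHolder.mono {α : ℝ} {I I₀ : Set ℝ} {D D₀ : Set (E d × E d)} {u : Z d → F}
    (h : MemLinftyHolder α I D u) (hI : I₀ ⊆ I) (hD : D₀ ⊆ D) : MemLinftyHolder α I₀ D₀ u :=
  ⟨h.1.mono_measure (Measure.restrict_mono (prod_mono hI hD) le_rfl),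
    (add_le_add (linftyNorm_mono (prod_mono hI hD))
      (linftyHolderSeminorm_mono hI hD)).trans_lt h.2⟩

end Restrict

/-! ### The interior estimate -/

lemma isOpen_cyl (r : ℝ) : IsOpen (cylTime r ×ˢ cylSpace d r) :=
  isOpen_Ioo.prod (Metric.isOpen_ball.prod Metric.isOpen_ball)

lemma cylTime_subset {r R : ℝ} (hr : 0 < r) (hrR : r < R) : cylTime r ⊆ cylTime R := by
  have : r ^ 2 ≤ R ^ 2 := by gcongr
  exact Ioo_subset_Ioo_left (neg_le_neg this)

lemma cylSpace_subset {r R : ℝ} (hr : 0 < r) (hrR : r < R) : cylSpace d r ⊆ cylSpace d R := by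
  have : r ^ 3 ≤ R ^ 3 := by gcongr
  exact prod_mono (Metric.ball_subset_ball this) (Metric.ball_subset_ball hrR.le)

/-- Mollifications at small scales at points of the smaller cylinder only involve values on the
larger one. -/
lemma eventually_reaches_cyl {r R : ℝ} (hr : 0 < r) (hrR : r < R) {ε : ℕ → ℝ}
    (hε : ∀ n, 0 < ε n) (hlim : Tendsto ε atTop (𝓝 0)) {φ : ℕ → Z d → ℝ}
    (hφ : ∀ n, IsMollifier (ε n) (φ n)) :
    ∀ᶠ n in atTop, ∀ z ∈ cylTime r ×ˢ cylSpace d r,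
      Reaches (cylTime R ×ˢ cylSpace d R) (φ n) z := by
  have h2 : 0 < R ^ 2 - r ^ 2 := sub_pos.2 (by gcongr)
  have h3 : 0 < R ^ 3 - r ^ 3 := sub_pos.2 (by gcongr)
  have hl : Tendsto (fun n => (1 + r ^ 2) * (3 * ε n)) atTop (𝓝 0) := by
    simpa using (hlim.const_mul 3).const_mul (1 + r ^ 2)
  filter_upwards [hl.eventually_lt_const h2, hl.eventually_lt_const h3,
    hl.eventually_lt_const (sub_pos.2 hrR)] with n n1 n2 n3 z hz z₀ hz₀
  have hεn := hε n
  have hle : ‖trl z₀ z - z‖ ≤ (1 + r ^ 2) * (3 * ε n) := by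
    refine (norm_trl_sub_le z₀ z).trans ?_
    have : |z.1| ≤ r ^ 2 := abs_le.2 ⟨hz.1.1.le, hz.1.2.le.trans (by positivity)⟩
    gcongr
    exact (hφ n).norm_le z₀ hz₀
  have k1 := (norm_fst_le (trl z₀ z - z)).trans hle
  have k2 := ((norm_fst_le (trl z₀ z - z).2).trans (norm_snd_le _)).trans hle
  have k3 := ((norm_snd_le (trl z₀ z - z).2).trans (norm_snd_le _)).trans hle
  have hx := mem_ball_zero_iff.1 hz.2.1
  have hv := mem_ball_zero_iff.1 hz.2.2
  simp only [Prod.fst_sub, Prod.snd_sub] at k1 k2 k3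
  refine ⟨⟨?_, ?_⟩, mem_ball_zero_iff.2 ?_, mem_ball_zero_iff.2 ?_⟩
  · rw [Real.norm_eq_abs, abs_le] at k1
    have := hz.1.1
    linarith [k1.1]
  · have := (hφ n).neg z₀ hz₀
    have h' := hz.1.2
    simp only [trl]
    linarith
  · have := norm_le_norm_add_norm_sub' (trl z₀ z).2.1 z.2.1
    linarith
  · have := norm_le_norm_add_norm_sub' (trl z₀ z).2.2 z.2.2
    linarith

lemma Controlled.bddHol_moll {α A ε : ℝ} {φ : Z d → ℝ} {I I₀ : Set ℝ} {D D₀ : Set (E d × E d)}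
    {f g : Z d → ℝ} (hg : Controlled α A I D g) (hφ : IsMollifier ε φ) (hI : MeasurableSet I)
    (hD : MeasurableSet D) (hA : 0 ≤ A) (hR : ∀ z ∈ I₀ ×ˢ D₀, Reaches (I ×ˢ D) φ z)
    (hf : ∀ z ∈ I₀ ×ˢ D₀, f z = moll φ ((I ×ˢ D).indicator g) z) : BddHol α A I₀ D₀ f := by
  refine ⟨fun t ht p hp => ?_, fun t ht p hp q hq => ?_⟩
  · rw [hf (t, p) ⟨ht, hp⟩]
    exact abs_moll_le hφ (hI.prod hD) hA hg.bound _
  · rw [hf (t, p) ⟨ht, hp⟩, hf (t, q) ⟨ht, hq⟩]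
    exact hol_moll hφ hI hD (hg.locallyIntegrable hI hD) hg.hol (hR (t, p) ⟨ht, hp⟩)
      (hR (t, q) ⟨ht, hq⟩)

lemma exists_cyl_bound (hd : 1 ≤ d) {α : ℝ} (hα₀ : 0 < α) (hα₁ : α < 1) {r R : ℝ}
    (hr : 0 < r) (hrR : r < R) :
    ∃ C : ℝ, 0 ≤ C ∧ ∀ {A : ℝ} {u Yu : Z d → ℝ} {Du : Z d → E d}
      {D2u : Z d → EuclideanSpace ℝ (Fin d × Fin d)}, 0 ≤ A →
      Controlled α A (cylTime R) (cylSpace d R) u →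
      (∀ i, Controlled α A (cylTime R) (cylSpace d R) fun z => Du z i) →
      (∀ ij, Controlled α A (cylTime R) (cylSpace d R) fun z => D2u z ij) →
      Controlled α A (cylTime R) (cylSpace d R) Yu →
      IsWeakGradV (cylTime R ×ˢ cylSpace d R) u Du →
      IsWeakHessV (cylTime R ×ˢ cylSpace d R) u D2u →
      IsWeakTransport (cylTime R ×ˢ cylSpace d R) u Yu →
      kinSeminorm α (cylTime r ×ˢ cylSpace d r) u ≤ ENNReal.ofReal (C * A) ∧
      kinSeminorm α (cylTime r ×ˢ cylSpace d r) D2u ≤ ENNReal.ofReal (C * A) := by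
  obtain ⟨b, hrb, hbR⟩ := exists_between hrR
  have hb : 0 < b := hr.trans hrb
  obtain ⟨C, hC, h⟩ := exists_smooth_interior_bound hd hα₀ hα₁ hr hrb
  set N : ℝ := ((Fintype.card (Fin d × Fin d) : ℕ) : ℝ) with hN
  have hN1 : 0 ≤ N := by positivity
  refine ⟨(1 + N) * C, by positivity, ?_⟩
  intro A u Yu Du D2u hA cu cD cD2 cY wD wD2 wY
  obtain ⟨ε, φ, hε, hlim, hφ⟩ := exists_mollifiers (d := d)
  have hI : MeasurableSet (cylTime R) := measurableSet_Ioo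
  have hD : MeasurableSet (cylSpace d R) :=
    (Metric.isOpen_ball.prod Metric.isOpen_ball).measurableSet
  have hG : MeasurableSet (cylTime R ×ˢ cylSpace d R) := hI.prod hD
  have hsub : cylTime r ×ˢ cylSpace d r ⊆ cylTime R ×ˢ cylSpace d R :=
    prod_mono (cylTime_subset hr hrR) (cylSpace_subset hr hrR)
  have hbsub : cylTime r ×ˢ cylSpace d r ⊆ cylTime b ×ˢ cylSpace d b :=
    prod_mono (cylTime_subset hr hrb) (cylSpace_subset hr hrb)
  have hul := cu.locallyIntegrable hI hD
  have key : ∀ᶠ n in atTop, ∀ z ∈ cylTime r ×ˢ cylSpace d r,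
      ∀ z' ∈ cylTime r ×ˢ cylSpace d r,
      |moll (φ n) ((cylTime R ×ˢ cylSpace d R).indicator u) z -
        moll (φ n) ((cylTime R ×ˢ cylSpace d R).indicator u) z'| ≤ C * A * rho z z' ^ α ∧
      ∀ ij, |moll (φ n) ((cylTime R ×ˢ cylSpace d R).indicator fun z => D2u z ij) z -
        moll (φ n) ((cylTime R ×ˢ cylSpace d R).indicator fun z => D2u z ij) z'| ≤
          C * A * rho z z' ^ α := by
    filter_upwards [eventually_reaches_cyl hb hbR hε hlim hφ] with n hn
    have hbh : ∀ {f g : Z d → ℝ}, Controlled α A (cylTime R) (cylSpace d R) g →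
        (∀ z ∈ cylTime b ×ˢ cylSpace d b,
          f z = moll (φ n) ((cylTime R ×ˢ cylSpace d R).indicator g) z) →
        BddHol α A (cylTime b) (cylSpace d b) f :=
      fun cg hf => cg.bddHol_moll (hφ n) hI hD hA hn hf
    have hs := (hφ n).smooth
    have hc := (hφ n).compact
    have hess := fun z hz (ij : Fin d × Fin d) =>
      partialV_partialV_moll hG hs hc hul wD2 (hn z hz) ij.1 ij.2
    intro z hz z' hz'
    have := h hA (contDiff_moll hs hc hul) (hbh cu fun _ _ => rfl)
      (fun i => hbh (cD i) fun z hz => partialV_moll hG hs hc hul wD (hn z hz) i)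
      (fun i j => hbh (cD2 (i, j)) fun z hz => hess z hz (i, j))
      (hbh cY fun z hz => transport_moll_indicator hG hs hc hul wY (hn z hz)) z hz z' hz'
    refine ⟨this.1, fun ij => ?_⟩
    have h2 := this.2 ij.1 ij.2
    rwa [hess z (hbsub hz) ij, hess z' (hbsub hz') ij] at h2
  have hCA : 0 ≤ C * A := by positivity
  constructor
  · refine (kinSeminorm_le_of_moll_real hε hlim hφ hG (isOpen_cyl r).measurableSet hsub hA
      hCA cu.meas cu.bound fun z hz z' hz' => ?_).trans (ENNReal.ofReal_le_ofReal ?_)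
    · filter_upwards [key] with n hn using (hn z hz z' hz').1
    · nlinarith
  · refine (kinSeminorm_le_of_moll hε hlim hφ hG (isOpen_cyl r).measurableSet hsub hA hCA
      (fun i => (cD2 i).meas) (fun i => (cD2 i).bound) fun z hz z' hz' => ?_).trans
      (ENNReal.ofReal_le_ofReal ?_)
    · filter_upwards [key] with n hn using (hn z hz z' hz').2
    · rw [← hN]
      nlinarith

lemma exists_interior_estimate (hd : 1 ≤ d) {α : ℝ} (hα₀ : 0 < α) (hα₁ : α < 1) {r R : ℝ}
    (hr : 0 < r) (hrR : r < R) :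
    ∃ N : ℝ≥0, ∀ u : Z d → ℝ, MemC2 α (cylTime R) (cylSpace d R) u →
      MemKin2 α (cylTime r) (cylSpace d r) u ∧
      ∀ (Du : Z d → E d) (D2u : Z d → EuclideanSpace ℝ (Fin d × Fin d)) (Yu : Z d → ℝ),
        IsWeakGradV (cylTime R ×ˢ cylSpace d R) u Du →
        IsWeakHessV (cylTime R ×ˢ cylSpace d R) u D2u →
        IsWeakTransport (cylTime R ×ˢ cylSpace d R) u Yu →
        kinSeminorm α (cylTime r ×ˢ cylSpace d r) D2u ≤
          N * c2Norm α (cylTime R) (cylSpace d R) u Du D2u Yu := by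
  obtain ⟨C, hC, h⟩ := exists_cyl_bound hd hα₀ hα₁ hr hrR
  have h' : ∀ {A : ℝ} {u Yu : Z d → ℝ} {Du : Z d → E d}
      {D2u : Z d → EuclideanSpace ℝ (Fin d × Fin d)}, 0 ≤ A →
      IsWeakGradV (cylTime R ×ˢ cylSpace d R) u Du →
      IsWeakHessV (cylTime R ×ˢ cylSpace d R) u D2u →
      IsWeakTransport (cylTime R ×ˢ cylSpace d R) u Yu →
      c2Norm α (cylTime R) (cylSpace d R) u Du D2u Yu < ENNReal.ofReal A →
      kinSeminorm α (cylTime r ×ˢ cylSpace d r) u ≤ ENNReal.ofReal (C * A) ∧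
      kinSeminorm α (cylTime r ×ˢ cylSpace d r) D2u ≤ ENNReal.ofReal (C * A) := by
    intro A u Yu Du D2u hA wD wD2 wY hlt
    have l4 := le_add_self.trans_lt hlt
    have l3 := (le_add_self.trans le_self_add).trans_lt hlt
    have l2 := ((le_add_self.trans le_self_add).trans le_self_add).trans_lt hlt
    have l1 := ((le_self_add.trans le_self_add).trans le_self_add).trans_lt hlt
    exact h hA
      (.of_lt ⟨wD.locInt.aestronglyMeasurable, l1.trans ENNReal.ofReal_lt_top⟩ hA l1)
      (.apply_of_lt ⟨wD.locInt_deriv.aestronglyMeasurable, l2.trans ENNReal.ofReal_lt_top⟩ hA l2)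
      (.apply_of_lt ⟨wD2.locInt_deriv.aestronglyMeasurable, l3.trans ENNReal.ofReal_lt_top⟩ hA l3)
      (.of_lt ⟨wY.locInt_deriv.aestronglyMeasurable, l4.trans ENNReal.ofReal_lt_top⟩ hA l4)
      wD wD2 wY
  refine ⟨C.toNNReal + 1, fun u hu => ⟨?_, fun Du D2u Yu wD wD2 wY =>
    le_mul_of_forall_lt hC fun M hM hlt => (h' hM wD wD2 wY hlt).2⟩⟩
  obtain ⟨mu, ⟨Du, wD, mD⟩, ⟨D2u, wD2, mD2⟩, ⟨Yu, wY, mY⟩⟩ := hu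
  have hlt : c2Norm α (cylTime R) (cylSpace d R) u Du D2u Yu < ⊤ :=
    ENNReal.add_lt_top.2 ⟨ENNReal.add_lt_top.2 ⟨ENNReal.add_lt_top.2 ⟨mu.2, mD.2⟩, mD2.2⟩, mY.2⟩
  obtain ⟨A, hA, hAlt⟩ := exists_lt_ofReal hlt
  obtain ⟨k1, k2⟩ := h' hA wD wD2 wY hAlt
  have hI := cylTime_subset hr hrR
  have hD : cylSpace d r ⊆ cylSpace d R := cylSpace_subset hr hrR
  have mu' := mu.mono hI hD
  exact ⟨⟨mu'.1, le_self_add.trans_lt mu'.2, k1.trans_lt ENNReal.ofReal_lt_top⟩,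
    ⟨Yu, wY.mono (prod_mono hI hD), mY.mono hI hD⟩,
    ⟨D2u, wD2.mono (prod_mono hI hD), k2.trans_lt ENNReal.ofReal_lt_top⟩⟩

end KineticHolder

end

open KineticHolder in
theorem corollary1p8 (d : ℕ) (hd : 1 ≤ d) (α : ℝ) (hα₀ : 0 < α) (hα₁ : α < 1) :
    (∃ N : ℝ≥0, ∀ (T : WithTop ℝ) (u : Z d → ℝ), MemC2 α (timeBelow T) univ u →
      MemKin2 α (timeBelow T) univ u ∧
      ∀ (D2u : Z d → EuclideanSpace ℝ (Fin d × Fin d)) (Yu : Z d → ℝ),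
        IsWeakHessV (timeBelow T ×ˢ univ) u D2u →
        IsWeakTransport (timeBelow T ×ˢ univ) u Yu →
        kinSeminorm α (timeBelow T ×ˢ univ) D2u ≤
          N * (linftyHolderSeminorm α (timeBelow T) univ Yu +
            linftyHolderSeminorm α (timeBelow T) univ (laplV D2u))) ∧
    (∀ R r : ℝ, 0 < r → r < R → ∃ N : ℝ≥0, ∀ u : Z d → ℝ,
      MemC2 α (cylTime R) (cylSpace d R) u →
      MemKin2 α (cylTime r) (cylSpace d r) u ∧
      ∀ (Du : Z d → E d) (D2u : Z d → EuclideanSpace ℝ (Fin d × Fin d)) (Yu : Z d → ℝ),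
        IsWeakGradV (cylTime R ×ˢ cylSpace d R) u Du →
        IsWeakHessV (cylTime R ×ˢ cylSpace d R) u D2u →
        IsWeakTransport (cylTime R ×ˢ cylSpace d R) u Yu →
        kinSeminorm α (cylTime r ×ˢ cylSpace d r) D2u ≤
          N * c2Norm α (cylTime R) (cylSpace d R) u Du D2u Yu) := by
  exact ⟨exists_global_estimate hd hα₀ hα₁, fun R r hr hrR =>
    exists_interior_estimate hd hα₀ hα₁ hr hrR⟩
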